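/- **Setting.** Let $V=\mathbb R^9$ with orthonormal basis $e_1,\dots,e_9$ and let $\gamma_1,\dots,\gamma_9$ act on an irreducible ($16$-dimensional, complex) Clifford module $S(V)$, with $\gamma_i\gamma_j+\gamma_j\gamma_i=-2\delta_{ij}$. Let $C_V$ be a non-degenerate symmetric complex bilinear form on $S(V)$ for which all $\gamma_i$ are self-adjoint. Let $W=\mathbb R^{1,1}\oplus V$ with null vectors $e_\pm$, $\langle e_+,e_-\rangle=1$, and $S(W)=\mathbb C^2\otimes S(V)$ with $$\Gamma_+=\sqrt2E_{12}\otimes 1,\quad \Gamma_-=-\sqrt2E_{21}\otimes 1,\quad \Gamma_i=\mathrm{diag}(-1,1)\otimes\gamma_i,\quad C=\begin{pmatrix}0&-i\\ i&0\end{pmatrix}\otimes C_V .$$ Write $S(W)=S^-\oplus S^+$ for the first and second copy of $S(V)$ (so $S^-=\ker\Gamma_+$) and $\xi=\xi_1+\xi_2$ accordingly. An endomorphism of $S(V)$ acts on $S(W)$ by acting on both copies. Put $X^\pm=\frac12(1\pm\gamma_1\gamma_2\gamma_3\gamma_4)$ and, for parameters $\alpha_\pm,\alpha'_\pm\in\mathbb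 C$, $$\bar c=(\alpha_+X^++\alpha_-X^-)\gamma_1\gamma_2\gamma_5,\quad d=(\alpha'_+X^++\alpha'_-X^-)\gamma_1\gamma_2\gamma_5,\quad s_{\bar c,d}(e_i)=\bar c\gamma_i-\gamma_id,\quad s_{d,\bar c}(e_i)=d\gamma_i-\gamma_i\bar c .$$ Assume that $$B=-\mathrm{diag}\big((\alpha_--\alpha'_+)^2\mathbb 1_2,(\alpha_-+\alpha'_+)^2\mathbb 1_2,(\alpha_+-\alpha'_+)^2\mathbb 1_1,(\alpha_++\alpha'_+)^2\mathbb 1_4\big)=\mathrm{diag}(B_1,\dots,B_9)$$ is real (for example, that the parameters are real). Let $\lambda_i=-i(\alpha_-\mp\alpha'_+)$ for $i=1,2$ (upper sign) and $i=3,4$ (lower sign), and $\lambda_i=-i(\alpha_+\mp\alpha'_+)$ for $i=5$ (upper sign) and $i=6,\dots,9$ (lower sign), so that $\lambda_i^2=B_i$. Let $M_B=\mathbb R^{11}$ with coordinates $x^+,x^-,x^1,\dots,x^9$ and metric $g_B=2dx^+dx^--\sum_iB_i(x^i)^2(dx^-)^2+\sum_i(dx^i)^2$. Its spinor bundle $S$,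 with fibre $S(W)$, is trivialized by the frame $\partial_+,\ \partial_-+\frac12\sum_iB_i(x^i)^2\partial_+,\ \partial_i$. Let $\nabla$ be the Levi-Civita spin connection, $\Gamma(A)=-\frac14\sum A_{\mu\nu}\Gamma^{\mu\nu}$ the spin representation, $\mathcal L_K\xi=\nabla_K\xi-\Gamma(\nabla K)\xi$ the spinorial Lie derivative, and $D_\mu=\nabla_\mu+\rho(e_\mu)$ with $\rho(e_+)=0$, $\rho(e_-)=\mathrm{diag}(\bar c,d)$ on $S^-\oplus S^+$ and $\rho(e_i)=-\frac12\Gamma_+s_{\bar c,d}(e_i)$. Let $M_B$ be indecomposable: no proper non-zero subspace of $W$ that is invariant under the endomorphisms $z\mapsto\langle e_+,z\rangle Bv-\langle Bv,z\rangle e_+$, $v\in V$, is non-degenerate. **Even part.** Let $\mathcal K_0$ be the complex span of $$K_{(\pm)}=\partial_\pm,\quad K_{(i)}=\cos(\lambda_ix^-)\partial_i+\lambda_i\sin(\lambda_ix^-)x^i\partial_+,\quad K_{(i^*)}=\lambda_i\sin(\lambda_ix^-)\partial_i-\lambda_i^2\cos(\lambda_ix^-)x^i\partial_+,\quad K_{(ij)}=x^j\partial_i-x^i\partial_j,$$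 with $1\le i\le 9$ in $K_{(i)},K_{(i^*)}$, and with $i,j$ in the same one of the blocks $\{1,2\},\{3,4\},\{5\},\{6,7,8,9\}$ in $K_{(ij)}$. **Odd part.** Let $\mathcal K_1$ be the space of the spinor fields $$\vec\xi(\xi_1^0,\xi_2^0)=\exp(-x^-\bar c)\xi_1^0+\Big(1+\tfrac12\sum_ix^i\Gamma_+s_{\bar c,d}(e_i)\Big)\exp(-x^-d)\xi_2^0,\qquad \xi_1^0\in S^-,\ \xi_2^0\in S^+ \text{ constant},\ X^-\xi_2^0=0 .$$ **Odd-odd bracket.** For $\vec\xi=\vec\xi(\xi_1^0,\xi_2^0)$ and $\vec\eta=\vec\xi(\eta_1^0,\eta_2^0)$ in $\mathcal K_1$ let $$\{\vec\xi,\vec\eta\}=\{\vec\xi,\vec\eta\}^+K_{(+)}+\{\vec\xi,\vec\eta\}^-K_{(-)}+\sum_i\{\vec\xi,\vec\eta\}^iK_{(i)}+\sum_i\{\vec\xi,\vec\eta\}^{i^*}K_{(i^*)}+\tfrac12\sum_{ij}\{\vec\xi,\vec\eta\}^{ij}K_{(ij)},$$ the last sum over $i,j$ in the same block, where $$\{\vec\xi,\vec\eta\}^+=C(\xi_1^0,\Gamma_-\eta_1^0),\quad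 \{\vec\xi,\vec\eta\}^-=C(\xi_2^0,\Gamma_+\eta_2^0),\quad \{\vec\xi,\vec\eta\}^i=C(\xi_1^0,\Gamma_i\eta_2^0)+C(\eta_1^0,\Gamma_i\xi_2^0),$$ $$\{\vec\xi,\vec\eta\}^{i^*}=C(\xi_1^0,s_{\bar c,d}(B^{-1}e_i)\eta_2^0)-C(s_{\bar c,d}(B^{-1}e_i)\xi_2^0,\eta_1^0),$$ $$\{\vec\xi,\vec\eta\}^{ij}=-\tfrac12C\big(\xi_2^0,\Gamma_+(s_{d,\bar c}(e_j)\Gamma_i+\Gamma_is_{\bar c,d}(e_j))\eta_2^0\big).$$ **Theorem.** Under these assumptions $\mathcal K_0\oplus\mathcal K_1$ is a geometric superalgebra on $(M_B,D)$, that is: 1. $\mathcal K_0$ consists of smooth (complexified) Killing vector fields of $g_B$ and is closed under the commutator and under complex conjugation. If $B_i\neq B_j$ for $i,j$ in different blocks, it contains all smooth (complexified) Killing vector fields of $g_B$. 2. $\mathcal K_1$ consists of smooth $D$-parallel spinor fields and $\dim_{\mathbb C}\mathcal K_1=24$. If $D$ is not flat, $\mathcal K_1$ is the space of all smooth $D$-parallel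 spinor fields, i.e. the superalgebra is non-restricted. 3. $\mathcal L_K$ maps $\mathcal K_1$ to itself for all $K\in\mathcal K_0$, and $[\mathcal L_X,\mathcal L_Y]=\mathcal L_{[X,Y]}$ on $\mathcal K_1$ for all $X,Y\in\mathcal K_0$. Explicitly, $\mathcal L_{K_{(\mu)}}\vec\xi(\zeta)=-\vec\xi(\rho(e_\mu)\zeta)$ for $\zeta=(\xi_1^0,\xi_2^0)$ and $\mu\in\{\pm,i,i^*,ij\}$, where $\rho(e_i^*)=\frac12\Gamma_+B_i\Gamma_i$ and $\rho(e_{ij})=-\frac14[\Gamma_i,\Gamma_j]$. 4. $\{\cdot,\cdot\}:\mathcal K_1\times\mathcal K_1\to\mathcal K_0$ is bilinear and symmetric, and $[K,\{\vec\xi,\vec\eta\}]=\{\mathcal L_K\vec\xi,\vec\eta\}+\{\vec\xi,\mathcal L_K\vec\eta\}$ for all $K\in\mathcal K_0$, $\vec\xi,\vec\eta\in\mathcal K_1$. -/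

import Mathlib

open scoped ContDiff Kronecker Matrix

noncomputable section

namespace CahenWallach

/-! ### Coordinates, vector fields, the Cahen–Wallach metric -/

/-- Coordinate labels of `ℝ¹¹`: `Sum.inl 0` is `+`, `Sum.inl 1` is `-`, and `Sum.inr i`
is the `i`-th direction of the euclidean space `V = ℝ⁹`. -/
abbrev Idx := Fin 2 ⊕ Fin 9

/-- The label `+`. -/
abbrev plus : Idx := Sum.inl 0
/-- The label `-`. -/
abbrev minus : Idx := Sum.inl 1

/-- Points `(x⁺, x⁻, x¹, …, x⁹)` of the (global) coordinate chart of `M_B`. -/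
abbrev Pt := Idx → ℝ

/-- Vector fields with complex coefficients (sections of the complexified tangent bundle),
written in the coordinate basis `∂₊, ∂₋, ∂₁, …, ∂₉`. -/
abbrev VectorField := Pt → Idx → ℂ

/-- The coordinate derivative `∂_m f`. -/
def pd {F : Type*} [NormedAddCommGroup F] [NormedSpace ℝ F] (m : Idx) (f : Pt → F) (x : Pt) : F :=
  fderiv ℝ f x (Pi.single m 1)

/-- The commutator `[X, Y] = X(Y) - Y(X)` of vector fields. -/
def commutator (X Y : VectorField) : VectorField :=
  fun x => ∑ m, (X x m • pd m Y x - Y x m • pd m X x)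

/-- The flat Lorentzian form on `W = ℝ^{1,1} ⊕ V`; `e₊, e₋` are null with `⟨e₊, e₋⟩ = 1`. -/
def flatForm : Matrix Idx Idx ℝ := Matrix.of fun a b =>
  match a, b with
  | Sum.inl i, Sum.inl j => if i = j then 0 else 1
  | Sum.inr i, Sum.inr j => if i = j then 1 else 0
  | _, _ => 0

/-- The metric `g_B = 2 dx⁺dx⁻ - ∑ Bᵢ (xⁱ)² (dx⁻)² + ∑ (dxⁱ)²` for `B = diag (B₁, …, B₉)`. -/
def cwMetric (B : Fin 9 → ℝ) (x : Pt) : Matrix Idx Idx ℝ :=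
  flatForm - (∑ i, B i * x (Sum.inr i) ^ 2) • Matrix.single minus minus 1

/-- `L_X g = 0`, for a vector field with complex coefficients (`g` is extended bilinearly). -/
def IsKilling (g : Pt → Matrix Idx Idx ℝ) (X : VectorField) : Prop :=
  ∀ x : Pt, ∀ m n : Idx,
    ∑ k, (X x k * ((pd k (fun y => g y m n) x : ℝ) : ℂ)
      + (g x k n : ℂ) * pd m X x k + (g x m k : ℂ) * pd n X x k) = 0

/-- Christoffel symbols of the first kind,
`Γ_{ij;k} = g(∇_{∂ᵢ} ∂ⱼ, ∂ₖ) = (∂ᵢ gⱼₖ + ∂ⱼ gᵢₖ - ∂ₖ gᵢⱼ) / 2`. -/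
def christoffel (g : Pt → Matrix Idx Idx ℝ) (x : Pt) (i j k : Idx) : ℝ :=
  (pd i (fun y => g y j k) x + pd j (fun y => g y i k) x - pd k (fun y => g y i j) x) / 2

/-- `g(∇_{∂ᵢ} Y, ∂ⱼ)` for the Levi-Civita connection `∇` of `g`. -/
def leviCivita (g : Pt → Matrix Idx Idx ℝ) (Y : VectorField) (x : Pt) (i j : Idx) : ℂ :=
  ∑ k, ((g x j k : ℂ) * pd i Y x k + (christoffel g x i k j : ℂ) * Y x k)

/-- The adapted frame `e₊ = ∂₊`, `e₋ = ∂₋ + ½ ∑ Bᵢ (xⁱ)² ∂₊`, `eᵢ = ∂ᵢ`, in which `g_B` is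
`flatForm`. -/
def frame (B : Fin 9 → ℝ) (a : Idx) (x : Pt) : Idx → ℝ :=
  Pi.single a 1 + if a = minus then Pi.single plus ((∑ i, B i * x (Sum.inr i) ^ 2) / 2) else 0

/-- The Levi-Civita connection form in the adapted frame, `(ω_m)_{ab} = g(∇_{∂_m} e_b, e_a)`. -/
def connForm (B : Fin 9 → ℝ) (x : Pt) (m : Idx) : Matrix Idx Idx ℂ := Matrix.of fun a b =>
  ∑ i, (frame B a x i : ℂ) * leviCivita (cwMetric B) (fun y j => (frame B b y j : ℂ)) x m i

/-- The endomorphism `∇K : Y ↦ ∇_Y K` in the adapted frame, `(∇K)_{ab} = g(∇_{e_b} K, e_a)`. -/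
def nablaEnd (B : Fin 9 → ℝ) (K : VectorField) (x : Pt) : Matrix Idx Idx ℂ := Matrix.of fun a b =>
  ∑ i, ∑ j, (frame B a x i : ℂ) * (frame B b x j : ℂ) * leviCivita (cwMetric B) K x j i

/-! ### Indecomposability -/

/-- The action of `v* ∈ V*` on `W`: it is `Bv ∧ e₊`, where
`(x ∧ y) z = ⟨y, z⟩ x - ⟨x, z⟩ y`. -/
def dualAction (B : Fin 9 → ℝ) (v : Fin 9 → ℝ) (z : Idx → ℝ) : Idx → ℝ :=
  let Bv : Idx → ℝ := Sum.elim 0 (fun i => B i * v i)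
  let ePlus : Idx → ℝ := Pi.single plus 1
  (ePlus ⬝ᵥ flatForm *ᵥ z) • Bv - (Bv ⬝ᵥ flatForm *ᵥ z) • ePlus

/-- `M_B` is indecomposable: no proper non-zero `V*`-invariant subspace of `W` is
non-degenerate. -/
def IsIndecomposable (B : Fin 9 → ℝ) : Prop :=
  ∀ U : Submodule ℝ (Idx → ℝ),
    (∀ v : Fin 9 → ℝ, ∀ z ∈ U, dualAction B v z ∈ U) →
    (∀ z ∈ U, (∀ w ∈ U, z ⬝ᵥ flatForm *ᵥ w = 0) → z = 0) →
    U = ⊥ ∨ U = ⊤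

/-! ### Spinors -/

/-- Labels of a basis of the 16-dimensional space `S(V)`. -/
abbrev VIdx := Fin 2 × Fin 8

/-- An irreducible (i.e. 16-dimensional) complex module of the Clifford algebra of the
euclidean space `V = ℝ⁹`, with the convention `vw + wv = -2⟨v, w⟩`, together with a charge
conjugation. -/
structure SpinModule where
  /-- the gamma matrices -/
  γ : Fin 9 → Matrix VIdx VIdx ℂ
  clifford : ∀ i j, γ i * γ j + γ j * γ i = if i = j then -2 else 0
  /-- the charge conjugation on `S(V)` -/
  CV : Matrix VIdx VIdx ℂ
  CV_symm : CVᵀ = CV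
  CV_nondeg : IsUnit CV.det
  CV_γ : ∀ i, (γ i)ᵀ * CV = CV * γ i

/-- Labels of a basis of the 32-dimensional space `S(W) = S₂ ⊗ S(V)`. -/
abbrev SIdx := Fin 2 × VIdx

/-- The space `S(W)`. -/
abbrev Spinor := SIdx → ℂ

/-- Sections of the spinor bundle of `M_B`, trivialized by the adapted frame. -/
abbrev SpinorField := Pt → Spinor

/-- `γ₊ = √2 E₁₂` -/
def gammaPlus : Matrix (Fin 2) (Fin 2) ℂ := !![0, (Real.sqrt 2 : ℂ); 0, 0]
/-- `γ₋ = -√2 E₂₁` -/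
def gammaMinus : Matrix (Fin 2) (Fin 2) ℂ := !![0, 0; -(Real.sqrt 2 : ℂ), 0]
/-- `σ = ½[γ₊, γ₋]` -/
def sigma : Matrix (Fin 2) (Fin 2) ℂ := !![-1, 0; 0, 1]
/-- The second Pauli matrix, the charge conjugation on `S₂`. -/
def pauli2 : Matrix (Fin 2) (Fin 2) ℂ := !![0, -Complex.I; Complex.I, 0]

/-- The projection of `S(W)` onto `S⁻ = ker Γ₊`, the `-1`-eigenspace of `σ`. -/
def projMinus : Matrix SIdx SIdx ℂ := (!![1, 0; 0, 0] : Matrix (Fin 2) (Fin 2) ℂ) ⊗ₖ 1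
/-- The projection of `S(W)` onto `S⁺`, the `+1`-eigenspace of `σ`. -/
def projPlus : Matrix SIdx SIdx ℂ := (!![0, 0; 0, 1] : Matrix (Fin 2) (Fin 2) ℂ) ⊗ₖ 1

/-- An endomorphism of `S(V)` acting on both summands of `S(W) = S⁻ ⊕ S⁺`. -/
def liftV (a : Matrix VIdx VIdx ℂ) : Matrix SIdx SIdx ℂ := (1 : Matrix (Fin 2) (Fin 2) ℂ) ⊗ₖ a

namespace SpinModule

variable (M : SpinModule)

/-- The generators `Γ₊, Γ₋, Γᵢ` of the Clifford algebra of `W`. -/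
def Γ : Idx → Matrix SIdx SIdx ℂ
  | Sum.inl i => (if i = 0 then gammaPlus else gammaMinus) ⊗ₖ 1
  | Sum.inr i => sigma ⊗ₖ M.γ i

/-- The generators with raised index, `Γ^a = ∑ η^{ab} Γ_b` (`flatForm` is its own inverse). -/
def Γup (a : Idx) : Matrix SIdx SIdx ℂ := ∑ b, (flatForm a b : ℂ) • M.Γ b

/-- The spin representation `A ↦ -¼ ∑ A_{ab} Γ^{ab}`, `Γ^{ab} = ½[Γ^a, Γ^b]`. -/
def spinRep (A : Matrix Idx Idx ℂ) : Matrix SIdx SIdx ℂ :=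
  -(1 / 4 : ℂ) • ∑ a, ∑ b, A a b • ((1 / 2 : ℂ) • (M.Γup a * M.Γup b - M.Γup b * M.Γup a))

/-- The charge conjugation `C_W = σ₂ ⊗ C_V`, as a complex bilinear form on `S(W)`. -/
def C (ξ η : Spinor) : ℂ := ξ ⬝ᵥ (pauli2 ⊗ₖ M.CV) *ᵥ η

/-- The Levi-Civita spin connection `∇_m ξ = ∂_m ξ + Γ(ω_m) ξ`. -/
def nabla (B : Fin 9 → ℝ) (m : Idx) (ξ : SpinorField) : SpinorField :=
  fun x => pd m ξ x + M.spinRep (connForm B x m) *ᵥ ξ x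

/-- The spinorial Lie derivative `𝓛_K ξ = ∇_K ξ - Γ(∇K) ξ`. -/
def spinLie (B : Fin 9 → ℝ) (K : VectorField) (ξ : SpinorField) : SpinorField :=
  fun x => ∑ m, K x m • M.nabla B m ξ x - M.spinRep (nablaEnd B K x) *ᵥ ξ x

end SpinModule

/-! ### The spinor connection -/

/-- The four parameters `α₊, α₋, α'₊, α'₋`. -/
structure Params where
  αp : ℂ
  αm : ℂ
  αp' : ℂ
  αm' : ℂ

namespace Params

variable (p : Params) (M : SpinModule)

/-- The numbers `μᵢ` with `B = -diag(μᵢ²)`. -/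
def μ : Fin 9 → ℂ :=
  ![p.αm - p.αp', p.αm - p.αp', p.αm + p.αp', p.αm + p.αp', p.αp - p.αp',
    p.αp + p.αp', p.αp + p.αp', p.αp + p.αp', p.αp + p.αp']

/-- `λᵢ = -i μᵢ`, the square roots of the eigenvalues of `B`. -/
def lam (i : Fin 9) : ℂ := -Complex.I * p.μ i

end Params

namespace SpinModule

variable (M : SpinModule) (p : Params)

/-- `γ₁₂₅` -/
def γ125 : Matrix VIdx VIdx ℂ := M.γ 0 * M.γ 1 * M.γ 4
/-- `γ₁₂₃₄` -/
def γ1234 : Matrix VIdx VIdx ℂ := M.γ 0 * M.γ 1 * M.γ 2 * M.γ 3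
/-- The projection `X⁺₁₂₃₄` on `S(V)`. -/
def Xp : Matrix VIdx VIdx ℂ := (1 / 2 : ℂ) • (1 + M.γ1234)
/-- The projection `X⁻₁₂₃₄` on `S(V)`. -/
def Xm : Matrix VIdx VIdx ℂ := (1 / 2 : ℂ) • (1 - M.γ1234)

/-- `c̄ = (α₊ X⁺ + α₋ X⁻) γ₁₂₅` -/
def cbar : Matrix VIdx VIdx ℂ := (p.αp • M.Xp + p.αm • M.Xm) * M.γ125
/-- `d = (α'₊ X⁺ + α'₋ X⁻) γ₁₂₅` -/
def d : Matrix VIdx VIdx ℂ := (p.αp' • M.Xp + p.αm' • M.Xm) * M.γ125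

/-- `s_{c̄,d}(eᵢ) = c̄ γᵢ - γᵢ d` -/
def s (i : Fin 9) : Matrix VIdx VIdx ℂ := M.cbar p * M.γ i - M.γ i * M.d p
/-- `s_{d,c̄}(eᵢ) = d γᵢ - γᵢ c̄` -/
def sdc (i : Fin 9) : Matrix VIdx VIdx ℂ := M.d p * M.γ i - M.γ i * M.cbar p

/-- The equivariant map `ρ` on `W`: `ρ(e₊) = 0`, `ρ(e₋) = diag(c̄, d)` on `S⁻ ⊕ S⁺`, and
`ρ(eᵢ) = -½ Γ₊ s_{c̄,d}(eᵢ)`. -/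
def rho : Idx → Matrix SIdx SIdx ℂ
  | Sum.inl i =>
    if i = 0 then 0 else projMinus * liftV (M.cbar p) + projPlus * liftV (M.d p)
  | Sum.inr i => -(1 / 2 : ℂ) • (M.Γ plus * liftV (M.s p i))

/-- The image `ρ(eᵢ*) = ½ Γ₊ B(eᵢ)` of `eᵢ* = B(eᵢ) ∧ e₊` under the spin representation. -/
def rhoStar (B : Fin 9 → ℝ) (i : Fin 9) : Matrix SIdx SIdx ℂ :=
  (1 / 2 : ℂ) • (M.Γ plus * ((B i : ℂ) • M.Γ (Sum.inr i)))

/-- The image `ρ(eᵢⱼ) = -½ Γᵢⱼ` of `eᵢⱼ = eᵢ ∧ eⱼ` under the spin representation. -/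
def rhoRot (i j : Fin 9) : Matrix SIdx SIdx ℂ :=
  -(1 / 2 : ℂ) • ((1 / 2 : ℂ) •
    (M.Γ (Sum.inr i) * M.Γ (Sum.inr j) - M.Γ (Sum.inr j) * M.Γ (Sum.inr i)))

/-- The connection `D_m = ∇_m + ρ(e_m)` on the spinor bundle. -/
def conn (B : Fin 9 → ℝ) (m : Idx) (ξ : SpinorField) : SpinorField :=
  fun x => M.nabla B m ξ x + M.rho p m *ᵥ ξ x

end SpinModule

/-- `ξ` is a smooth section with `D ξ = 0`. -/
def IsParallel (D : Idx → SpinorField → SpinorField) (ξ : SpinorField) : Prop :=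
  ContDiff ℝ ∞ ξ ∧ ∀ m, D m ξ = 0

/-- The curvature of `D` vanishes. -/
def IsFlat (D : Idx → SpinorField → SpinorField) : Prop :=
  ∀ ξ : SpinorField, ContDiff ℝ ∞ ξ → ∀ m n, D m (D n ξ) = D n (D m ξ)

/-! ### Geometric superalgebras -/

/-- A geometric superalgebra (with complexified even part) on the coordinate space `ℝ¹¹` with
metric `g` and a connection `D` on the spinor bundle: a Lie algebra `even` of Killing vector
fields, a space `odd` of parallel sections, an action of `even` on `odd`, and a symmetric
pairing `odd × odd → even` for which `even` acts by derivations. -/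
structure GeometricSuperalgebra (g : Pt → Matrix Idx Idx ℝ)
    (D : Idx → SpinorField → SpinorField) where
  even : Submodule ℂ VectorField
  even_smooth : ∀ X ∈ even, ContDiff ℝ ∞ X
  even_killing : ∀ X ∈ even, IsKilling g X
  even_commutator : ∀ X ∈ even, ∀ Y ∈ even, commutator X Y ∈ even
  odd : Submodule ℂ SpinorField
  odd_parallel : ∀ ξ ∈ odd, IsParallel D ξ
  action : even →ₗ[ℂ] Module.End ℂ odd
  action_commutator : ∀ X Y : even,
    action ⟨commutator X Y, even_commutator X X.2 Y Y.2⟩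
      = action X * action Y - action Y * action X
  pairing : odd →ₗ[ℂ] odd →ₗ[ℂ] even
  pairing_symm : ∀ ξ η, pairing ξ η = pairing η ξ
  pairing_compat : ∀ (X : even) (ξ η : odd),
    commutator X (pairing ξ η) =
      (pairing (action X ξ) η : VectorField) + (pairing ξ (action X η) : VectorField)

/-- The odd part consists of all parallel sections. -/
def GeometricSuperalgebra.IsNonRestricted {g : Pt → Matrix Idx Idx ℝ}
    {D : Idx → SpinorField → SpinorField} (A : GeometricSuperalgebra g D) : Prop :=
  ∀ ξ, IsParallel D ξ → ξ ∈ A.odd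

/-! ### The even part -/

/-- The blocks `{1,2}`, `{3,4}`, `{5}`, `{6,7,8,9}` of indices. -/
def block : Fin 9 → Fin 4 := ![0, 0, 1, 1, 2, 3, 3, 3, 3]

/-- The coordinate vector field `∂_m`. -/
def coordField (m : Idx) : VectorField := fun _ => Pi.single m 1

/-- `K₍₊₎ = ∂₊` -/
def KPlus : VectorField := coordField plus
/-- `K₍₋₎ = ∂₋` -/
def KMinus : VectorField := coordField minus

/-- `K₍ᵢ₎ = cos(λᵢ x⁻) ∂ᵢ + λᵢ sin(λᵢ x⁻) xⁱ ∂₊` -/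
def KVec (p : Params) (i : Fin 9) : VectorField := fun x =>
  Complex.cos (p.lam i * x minus) • coordField (Sum.inr i) x
    + (p.lam i * Complex.sin (p.lam i * x minus) * x (Sum.inr i)) • coordField plus x

/-- `K₍ᵢ*₎ = λᵢ sin(λᵢ x⁻) ∂ᵢ - λᵢ² cos(λᵢ x⁻) xⁱ ∂₊` -/
def KStar (p : Params) (i : Fin 9) : VectorField := fun x =>
  (p.lam i * Complex.sin (p.lam i * x minus)) • coordField (Sum.inr i) x
    - (p.lam i ^ 2 * Complex.cos (p.lam i * x minus) * x (Sum.inr i)) • coordField plus x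

/-- `K₍ᵢⱼ₎ = xʲ ∂ᵢ - xⁱ ∂ⱼ` -/
def KRot (i j : Fin 9) : VectorField := fun x =>
  (x (Sum.inr j) : ℂ) • coordField (Sum.inr i) x - (x (Sum.inr i) : ℂ) • coordField (Sum.inr j) x

/-- The (complexified) Killing algebra `𝒦₀`, spanned by `K₍₊₎`, `K₍₋₎`, `K₍ᵢ₎`, `K₍ᵢ*₎`, and those
`K₍ᵢⱼ₎` with `i`, `j` in the same block. -/
def killingAlgebra (p : Params) : Submodule ℂ VectorField :=
  Submodule.span ℂ ({KPlus, KMinus} ∪ Set.range (KVec p) ∪ Set.range (KStar p)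
    ∪ {X | ∃ i j, block i = block j ∧ X = KRot i j})

/-! ### The odd part and the odd-odd bracket -/

namespace SpinModule

variable (M : SpinModule) (p : Params)

/-- The spinor field with constants `ξ₁⁰ = projMinus ζ` and `ξ₂⁰ = projPlus ζ`:
`exp(-x⁻ c̄) ξ₁⁰ + (1 + ½ ∑ xⁱ Γ₊ s_{c̄,d}(eᵢ)) exp(-x⁻ d) ξ₂⁰`. -/
def parField (ζ : Spinor) : SpinorField := fun x =>
  NormedSpace.exp (-(x minus : ℂ) • liftV (M.cbar p)) *ᵥ (projMinus *ᵥ ζ)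
    + (1 + (1 / 2 : ℂ) • ∑ i, (x (Sum.inr i) : ℂ) • (M.Γ plus * liftV (M.s p i))) *ᵥ
      (NormedSpace.exp (-(x minus : ℂ) • liftV (M.d p)) *ᵥ (projPlus *ᵥ ζ))

/-- The constant spinors `ζ = ξ₁⁰ + ξ₂⁰` with `X⁻₁₂₃₄ ξ₂⁰ = 0`. -/
def constants : Submodule ℂ Spinor :=
  LinearMap.ker (Matrix.mulVecLin (liftV M.Xm * projPlus))

/-- The value at the origin of the spinor field with constants `ζ` is `ζ`. -/
theorem parField_zero (ζ : Spinor) : M.parField p ζ 0 = ζ := by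
  have h : (projMinus + projPlus : Matrix SIdx SIdx ℂ) = 1 := by
    rw [projMinus, projPlus, ← Matrix.add_kronecker]
    have : (!![1, 0; 0, 0] + !![0, 0; 0, 1] : Matrix (Fin 2) (Fin 2) ℂ) = 1 := by
      ext i j; fin_cases i <;> fin_cases j <;> simp
    rw [this, Matrix.one_kronecker_one]
  simp [parField, ← Matrix.add_mulVec, h]

/-- The space `𝒦₁` of spinor fields with constants in `constants`. -/
def oddPart : Submodule ℂ SpinorField where
  carrier := {ξ | ∃ ζ ∈ M.constants, ξ = M.parField p ζ}
  zero_mem' := ⟨0, zero_mem _, by ext x : 1; simp [parField]⟩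
  add_mem' := by
    rintro _ _ ⟨a, ha, rfl⟩ ⟨b, hb, rfl⟩
    refine ⟨a + b, add_mem ha hb, ?_⟩
    ext x : 1
    simp only [parField, Pi.add_apply, Matrix.mulVec_add]
    abel
  smul_mem' := by
    rintro c _ ⟨a, ha, rfl⟩
    refine ⟨c • a, Submodule.smul_mem _ c ha, ?_⟩
    ext x : 1
    simp only [parField, Pi.smul_apply, Matrix.mulVec_smul, smul_add]

/-- `{ξ,η}⁻ = C(ξ₂⁰, Γ₊ η₂⁰)` -/
def coeffMinus (ζ θ : Spinor) : ℂ :=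
  M.C (projPlus *ᵥ ζ) (M.Γ plus *ᵥ (projPlus *ᵥ θ))

/-- `{ξ,η}⁺ = C(ξ₁⁰, Γ₋ η₁⁰)` -/
def coeffPlus (ζ θ : Spinor) : ℂ :=
  M.C (projMinus *ᵥ ζ) (M.Γ minus *ᵥ (projMinus *ᵥ θ))

/-- `{ξ,η}ⁱ = C(ξ₁⁰, Γᵢ η₂⁰) + C(η₁⁰, Γᵢ ξ₂⁰)` -/
def coeffVec (i : Fin 9) (ζ θ : Spinor) : ℂ :=
  M.C (projMinus *ᵥ ζ) (M.Γ (Sum.inr i) *ᵥ (projPlus *ᵥ θ))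
    + M.C (projMinus *ᵥ θ) (M.Γ (Sum.inr i) *ᵥ (projPlus *ᵥ ζ))

/-- `{ξ,η}^{i*} = C(ξ₁⁰, s_{c̄,d}(B⁻¹eᵢ) η₂⁰) - C(s_{c̄,d}(B⁻¹eᵢ) ξ₂⁰, η₁⁰)` -/
def coeffStar (B : Fin 9 → ℝ) (i : Fin 9) (ζ θ : Spinor) : ℂ :=
  let sB : Matrix SIdx SIdx ℂ := liftV (((B i)⁻¹ : ℂ) • M.s p i)
  M.C (projMinus *ᵥ ζ) (sB *ᵥ (projPlus *ᵥ θ)) - M.C (sB *ᵥ (projPlus *ᵥ ζ)) (projMinus *ᵥ θ)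

/-- `{ξ,η}^{ij} = -½ C(ξ₂⁰, Γ₊ (s_{d,c̄}(eⱼ) Γᵢ + Γᵢ s_{c̄,d}(eⱼ)) η₂⁰)` -/
def coeffRot (i j : Fin 9) (ζ θ : Spinor) : ℂ :=
  -(1 / 2 : ℂ) * M.C (projPlus *ᵥ ζ)
    ((M.Γ plus * (liftV (M.sdc p j) * M.Γ (Sum.inr i) + M.Γ (Sum.inr i) * liftV (M.s p j))) *ᵥ
      (projPlus *ᵥ θ))

/-- The odd-odd bracket of the spinor fields with constants `ζ` and `θ`. -/
def oddBracket (B : Fin 9 → ℝ) (ζ θ : Spinor) : VectorField :=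
  M.coeffPlus ζ θ • KPlus + M.coeffMinus ζ θ • KMinus
    + ∑ i, M.coeffVec i ζ θ • KVec p i
    + ∑ i, M.coeffStar p B i ζ θ • KStar p i
    + (1 / 2 : ℂ) • ∑ i, ∑ j, if block i = block j then M.coeffRot p i j ζ θ • KRot i j else 0

end SpinModule

/-! ### The module exists: the octonionic model -/

/-- Signs of the matrices of left multiplication by the imaginary octonions. -/
def octSign : Fin 7 → Fin 8 → ℤ :=
  ![![-1, 1, -1, 1, -1, 1, 1, -1],
    ![-1, 1, 1, -1, -1, -1, 1, 1],
    ![-1, -1, 1, 1, -1, 1, -1, 1],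
    ![-1, 1, 1, 1, 1, -1, -1, -1],
    ![-1, -1, 1, -1, 1, 1, 1, -1],
    ![-1, -1, -1, 1, 1, -1, 1, 1],
    ![-1, 1, -1, -1, 1, 1, -1, 1]]

/-- Left multiplication by the imaginary octonions. -/
def octL (a : Fin 7) : Matrix (Fin 8) (Fin 8) ℤ := Matrix.of fun r c =>
  if c.val = r.val ^^^ (a.val + 1) then octSign a r else 0

theorem octL_anticomm : ∀ a b, octL a * octL b + octL b * octL a = if a = b then -2 else 0 := by
  decide +kernel

theorem octL_transpose : ∀ a, (octL a)ᵀ = -octL a := by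
  decide +kernel

/-- Complexification of `octL`. -/
def octLC (a : Fin 7) : Matrix (Fin 8) (Fin 8) ℂ := (octL a).map (Int.castRingHom ℂ)

theorem octLC_anticomm (a b : Fin 7) :
    octLC a * octLC b + octLC b * octLC a = if a = b then -2 else 0 := by
  have h := congrArg (fun X : Matrix (Fin 8) (Fin 8) ℤ => (Int.castRingHom ℂ).mapMatrix X)
    (octL_anticomm a b)
  simp only [map_add, map_mul, RingHom.mapMatrix_apply] at h
  rw [octLC, octLC, h]
  split_ifs
  · rw [← RingHom.mapMatrix_apply, map_neg, map_ofNat]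
  · rw [← RingHom.mapMatrix_apply, map_zero]

theorem octLC_transpose (a : Fin 7) : (octLC a)ᵀ = -octLC a := by
  rw [octLC, ← Matrix.transpose_map, octL_transpose]
  ext i j
  simp

/-- The Pauli matrix `σ₁`. -/
def pauli1 : Matrix (Fin 2) (Fin 2) ℂ := !![0, 1; 1, 0]
/-- The Pauli matrix `σ₃`. -/
def pauli3 : Matrix (Fin 2) (Fin 2) ℂ := !![1, 0; 0, -1]

/-- `γ_a = σ₁ ⊗ L_a` for `a ≤ 7`, `γ₈ = -iσ₂ ⊗ 1`, `γ₉ = -iσ₃ ⊗ 1`. -/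
def octGamma (i : Fin 9) : Matrix VIdx VIdx ℂ :=
  if h : i.val < 7 then pauli1 ⊗ₖ octLC ⟨i.val, h⟩
  else if i = 7 then (-Complex.I • pauli2) ⊗ₖ 1 else (-Complex.I • pauli3) ⊗ₖ 1

/-- The octonionic model, with charge conjugation `C_V = σ₃ ⊗ 1`. -/
def octonionicModule : SpinModule where
  γ := octGamma
  clifford := by
    have p11 : pauli1 * pauli1 = 1 := by
      ext i j; fin_cases i <;> fin_cases j <;> simp [pauli1]
    have p22 : (-Complex.I • pauli2) * (-Complex.I • pauli2) = -1 := by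
      ext i j; fin_cases i <;> fin_cases j <;> simp [pauli2]
    have p33 : (-Complex.I • pauli3) * (-Complex.I • pauli3) = -1 := by
      ext i j; fin_cases i <;> fin_cases j <;> simp [pauli3]
    have p12 : pauli1 * (-Complex.I • pauli2) = -((-Complex.I • pauli2) * pauli1) := by
      ext i j; fin_cases i <;> fin_cases j <;> simp [pauli1, pauli2]
    have p13 : pauli1 * (-Complex.I • pauli3) = -((-Complex.I • pauli3) * pauli1) := by
      ext i j; fin_cases i <;> fin_cases j <;> simp [pauli1, pauli3]
    have p23 : (-Complex.I • pauli2) * (-Complex.I • pauli3)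
        = -((-Complex.I • pauli3) * (-Complex.I • pauli2)) := by
      ext i j; fin_cases i <;> fin_cases j <;> simp [pauli2, pauli3]
    have neg (A : Matrix (Fin 2) (Fin 2) ℂ) (X : Matrix (Fin 8) (Fin 8) ℂ) :
        (-A) ⊗ₖ X = -(A ⊗ₖ X) := by
      ext i j; simp
    have two (X : Matrix VIdx VIdx ℂ) : -X + -X = -2 * X := by rw [neg_mul, two_mul]; abel
    have hcase (i : Fin 9) (h : ¬ i.val < 7) : i = 7 ∨ i = 8 := by omega
    intro i j
    by_cases hi : i.val < 7 <;> by_cases hj : j.val < 7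
    · simp only [octGamma, hi, hj, dif_pos, ← Matrix.mul_kronecker_mul, p11,
        ← Matrix.kronecker_add, octLC_anticomm]
      by_cases hij : i = j
      · subst hij
        ext a b
        simp only [Matrix.ofNat_apply, Matrix.kroneckerMap_apply, Matrix.one_apply, if_true,
          Matrix.neg_apply, Prod.ext_iff]
        split_ifs <;> simp_all
      · have : (⟨i.val, hi⟩ : Fin 7) ≠ ⟨j.val, hj⟩ := by
          intro h; apply hij; ext; simpa using h
        simp [hij, this]
    · have hij : i ≠ j := by rintro rfl; exact hj hi
      rcases hcase j hj with rfl | rfl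
      · simp [octGamma, hi, hij, ← Matrix.mul_kronecker_mul, p12, neg, -neg_smul]
      · simp [octGamma, hi, hij, ← Matrix.mul_kronecker_mul, p13, neg, -neg_smul]
    · have hij : i ≠ j := by rintro rfl; exact hi hj
      rcases hcase i hi with rfl | rfl
      · simp [octGamma, hj, hij, ← Matrix.mul_kronecker_mul, p12, neg, -neg_smul]
      · simp [octGamma, hj, hij, ← Matrix.mul_kronecker_mul, p13, neg, -neg_smul]
    · rcases hcase i hi with rfl | rfl <;> rcases hcase j hj with rfl | rfl
      · simp [octGamma, ← Matrix.mul_kronecker_mul, p22, neg, -neg_smul, two]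
      · simp [octGamma, ← Matrix.mul_kronecker_mul, p23, neg, -neg_smul]
      · simp [octGamma, ← Matrix.mul_kronecker_mul, p23, neg, -neg_smul]
      · simp [octGamma, ← Matrix.mul_kronecker_mul, p33, neg, -neg_smul, two]
  CV := pauli3 ⊗ₖ 1
  CV_symm := by
    rw [← Matrix.kroneckerMap_transpose, Matrix.transpose_one]
    congr 1
    ext i j; fin_cases i <;> fin_cases j <;> simp [pauli3]
  CV_nondeg := by
    rw [Matrix.det_kronecker]
    simp [pauli3]
  CV_γ := by
    intro i
    have neg (A : Matrix (Fin 2) (Fin 2) ℂ) (X : Matrix (Fin 8) (Fin 8) ℂ) :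
        A ⊗ₖ (-X) = -(A ⊗ₖ X) := by
      ext i j; simp
    have neg' (A : Matrix (Fin 2) (Fin 2) ℂ) (X : Matrix (Fin 8) (Fin 8) ℂ) :
        (-A) ⊗ₖ X = -(A ⊗ₖ X) := by
      ext i j; simp
    have q1 : pauli1ᵀ * pauli3 = -(pauli3 * pauli1) := by
      ext i j; fin_cases i <;> fin_cases j <;> simp [pauli1, pauli3, Matrix.mul_apply]
    have q2 : (-Complex.I • pauli2)ᵀ * pauli3 = pauli3 * (-Complex.I • pauli2) := by
      ext i j; fin_cases i <;> fin_cases j <;> simp [pauli2, pauli3, Matrix.mul_apply]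
    have q3 : (-Complex.I • pauli3)ᵀ * pauli3 = pauli3 * (-Complex.I • pauli3) := by
      ext i j; fin_cases i <;> fin_cases j <;> simp [pauli3, Matrix.mul_apply]
    unfold octGamma
    split_ifs
    · rw [← Matrix.kroneckerMap_transpose, octLC_transpose, ← Matrix.mul_kronecker_mul,
        ← Matrix.mul_kronecker_mul, q1, mul_one, one_mul, neg, neg', neg_neg]
    · rw [← Matrix.kroneckerMap_transpose, Matrix.transpose_one, ← Matrix.mul_kronecker_mul,
        ← Matrix.mul_kronecker_mul, q2]
    · rw [← Matrix.kroneckerMap_transpose, Matrix.transpose_one, ← Matrix.mul_kronecker_mul,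
        ← Matrix.mul_kronecker_mul, q3]

end CahenWallach

end

/-!
Everything is computed on the two halves `S⁻`, `S⁺` of `S(W)` (`sMinus`, `sPlus`), each a copy of
`S(V)`. The key fact concerns the image of `X⁺`, which is the `1`-eigenspace of `γ₁₂₃₄`
(`Xm_mulVec_eq_zero_iff`). There `s_{c̄,d}(eᵢ)` equals `μᵢ γ₁₂₅ γᵢ` (`s_mulVec_of_mem`), so that
`c̄ s_{c̄,d}(eᵢ) - s_{c̄,d}(eᵢ) d = μᵢ² γᵢ = -Bᵢ γᵢ` (`cbar_s_sub_s_d`): the curvature of `D`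
vanishes on this subspace.

*Odd part.* Vanishing of the curvature makes `parField ζ` parallel for `ζ ∈ constants`
(`conn_parField`). It also yields the differential equations by which `exp(-t c̄)` is moved past
`s_{c̄,d}(eᵢ)` and `γᵢ`, with cosines and sines of `λᵢ t` as coefficients (`expV_cbar_s`,
`expV_cbar_γ`). These are the coefficients of `K₍ᵢ₎` and `K₍ᵢ*₎`, and the spinorial Lie derivatives
of the parallel fields follow. On the image of `X⁻` the curvature in the direction `(e₋, eᵢ)` is a
scalar times `γᵢ` (`curv_mulVec`). If `D` is not flat, one of these scalars is non-zero, hence the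
value at the origin of a parallel field belongs to `constants`, and this value determines the field
(`eq_of_isParallel`). The dimension is `32 - 8`, because `γ₁₂₃₄` has trace zero
(`finrank_constants`).

*Brackets.* A vector field `X` in the even part acts on the constants of the odd part through an
endomorphism `-R`; the predicate `Represents` records this together with the invariance of the
odd-odd bracket. It is linear in `(X, R)`, and `R` is determined by `X` on `constants`, as
`parField ζ` has the value `ζ` at the origin. So the homomorphism property and the invariance of
the odd-odd bracket are checked on generators (`bracket_*`, `compat_*`). Division by `Bᵢ` in the
bracket is harmless, since indecomposability forces `Bᵢ ≠ 0` (`IsIndecomposable.ne_zero`).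

*Killing vector fields.* The Killing equations form an overdetermined linear system
(`KillingSystem`). Differentiating it determines all second derivatives, so a solution is determined
by its 1-jet at the origin (`eq_zero`). It also shows that `∂ⱼ vₖ = 0` whenever `Bⱼ ≠ Bₖ`
(`inr_v_eq_zero`), so a field in `killingAlgebra` with the same 1-jet exists
(`IsKilling.mem_killingAlgebra`).
-/

noncomputable section

namespace CahenWallach

/-! ### Clifford algebra of `V` -/

/-- The sign in `γᵢ γⱼ = ± γⱼ γᵢ`. -/
def swapSign (i j : Fin 9) : ℂ := if i = j then 1 else -1

/-- The sign in `γᵢ γ₁₂₅ = ± γ₁₂₅ γᵢ`. -/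
def sign125 (i : Fin 9) : ℂ := swapSign i 0 * swapSign i 1 * swapSign i 4

/-- The sign in `γᵢ γ₁₂₃₄ = ± γ₁₂₃₄ γᵢ`. -/
def sign1234 (i : Fin 9) : ℂ := swapSign i 0 * swapSign i 1 * swapSign i 2 * swapSign i 3

theorem swapSign_mul_self (i j : Fin 9) : swapSign i j * swapSign i j = 1 := by
  unfold swapSign; split_ifs <;> norm_num

theorem sign125_mul_self (i : Fin 9) : sign125 i * sign125 i = 1 := by
  have h0 := swapSign_mul_self i 0
  have h1 := swapSign_mul_self i 1
  have h4 := swapSign_mul_self i 4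
  unfold sign125
  linear_combination h0 * (swapSign i 1 ^ 2 * swapSign i 4 ^ 2) + h1 * swapSign i 4 ^ 2 + h4

/-- `γᵢ` anticommutes with `γ₁₂₃₄` exactly for `i ≤ 4` (indices are shifted by one in `Fin 9`). -/
theorem sign1234_eq (i : Fin 9) : sign1234 i = if i.val < 4 then -1 else 1 := by
  fin_cases i <;> simp [sign1234, swapSign]

theorem block_sign1234 {i j : Fin 9} (h : block i = block j) : sign1234 i = sign1234 j := by
  simp only [sign1234_eq]
  have : (i.val < 4 ↔ j.val < 4) := by revert i j; decide
  simp [this]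

theorem block_sign125 {i j : Fin 9} (h : block i = block j) : sign125 i = sign125 j := by
  fin_cases i <;> fin_cases j <;> simp_all [block, sign125, swapSign]

/-- Indices in different blocks are told apart by at least one of the two signs. -/
theorem sign_of_block_ne {i j : Fin 9} (h : block i ≠ block j) :
    sign125 i = -sign125 j ∨ sign1234 i = -sign1234 j := by
  fin_cases i <;> fin_cases j <;> simp_all [block, sign125, sign1234, swapSign]

namespace SpinModule

variable (M : SpinModule) (p : Params)

theorem γ_mul_γ (i j : Fin 9) : M.γ i * M.γ j = swapSign i j • (M.γ j * M.γ i) := by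
  have h := M.clifford i j
  unfold swapSign
  split_ifs with hij
  · subst hij; simp
  · rw [if_neg hij] at h
    rw [neg_one_smul]; exact eq_neg_of_add_eq_zero_left h

theorem γ_sq (i : Fin 9) : M.γ i * M.γ i = -1 := by
  have h := M.clifford i i
  rw [if_pos rfl, ← two_smul ℂ] at h
  have h2 : (-2 : Matrix VIdx VIdx ℂ) = (2 : ℂ) • (-1 : Matrix VIdx VIdx ℂ) := by
    ext a b
    rw [Matrix.smul_apply, Matrix.neg_apply, Matrix.neg_apply, Matrix.ofNat_apply, Matrix.one_apply]
    split_ifs <;> simp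
  rw [h2] at h
  exact smul_right_injective _ (two_ne_zero' ℂ) h

theorem γ_anticomm {i j : Fin 9} (h : i ≠ j) : M.γ i * M.γ j = -(M.γ j * M.γ i) := by
  rw [γ_mul_γ, swapSign, if_neg h, neg_one_smul]

theorem γ_mul_γ125 (i : Fin 9) : M.γ i * M.γ125 = sign125 i • (M.γ125 * M.γ i) := by
  unfold γ125 sign125
  rw [← mul_assoc, ← mul_assoc, M.γ_mul_γ i 0, Matrix.smul_mul, mul_assoc (M.γ 0), M.γ_mul_γ i 1,
    Matrix.mul_smul, ← mul_assoc, Matrix.smul_mul, Matrix.smul_mul, mul_assoc _ (M.γ i),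
    M.γ_mul_γ i 4, Matrix.mul_smul, ← mul_assoc, smul_smul, smul_smul]

theorem γ_mul_γ1234 (i : Fin 9) : M.γ i * M.γ1234 = sign1234 i • (M.γ1234 * M.γ i) := by
  unfold γ1234 sign1234
  rw [mul_assoc (M.γ 0 * M.γ 1), ← mul_assoc, ← mul_assoc (M.γ i), M.γ_mul_γ i 0, Matrix.smul_mul,
    mul_assoc (M.γ 0), M.γ_mul_γ i 1, Matrix.mul_smul, ← mul_assoc (M.γ 0), Matrix.smul_mul,
    Matrix.smul_mul, mul_assoc _ (M.γ i), ← mul_assoc (M.γ i), M.γ_mul_γ i 2, Matrix.smul_mul,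
    mul_assoc (M.γ 2), M.γ_mul_γ i 3, Matrix.mul_smul, Matrix.mul_smul,
    Matrix.mul_smul, mul_assoc _ (M.γ 2 * M.γ 3), mul_assoc (M.γ 2), smul_smul, smul_smul, smul_smul]

theorem γ125_sq : M.γ125 * M.γ125 = 1 := by
  have a {i j : Fin 9} (hij : i ≠ j) (x : Matrix VIdx VIdx ℂ) :
      M.γ i * (M.γ j * x) = -(M.γ j * (M.γ i * x)) := by
    rw [← mul_assoc, M.γ_anticomm hij]; simp [mul_assoc]
  have a10 := a (i := 1) (j := 0) (by decide)
  have a40 := a (i := 4) (j := 0) (by decide)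
  have a41 := a (i := 4) (j := 1) (by decide)
  simp only [γ125, mul_assoc, a10, a40, a41, M.γ_sq, mul_neg, neg_neg, mul_one]

theorem γ1234_mul_γ125 : M.γ1234 * M.γ125 = M.γ125 * M.γ1234 := by
  have h0 : sign125 0 = 1 := by simp [sign125, swapSign]
  have h1 : sign125 1 = 1 := by simp [sign125, swapSign]
  have h2 : sign125 2 = -1 := by simp [sign125, swapSign]
  have h3 : sign125 3 = -1 := by simp [sign125, swapSign]
  have k0 := M.γ_mul_γ125 0
  have k1 := M.γ_mul_γ125 1
  have k2 := M.γ_mul_γ125 2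
  have k3 := M.γ_mul_γ125 3
  rw [h0, one_smul] at k0
  rw [h1, one_smul] at k1
  rw [h2, neg_one_smul] at k2
  rw [h3, neg_one_smul] at k3
  rw [γ1234, mul_assoc, k3, mul_neg, mul_assoc, ← mul_assoc (M.γ 2), k2, neg_mul, mul_neg, mul_assoc,
    ← mul_assoc (M.γ 1), ← mul_assoc (M.γ 1), k1, ← mul_assoc, ← mul_assoc, ← mul_assoc, k0, neg_neg]
  simp only [mul_assoc]

theorem γ1234_sq : M.γ1234 * M.γ1234 = 1 := by
  have a {i j : Fin 9} (hij : i ≠ j) (x : Matrix VIdx VIdx ℂ) :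
      M.γ i * (M.γ j * x) = -(M.γ j * (M.γ i * x)) := by
    rw [← mul_assoc, M.γ_anticomm hij]; simp [mul_assoc]
  have a10 := a (i := 1) (j := 0) (by decide)
  have a20 := a (i := 2) (j := 0) (by decide)
  have a30 := a (i := 3) (j := 0) (by decide)
  have a21 := a (i := 2) (j := 1) (by decide)
  have a31 := a (i := 3) (j := 1) (by decide)
  have a32 := a (i := 3) (j := 2) (by decide)
  simp only [γ1234, mul_assoc, a10, a20, a30, a21, a31, a32, M.γ_sq, mul_neg, neg_neg, mul_one]

/-- The trace vanishes because `γ₁` anticommutes with `γ₁₂₃₄` and squares to `-1`. -/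
theorem trace_γ1234 : M.γ1234.trace = 0 := by
  have h := M.γ_mul_γ1234 0
  have h0 : sign1234 0 = -1 := by simp [sign1234, swapSign]
  rw [h0, neg_one_smul] at h
  have h1 : M.γ 0 * M.γ1234 * M.γ 0 = M.γ1234 := by
    rw [h, neg_mul, mul_assoc, γ_sq]; simp
  have h2 : (M.γ 0 * M.γ1234 * M.γ 0).trace = -M.γ1234.trace := by
    rw [Matrix.trace_mul_comm, ← mul_assoc, γ_sq]; simp
  rw [h1] at h2
  linear_combination h2 / 2

/-! ### Vectors in the image of `X⁺` -/

theorem γ_γ125_mulVec (i : Fin 9) (v : VIdx → ℂ) :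
    M.γ i *ᵥ (M.γ125 *ᵥ v) = sign125 i • M.γ125 *ᵥ (M.γ i *ᵥ v) := by
  simp only [Matrix.mulVec_mulVec, γ_mul_γ125, Matrix.smul_mulVec]

theorem γ125_γ125_mulVec (v : VIdx → ℂ) : M.γ125 *ᵥ (M.γ125 *ᵥ v) = v := by
  simp only [Matrix.mulVec_mulVec, γ125_sq, Matrix.one_mulVec]

theorem γ1234_γ125_mulVec (v : VIdx → ℂ) :
    M.γ1234 *ᵥ (M.γ125 *ᵥ v) = M.γ125 *ᵥ (M.γ1234 *ᵥ v) := by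
  simp only [Matrix.mulVec_mulVec, γ1234_mul_γ125]

theorem γ1234_γ_mulVec (i : Fin 9) (v : VIdx → ℂ) :
    M.γ1234 *ᵥ (M.γ i *ᵥ v) = sign1234 i • M.γ i *ᵥ (M.γ1234 *ᵥ v) := by
  simp only [Matrix.mulVec_mulVec, γ_mul_γ1234, smul_smul, Matrix.smul_mulVec]
  have : sign1234 i * sign1234 i = 1 := by rw [sign1234_eq]; split_ifs <;> norm_num
  rw [this, one_smul]

theorem γ_γ_mulVec (i j : Fin 9) (v : VIdx → ℂ) :
    M.γ i *ᵥ (M.γ j *ᵥ v) = swapSign i j • M.γ j *ᵥ (M.γ i *ᵥ v) := by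
  simp only [Matrix.mulVec_mulVec, M.γ_mul_γ i j, Matrix.smul_mulVec]

theorem γ_γ_self_mulVec (i : Fin 9) (v : VIdx → ℂ) : M.γ i *ᵥ (M.γ i *ᵥ v) = -v := by
  simp only [Matrix.mulVec_mulVec, γ_sq, Matrix.neg_mulVec, Matrix.one_mulVec]

/-- The image of `X⁺` is the `1`-eigenspace of `γ₁₂₃₄`. -/
theorem Xm_mulVec_eq_zero_iff (v : VIdx → ℂ) : M.Xm *ᵥ v = 0 ↔ M.γ1234 *ᵥ v = v := by
  rw [Xm, Matrix.smul_mulVec, smul_eq_zero_iff_right (by norm_num), Matrix.sub_mulVec,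
    Matrix.one_mulVec, sub_eq_zero, eq_comm]

theorem cbar_mulVec (v : VIdx → ℂ) : M.cbar p *ᵥ v
    = ((p.αp + p.αm) / 2) • M.γ125 *ᵥ v
      + ((p.αp - p.αm) / 2) • M.γ1234 *ᵥ (M.γ125 *ᵥ v) := by
  simp only [cbar, Xp, Xm, ← Matrix.mulVec_mulVec, Matrix.add_mulVec, Matrix.smul_mulVec,
    Matrix.sub_mulVec, Matrix.one_mulVec]
  module

theorem d_mulVec (v : VIdx → ℂ) : M.d p *ᵥ v
    = ((p.αp' + p.αm') / 2) • M.γ125 *ᵥ v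
      + ((p.αp' - p.αm') / 2) • M.γ1234 *ᵥ (M.γ125 *ᵥ v) := by
  simp only [d, Xp, Xm, ← Matrix.mulVec_mulVec, Matrix.add_mulVec, Matrix.smul_mulVec,
    Matrix.sub_mulVec, Matrix.one_mulVec]
  module

theorem cbar_mulVec_of_eigen {v : VIdx → ℂ} {t : ℂ} (h : M.γ1234 *ᵥ v = t • v) :
    M.cbar p *ᵥ v = ((p.αp + p.αm) / 2 + t * ((p.αp - p.αm) / 2)) • M.γ125 *ᵥ v := by
  rw [cbar_mulVec, γ1234_γ125_mulVec, h, Matrix.mulVec_smul]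
  module

theorem d_mulVec_of_eigen {v : VIdx → ℂ} {t : ℂ} (h : M.γ1234 *ᵥ v = t • v) :
    M.d p *ᵥ v = ((p.αp' + p.αm') / 2 + t * ((p.αp' - p.αm') / 2)) • M.γ125 *ᵥ v := by
  rw [d_mulVec, γ1234_γ125_mulVec, h, Matrix.mulVec_smul]
  module

theorem γ_mulVec_eigen {v : VIdx → ℂ} {t : ℂ} (h : M.γ1234 *ᵥ v = t • v) (i : Fin 9) :
    M.γ1234 *ᵥ (M.γ i *ᵥ v) = (sign1234 i * t) • M.γ i *ᵥ v := by
  rw [γ1234_γ_mulVec, h, Matrix.mulVec_smul, smul_smul]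

theorem γ125_mulVec_eigen {v : VIdx → ℂ} {t : ℂ} (h : M.γ1234 *ᵥ v = t • v) :
    M.γ1234 *ᵥ (M.γ125 *ᵥ v) = t • M.γ125 *ᵥ v := by
  rw [γ1234_γ125_mulVec, h, Matrix.mulVec_smul]

theorem s_mulVec (i : Fin 9) (v : VIdx → ℂ) :
    M.s p i *ᵥ v = M.cbar p *ᵥ (M.γ i *ᵥ v) - M.γ i *ᵥ (M.d p *ᵥ v) := by
  simp only [s, Matrix.sub_mulVec, Matrix.mulVec_mulVec]

theorem sdc_mulVec (i : Fin 9) (v : VIdx → ℂ) :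
    M.sdc p i *ᵥ v = M.d p *ᵥ (M.γ i *ᵥ v) - M.γ i *ᵥ (M.cbar p *ᵥ v) := by
  simp only [sdc, Matrix.sub_mulVec, Matrix.mulVec_mulVec]

/-- `s_{c̄,d}(eᵢ)` on an eigenspace of `γ₁₂₃₄` is a multiple of `γ₁₂₅ γᵢ`. -/
theorem s_mulVec_of_eigen {v : VIdx → ℂ} {t : ℂ} (h : M.γ1234 *ᵥ v = t • v) (i : Fin 9) :
    M.s p i *ᵥ v = ((p.αp + p.αm) / 2 + sign1234 i * t * ((p.αp - p.αm) / 2)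
      - sign125 i * ((p.αp' + p.αm') / 2 + t * ((p.αp' - p.αm') / 2)))
        • M.γ125 *ᵥ (M.γ i *ᵥ v) := by
  rw [s_mulVec, M.cbar_mulVec_of_eigen p (M.γ_mulVec_eigen h i), M.d_mulVec_of_eigen p h,
    Matrix.mulVec_smul, γ_γ125_mulVec]
  module

/-- The four cases in the definition of `μ` in terms of the signs of `γᵢ` against
`γ₁₂₃₄` and `γ₁₂₅`. -/
theorem μ_eq (i : Fin 9) : p.μ i = (p.αp + p.αm) / 2 + sign1234 i * ((p.αp - p.αm) / 2)
    - sign125 i * p.αp' := by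
  fin_cases i <;> simp [Params.μ, sign125, sign1234, swapSign] <;> ring

/-- On the image of `X⁺`, where the parameter `α'₋` plays no role. -/
theorem s_mulVec_of_mem {v : VIdx → ℂ} (h : M.γ1234 *ᵥ v = v) (i : Fin 9) :
    M.s p i *ᵥ v = p.μ i • M.γ125 *ᵥ (M.γ i *ᵥ v) := by
  rw [M.s_mulVec_of_eigen p (t := 1) (by rw [h, one_smul]) i, μ_eq]
  congr 1; ring

theorem d_mulVec_of_mem {v : VIdx → ℂ} (h : M.γ1234 *ᵥ v = v) :
    M.d p *ᵥ v = p.αp' • M.γ125 *ᵥ v := by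
  rw [M.d_mulVec_of_eigen p (t := 1) (by rw [h, one_smul])]
  congr 1; ring

theorem d_mulVec_mem {v : VIdx → ℂ} (h : M.γ1234 *ᵥ v = v) :
    M.γ1234 *ᵥ (M.d p *ᵥ v) = M.d p *ᵥ v := by
  rw [M.d_mulVec_of_mem p h, Matrix.mulVec_smul, γ1234_γ125_mulVec, h]

/-- The curvature of the connection in direction `(e₋, eᵢ)` on an eigenspace of `γ₁₂₃₄`. -/
theorem cbar_s_sub_s_d_of_eigen {v : VIdx → ℂ} {t : ℂ} (h : M.γ1234 *ᵥ v = t • v) (i : Fin 9) :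
    M.cbar p *ᵥ (M.s p i *ᵥ v) - M.s p i *ᵥ (M.d p *ᵥ v)
      = (((p.αp + p.αm) / 2 + sign1234 i * t * ((p.αp - p.αm) / 2)
      - sign125 i * ((p.αp' + p.αm') / 2 + t * ((p.αp' - p.αm') / 2))) ^ 2) • M.γ i *ᵥ v := by
  have h1 := M.γ_mulVec_eigen h i
  have h2 := M.γ125_mulVec_eigen h1
  have h3 := M.γ125_mulVec_eigen h
  rw [M.s_mulVec_of_eigen p h, M.d_mulVec_of_eigen p h, Matrix.mulVec_smul, Matrix.mulVec_smul,
    M.cbar_mulVec_of_eigen p h2, M.s_mulVec_of_eigen p h3, γ_γ125_mulVec, Matrix.mulVec_smul,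
    γ125_γ125_mulVec, smul_smul, smul_smul, smul_smul, ← sub_smul]
  congr 1
  ring

/-- Vanishing of the curvature of `D` on the image of `X⁺`, as `Bᵢ = -μᵢ²`. -/
theorem cbar_s_sub_s_d {v : VIdx → ℂ} (h : M.γ1234 *ᵥ v = v) (i : Fin 9) :
    M.cbar p *ᵥ (M.s p i *ᵥ v) - M.s p i *ᵥ (M.d p *ᵥ v) = (p.μ i ^ 2) • M.γ i *ᵥ v := by
  rw [M.cbar_s_sub_s_d_of_eigen p (t := 1) (by rw [h, one_smul]) i, μ_eq]
  congr 1; ring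

/-! ### The charge conjugation on `S(V)` -/

/-- The charge conjugation of `S(V)`, as a bilinear form. -/
def form (v w : VIdx → ℂ) : ℂ := v ⬝ᵥ M.CV *ᵥ w

theorem form_add_left (v v' w) : M.form (v + v') w = M.form v w + M.form v' w := by
  simp [form, add_dotProduct]
theorem form_add_right (v w w') : M.form v (w + w') = M.form v w + M.form v w' := by
  simp [form, dotProduct_add, Matrix.mulVec_add]
theorem form_smul_left (c : ℂ) (v w) : M.form (c • v) w = c * M.form v w := by
  simp [form]
theorem form_smul_right (c : ℂ) (v w) : M.form v (c • w) = c * M.form v w := by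
  simp [form, Matrix.mulVec_smul]
theorem form_neg_left (v w) : M.form (-v) w = -M.form v w := by simp [form]
theorem form_neg_right (v w) : M.form v (-w) = -M.form v w := by simp [form, Matrix.mulVec_neg]
theorem form_sub_left (v v' w) : M.form (v - v') w = M.form v w - M.form v' w := by
  rw [sub_eq_add_neg, form_add_left, form_neg_left, sub_eq_add_neg]
theorem form_sub_right (v w w') : M.form v (w - w') = M.form v w - M.form v w' := by
  rw [sub_eq_add_neg, form_add_right, form_neg_right, sub_eq_add_neg]
theorem form_zero_left (w) : M.form 0 w = 0 := by simp [form]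
theorem form_zero_right (v) : M.form v 0 = 0 := by simp [form]

theorem form_comm (v w : VIdx → ℂ) : M.form v w = M.form w v := by
  conv_rhs => rw [form, Matrix.dotProduct_mulVec, ← Matrix.mulVec_transpose, M.CV_symm]
  rw [form, dotProduct_comm]

theorem form_γ (i : Fin 9) (v w : VIdx → ℂ) : M.form (M.γ i *ᵥ v) w = M.form v (M.γ i *ᵥ w) := by
  rw [form, form, Matrix.mulVec_mulVec, ← M.CV_γ, ← Matrix.mulVec_mulVec, Matrix.dotProduct_mulVec v,
    Matrix.vecMul_transpose]

theorem form_γ125 (v w : VIdx → ℂ) : M.form (M.γ125 *ᵥ v) w = -M.form v (M.γ125 *ᵥ w) := by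
  simp only [γ125, ← Matrix.mulVec_mulVec, form_γ]
  have a {i j : Fin 9} (hij : i ≠ j) (x : VIdx → ℂ) :
      M.γ i *ᵥ (M.γ j *ᵥ x) = -(M.γ j *ᵥ (M.γ i *ᵥ x)) := by
    rw [γ_γ_mulVec, swapSign, if_neg hij, neg_one_smul]
  have a10 := a (i := 1) (j := 0) (by decide)
  have a40 := a (i := 4) (j := 0) (by decide)
  have a41 := a (i := 4) (j := 1) (by decide)
  simp only [a10, a40, a41, Matrix.mulVec_neg, neg_neg, form_neg_right]

theorem form_γ1234 (v w : VIdx → ℂ) : M.form (M.γ1234 *ᵥ v) w = M.form v (M.γ1234 *ᵥ w) := by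
  simp only [γ1234, ← Matrix.mulVec_mulVec, form_γ]
  have a {i j : Fin 9} (hij : i ≠ j) (x : VIdx → ℂ) :
      M.γ i *ᵥ (M.γ j *ᵥ x) = -(M.γ j *ᵥ (M.γ i *ᵥ x)) := by
    rw [γ_γ_mulVec, swapSign, if_neg hij, neg_one_smul]
  have a10 := a (i := 1) (j := 0) (by decide)
  have a20 := a (i := 2) (j := 0) (by decide)
  have a30 := a (i := 3) (j := 0) (by decide)
  have a21 := a (i := 2) (j := 1) (by decide)
  have a31 := a (i := 3) (j := 1) (by decide)
  have a32 := a (i := 3) (j := 2) (by decide)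
  simp only [a10, a20, a30, a21, a31, a32, Matrix.mulVec_neg, neg_neg]

theorem form_cbar (v w : VIdx → ℂ) : M.form (M.cbar p *ᵥ v) w = -M.form v (M.cbar p *ᵥ w) := by
  simp only [cbar_mulVec, form_add_left, form_add_right, form_smul_left, form_smul_right,
    form_γ1234, form_γ125, γ1234_γ125_mulVec]
  ring

theorem form_d (v w : VIdx → ℂ) : M.form (M.d p *ᵥ v) w = -M.form v (M.d p *ᵥ w) := by
  simp only [d_mulVec, form_add_left, form_add_right, form_smul_left, form_smul_right,
    form_γ1234, form_γ125, γ1234_γ125_mulVec]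
  ring

theorem form_s (i : Fin 9) (v w : VIdx → ℂ) :
    M.form (M.s p i *ᵥ v) w = M.form v (M.sdc p i *ᵥ w) := by
  simp only [s_mulVec, sdc_mulVec, form_sub_left, form_sub_right, form_γ, form_cbar, form_d]
  ring

end SpinModule

/-! ### The two halves of a spinor -/

/-- The component of a spinor in `S⁻`, as an element of `S(V)`. -/
def sMinus (ξ : Spinor) : VIdx → ℂ := fun a => ξ (0, a)

/-- The component of a spinor in `S⁺`, as an element of `S(V)`. -/
def sPlus (ξ : Spinor) : VIdx → ℂ := fun a => ξ (1, a)

theorem spinor_ext {ξ η : Spinor} (h₁ : sMinus ξ = sMinus η) (h₂ : sPlus ξ = sPlus η) : ξ = η := by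
  ext ⟨i, a⟩
  fin_cases i
  · exact congrFun h₁ a
  · exact congrFun h₂ a

@[simp] theorem sMinus_add (ξ η : Spinor) : sMinus (ξ + η) = sMinus ξ + sMinus η := rfl
@[simp] theorem sPlus_add (ξ η : Spinor) : sPlus (ξ + η) = sPlus ξ + sPlus η := rfl
@[simp] theorem sMinus_sub (ξ η : Spinor) : sMinus (ξ - η) = sMinus ξ - sMinus η := rfl
@[simp] theorem sPlus_sub (ξ η : Spinor) : sPlus (ξ - η) = sPlus ξ - sPlus η := rfl
@[simp] theorem sMinus_neg (ξ : Spinor) : sMinus (-ξ) = -sMinus ξ := rfl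
@[simp] theorem sPlus_neg (ξ : Spinor) : sPlus (-ξ) = -sPlus ξ := rfl
@[simp] theorem sMinus_smul (c : ℂ) (ξ : Spinor) : sMinus (c • ξ) = c • sMinus ξ := rfl
@[simp] theorem sPlus_smul (c : ℂ) (ξ : Spinor) : sPlus (c • ξ) = c • sPlus ξ := rfl
@[simp] theorem sMinus_zero : sMinus 0 = 0 := rfl
@[simp] theorem sPlus_zero : sPlus 0 = 0 := rfl
@[simp] theorem sMinus_sum {ι : Type*} (s : Finset ι) (f : ι → Spinor) :
    sMinus (∑ i ∈ s, f i) = ∑ i ∈ s, sMinus (f i) := by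
  ext a; simp [sMinus, Finset.sum_apply]
@[simp] theorem sPlus_sum {ι : Type*} (s : Finset ι) (f : ι → Spinor) :
    sPlus (∑ i ∈ s, f i) = ∑ i ∈ s, sPlus (f i) := by
  ext a; simp [sPlus, Finset.sum_apply]

theorem kronecker_mulVec_apply (A : Matrix (Fin 2) (Fin 2) ℂ) (b : Matrix VIdx VIdx ℂ) (ξ : Spinor)
    (i : Fin 2) (a : VIdx) :
    ((A ⊗ₖ b) *ᵥ ξ) (i, a) = A i 0 * (b *ᵥ sMinus ξ) a + A i 1 * (b *ᵥ sPlus ξ) a := by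
  rw [Matrix.mulVec, dotProduct, Fintype.sum_prod_type, Fin.sum_univ_two]
  simp only [Matrix.kroneckerMap_apply, Matrix.mulVec, dotProduct, Finset.mul_sum, sMinus, sPlus,
    mul_assoc]

theorem sMinus_kronecker (A : Matrix (Fin 2) (Fin 2) ℂ) (b : Matrix VIdx VIdx ℂ) (ξ : Spinor) :
    sMinus ((A ⊗ₖ b) *ᵥ ξ) = A 0 0 • b *ᵥ sMinus ξ + A 0 1 • b *ᵥ sPlus ξ := by
  ext a; exact kronecker_mulVec_apply A b ξ 0 a

theorem sPlus_kronecker (A : Matrix (Fin 2) (Fin 2) ℂ) (b : Matrix VIdx VIdx ℂ) (ξ : Spinor) :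
    sPlus ((A ⊗ₖ b) *ᵥ ξ) = A 1 0 • b *ᵥ sMinus ξ + A 1 1 • b *ᵥ sPlus ξ := by
  ext a; exact kronecker_mulVec_apply A b ξ 1 a

@[simp] theorem sMinus_liftV (a : Matrix VIdx VIdx ℂ) (ξ : Spinor) :
    sMinus (liftV a *ᵥ ξ) = a *ᵥ sMinus ξ := by simp [liftV, sMinus_kronecker]
@[simp] theorem sPlus_liftV (a : Matrix VIdx VIdx ℂ) (ξ : Spinor) :
    sPlus (liftV a *ᵥ ξ) = a *ᵥ sPlus ξ := by simp [liftV, sPlus_kronecker]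
@[simp] theorem sMinus_projMinus (ξ : Spinor) : sMinus (projMinus *ᵥ ξ) = sMinus ξ := by
  simp [projMinus, sMinus_kronecker]
@[simp] theorem sPlus_projMinus (ξ : Spinor) : sPlus (projMinus *ᵥ ξ) = 0 := by
  simp [projMinus, sPlus_kronecker]
@[simp] theorem sMinus_projPlus (ξ : Spinor) : sMinus (projPlus *ᵥ ξ) = 0 := by
  simp [projPlus, sMinus_kronecker]
@[simp] theorem sPlus_projPlus (ξ : Spinor) : sPlus (projPlus *ᵥ ξ) = sPlus ξ := by
  simp [projPlus, sPlus_kronecker]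

/-- `√2` as a complex number. -/
def rt : ℂ := (Real.sqrt 2 : ℂ)

theorem rt_mul_rt : rt * rt = 2 := by
  rw [rt, ← Complex.ofReal_mul, Real.mul_self_sqrt (by norm_num)]; norm_num

theorem rt_ne_zero : rt ≠ 0 := by
  intro h; have := rt_mul_rt; rw [h] at this; norm_num at this

namespace SpinModule

variable (M : SpinModule) (p : Params)

@[simp] theorem sMinus_Γplus (ξ : Spinor) : sMinus (M.Γ plus *ᵥ ξ) = rt • sPlus ξ := by
  simp [Γ, gammaPlus, rt, sMinus_kronecker]
@[simp] theorem sPlus_Γplus (ξ : Spinor) : sPlus (M.Γ plus *ᵥ ξ) = 0 := by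
  simp [Γ, gammaPlus, sPlus_kronecker]
@[simp] theorem sMinus_Γminus (ξ : Spinor) : sMinus (M.Γ minus *ᵥ ξ) = 0 := by
  simp [Γ, gammaMinus, sMinus_kronecker]
@[simp] theorem sPlus_Γminus (ξ : Spinor) : sPlus (M.Γ minus *ᵥ ξ) = -(rt • sMinus ξ) := by
  simp [Γ, gammaMinus, rt, sPlus_kronecker]
@[simp] theorem sMinus_Γ (i : Fin 9) (ξ : Spinor) :
    sMinus (M.Γ (Sum.inr i) *ᵥ ξ) = -(M.γ i *ᵥ sMinus ξ) := by
  simp [Γ, sigma, sMinus_kronecker]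
@[simp] theorem sPlus_Γ (i : Fin 9) (ξ : Spinor) :
    sPlus (M.Γ (Sum.inr i) *ᵥ ξ) = M.γ i *ᵥ sPlus ξ := by
  simp [Γ, sigma, sPlus_kronecker]

theorem C_eq (ξ η : Spinor) : M.C ξ η
    = -Complex.I * M.form (sMinus ξ) (sPlus η) + Complex.I * M.form (sPlus ξ) (sMinus η) := by
  rw [C, dotProduct, Fintype.sum_prod_type, Fin.sum_univ_two]
  simp only [kronecker_mulVec_apply, form, dotProduct, Finset.mul_sum]
  congr 1 <;> refine Finset.sum_congr rfl fun a _ => ?_ <;> simp [sMinus, sPlus, pauli2] <;> ring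

/-- Membership in the space of constants: `ξ₂⁰` lies in the image of `X⁺`. -/
theorem mem_constants_iff (ζ : Spinor) : ζ ∈ M.constants ↔ M.γ1234 *ᵥ sPlus ζ = sPlus ζ := by
  rw [← Xm_mulVec_eq_zero_iff, constants, LinearMap.mem_ker, Matrix.mulVecLin_apply,
    ← Matrix.mulVec_mulVec]
  constructor
  · intro h; have := congrArg sPlus h; simpa [-Matrix.mulVec_mulVec] using this
  · intro h; exact spinor_ext (by simp [-Matrix.mulVec_mulVec])
      (by simpa [-Matrix.mulVec_mulVec] using h)

/-! ### The coefficients of the odd-odd bracket on `S(V)` -/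

theorem coeffMinus_eq (ζ θ : Spinor) :
    M.coeffMinus ζ θ = Complex.I * rt * M.form (sPlus ζ) (sPlus θ) := by
  simp [coeffMinus, C_eq, form_smul_right, form_zero_left, mul_assoc, -Matrix.mulVec_mulVec]

theorem coeffPlus_eq (ζ θ : Spinor) :
    M.coeffPlus ζ θ = Complex.I * rt * M.form (sMinus ζ) (sMinus θ) := by
  simp [coeffPlus, C_eq, form_smul_right, form_neg_right, form_zero_left, mul_assoc,
    -Matrix.mulVec_mulVec]

theorem coeffVec_eq (i : Fin 9) (ζ θ : Spinor) : M.coeffVec i ζ θ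
    = -Complex.I * (M.form (sMinus ζ) (M.γ i *ᵥ sPlus θ) + M.form (sMinus θ) (M.γ i *ᵥ sPlus ζ)) := by
  simp [coeffVec, C_eq, form_zero_left, -Matrix.mulVec_mulVec]; ring

theorem coeffStar_eq (B : Fin 9 → ℝ) (i : Fin 9) (ζ θ : Spinor) : M.coeffStar p B i ζ θ
    = -Complex.I * (B i : ℂ)⁻¹ *
      (M.form (sMinus ζ) (M.s p i *ᵥ sPlus θ) + M.form (sMinus θ) (M.s p i *ᵥ sPlus ζ)) := by
  simp only [coeffStar, C_eq, sMinus_projMinus, sPlus_projMinus, sMinus_liftV, sPlus_liftV,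
    sMinus_projPlus, sPlus_projPlus, Matrix.smul_mulVec, form_smul_left, form_smul_right,
    Matrix.mulVec_zero, form_zero_right]
  rw [M.form_comm (M.s p i *ᵥ sPlus ζ)]
  ring

theorem coeffRot_eq (i j : Fin 9) (ζ θ : Spinor) : M.coeffRot p i j ζ θ
    = -(1 / 2) * (Complex.I * rt) *
      (M.form (M.s p j *ᵥ sPlus ζ) (M.γ i *ᵥ sPlus θ)
        + M.form (M.γ i *ᵥ sPlus ζ) (M.s p j *ᵥ sPlus θ)) := by
  simp only [coeffRot, C_eq, ← Matrix.mulVec_mulVec, Matrix.add_mulVec, sMinus_Γplus, sPlus_Γplus,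
    sMinus_projPlus, sPlus_projPlus, sPlus_liftV, sPlus_Γ, sPlus_add, form_zero_left,
    form_smul_right, form_add_right, form_s, form_γ]
  ring

/-! ### The action of the represented endomorphisms -/

@[simp] theorem rho_plus : M.rho p plus = 0 := rfl

theorem sMinus_rho_minus (ξ : Spinor) :
    sMinus (M.rho p minus *ᵥ ξ) = M.cbar p *ᵥ sMinus ξ := by
  simp [rho, Matrix.add_mulVec, ← Matrix.mulVec_mulVec]
theorem sPlus_rho_minus (ξ : Spinor) : sPlus (M.rho p minus *ᵥ ξ) = M.d p *ᵥ sPlus ξ := by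
  simp [rho, Matrix.add_mulVec, ← Matrix.mulVec_mulVec]
theorem sMinus_rho_vec (i : Fin 9) (ξ : Spinor) :
    sMinus (M.rho p (Sum.inr i) *ᵥ ξ) = -((rt / 2) • M.s p i *ᵥ sPlus ξ) := by
  simp only [rho, Matrix.smul_mulVec, ← Matrix.mulVec_mulVec, sMinus_smul, sMinus_Γplus, sPlus_liftV]
  module
theorem sPlus_rho_vec (i : Fin 9) (ξ : Spinor) : sPlus (M.rho p (Sum.inr i) *ᵥ ξ) = 0 := by
  simp [rho, Matrix.smul_mulVec, ← Matrix.mulVec_mulVec, -neg_smul, -smul_neg]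
theorem sMinus_rhoStar (B : Fin 9 → ℝ) (i : Fin 9) (ξ : Spinor) :
    sMinus (M.rhoStar B i *ᵥ ξ) = (rt / 2 * B i) • M.γ i *ᵥ sPlus ξ := by
  simp only [rhoStar, Matrix.smul_mulVec, ← Matrix.mulVec_mulVec, sMinus_smul, sMinus_Γplus,
    sPlus_smul, sPlus_Γ]
  module
theorem sPlus_rhoStar (B : Fin 9 → ℝ) (i : Fin 9) (ξ : Spinor) : sPlus (M.rhoStar B i *ᵥ ξ) = 0 := by
  simp only [rhoStar, Matrix.smul_mulVec, ← Matrix.mulVec_mulVec, sPlus_smul, sPlus_Γplus, smul_zero]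

/-- `-½ γᵢⱼ`, the spin representation of `eᵢ ∧ eⱼ` on `S(V)`. -/
def rot (i j : Fin 9) : Matrix VIdx VIdx ℂ := -(1 / 4 : ℂ) • (M.γ i * M.γ j - M.γ j * M.γ i)

theorem rot_mulVec (i j : Fin 9) (v : VIdx → ℂ) : M.rot i j *ᵥ v
    = -(1 / 4 : ℂ) • (M.γ i *ᵥ (M.γ j *ᵥ v) - M.γ j *ᵥ (M.γ i *ᵥ v)) := by
  simp only [rot, Matrix.smul_mulVec, Matrix.sub_mulVec, Matrix.mulVec_mulVec]

theorem sMinus_rhoRot (i j : Fin 9) (ξ : Spinor) :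
    sMinus (M.rhoRot i j *ᵥ ξ) = M.rot i j *ᵥ sMinus ξ := by
  simp only [rhoRot, rot_mulVec, Matrix.smul_mulVec, Matrix.sub_mulVec, ← Matrix.mulVec_mulVec,
    sMinus_smul, sMinus_sub, sMinus_Γ, Matrix.mulVec_neg]
  module
theorem sPlus_rhoRot (i j : Fin 9) (ξ : Spinor) :
    sPlus (M.rhoRot i j *ᵥ ξ) = M.rot i j *ᵥ sPlus ξ := by
  simp only [rhoRot, rot_mulVec, Matrix.smul_mulVec, Matrix.sub_mulVec, ← Matrix.mulVec_mulVec,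
    sPlus_smul, sPlus_sub, sPlus_Γ]
  module

/-- `rot i j` acts on the vectors `γₖ` as an infinitesimal rotation. -/
theorem γ_rot_mulVec (i j k : Fin 9) (v : VIdx → ℂ) :
    M.γ k *ᵥ (M.rot i j *ᵥ v) = M.rot i j *ᵥ (M.γ k *ᵥ v)
      + ((if k = i then M.γ j *ᵥ v else 0) - (if k = j then M.γ i *ᵥ v else 0)) := by
  have key (a b : Fin 9) : M.γ a *ᵥ (M.γ b *ᵥ (M.γ k *ᵥ v)) = M.γ k *ᵥ (M.γ a *ᵥ (M.γ b *ᵥ v))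
      + (2 : ℂ) • ((if k = a then M.γ b *ᵥ v else 0) - (if k = b then M.γ a *ᵥ v else 0)) := by
    by_cases ha : k = a <;> by_cases hb : k = b
    · subst ha; subst hb; simp
    · subst ha
      rw [M.γ_γ_mulVec b k v, M.γ_γ_self_mulVec k (M.γ b *ᵥ v), swapSign, if_neg (Ne.symm hb),
        Matrix.mulVec_smul, γ_γ_self_mulVec, if_pos rfl, if_neg hb]
      module
    · subst hb
      rw [M.γ_γ_self_mulVec k v, M.γ_γ_mulVec k a, swapSign, if_neg ha, γ_γ_self_mulVec, if_neg ha,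
        if_pos rfl]
      simp only [Matrix.mulVec_neg]
      module
    · rw [M.γ_γ_mulVec b k v, Matrix.mulVec_smul, M.γ_γ_mulVec a k, swapSign, swapSign,
        if_neg (Ne.symm ha), if_neg (Ne.symm hb), if_neg ha, if_neg hb]
      module
  rw [rot_mulVec, rot_mulVec, key i j, key j i, Matrix.mulVec_smul, Matrix.mulVec_sub]
  module

theorem form_rot (i j : Fin 9) (v w : VIdx → ℂ) :
    M.form (M.rot i j *ᵥ v) w = -M.form v (M.rot i j *ᵥ w) := by
  simp only [rot_mulVec, form_smul_left, form_smul_right, form_sub_left, form_sub_right, form_γ]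
  ring

/-- Within a block, `γᵢ` and `γⱼ` pick up the same sign when they pass `γ₁₂₅`, and likewise
`γ₁₂₃₄`; so rotations within a block commute with `c̄` and `d`. -/
theorem γ125_rot_mulVec {i j : Fin 9} (h : block i = block j) (v : VIdx → ℂ) :
    M.γ125 *ᵥ (M.rot i j *ᵥ v) = M.rot i j *ᵥ (M.γ125 *ᵥ v) := by
  have e := sign125_mul_self j
  simp only [rot_mulVec, γ_γ125_mulVec, Matrix.mulVec_smul, Matrix.mulVec_sub, smul_smul,
    block_sign125 h, e, one_smul]

theorem γ1234_rot_mulVec {i j : Fin 9} (h : block i = block j) (v : VIdx → ℂ) :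
    M.γ1234 *ᵥ (M.rot i j *ᵥ v) = M.rot i j *ᵥ (M.γ1234 *ᵥ v) := by
  have e : sign1234 j * sign1234 j = 1 := by rw [sign1234_eq]; split_ifs <;> norm_num
  simp only [rot_mulVec, γ1234_γ_mulVec, Matrix.mulVec_smul, Matrix.mulVec_sub, smul_smul,
    block_sign1234 h, e, one_smul]

theorem cbar_rot_mulVec {i j : Fin 9} (h : block i = block j) (v : VIdx → ℂ) :
    M.cbar p *ᵥ (M.rot i j *ᵥ v) = M.rot i j *ᵥ (M.cbar p *ᵥ v) := by
  simp only [cbar_mulVec, γ125_rot_mulVec M h, γ1234_rot_mulVec M h, Matrix.mulVec_add,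
    Matrix.mulVec_smul]

theorem d_rot_mulVec {i j : Fin 9} (h : block i = block j) (v : VIdx → ℂ) :
    M.d p *ᵥ (M.rot i j *ᵥ v) = M.rot i j *ᵥ (M.d p *ᵥ v) := by
  simp only [d_mulVec, γ125_rot_mulVec M h, γ1234_rot_mulVec M h, Matrix.mulVec_add,
    Matrix.mulVec_smul]

theorem s_rot_mulVec {i j : Fin 9} (h : block i = block j) (k : Fin 9) (v : VIdx → ℂ) :
    M.s p k *ᵥ (M.rot i j *ᵥ v) = M.rot i j *ᵥ (M.s p k *ᵥ v)
      + ((if k = i then M.s p j *ᵥ v else 0) - (if k = j then M.s p i *ᵥ v else 0)) := by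
  simp only [s_mulVec, d_rot_mulVec M p h, γ_rot_mulVec, Matrix.mulVec_add, Matrix.mulVec_sub,
    cbar_rot_mulVec M p h]
  split_ifs <;> (try simp only [Matrix.mulVec_zero]) <;> abel

end SpinModule

/-! ### Coordinate derivatives -/

section pd

variable {F G : Type*} [NormedAddCommGroup F] [NormedSpace ℝ F] [NormedAddCommGroup G]
  [NormedSpace ℝ G] {x : Pt} (m : Idx)

theorem pd_const (c : F) (x : Pt) : pd m (fun _ => c) x = 0 := by simp [pd]

theorem pd_add {f g : Pt → F} (hf : DifferentiableAt ℝ f x) (hg : DifferentiableAt ℝ g x) :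
    pd m (fun y => f y + g y) x = pd m f x + pd m g x := by
  simp only [pd]; rw [fderiv_fun_add hf hg]; rfl

theorem pd_sub {f g : Pt → F} (hf : DifferentiableAt ℝ f x) (hg : DifferentiableAt ℝ g x) :
    pd m (fun y => f y - g y) x = pd m f x - pd m g x := by
  simp only [pd]; rw [fderiv_fun_sub hf hg]; rfl

theorem pd_neg (f : Pt → F) (x : Pt) : pd m (fun y => -f y) x = -pd m f x := by
  simp only [pd]; rw [fderiv_fun_neg]; rfl

theorem pd_sum {ι : Type*} (s : Finset ι) {f : ι → Pt → F}
    (hf : ∀ i ∈ s, DifferentiableAt ℝ (f i) x) :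
    pd m (fun y => ∑ i ∈ s, f i y) x = ∑ i ∈ s, pd m (f i) x := by
  simp only [pd]; rw [fderiv_fun_sum hf]; simp

theorem pd_clm (L : F →L[ℝ] G) {f : Pt → F} (hf : DifferentiableAt ℝ f x) :
    pd m (fun y => L (f y)) x = L (pd m f x) := by
  simp only [pd]
  rw [show (fun y => L (f y)) = L ∘ f from rfl, fderiv_comp _ L.differentiableAt hf, L.fderiv]; rfl

theorem pd_apply {ι : Type*} [Fintype ι] {f : Pt → ι → F} (hf : DifferentiableAt ℝ f x) (k : ι) :
    pd m (fun y => f y k) x = pd m f x k :=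
  pd_clm m (ContinuousLinearMap.proj (R := ℝ) (φ := fun _ : ι => F) k) hf

theorem pd_smul_const {f : Pt → ℂ} [NormedSpace ℂ F] [IsScalarTower ℝ ℂ F]
    (hf : DifferentiableAt ℝ f x) (v : F) : pd m (fun y => f y • v) x = pd m f x • v := by
  simp only [pd]; rw [fderiv_smul_const hf]; rfl

theorem pd_const_smul {f : Pt → F} [NormedSpace ℂ F] [IsScalarTower ℝ ℂ F] (c : ℂ)
    (hf : DifferentiableAt ℝ f x) : pd m (fun y => c • f y) x = c • pd m f x := by
  simp only [pd]; rw [fderiv_fun_const_smul hf]; rfl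

theorem pd_mul {𝔸 : Type*} [NormedRing 𝔸] [NormedAlgebra ℝ 𝔸] {f g : Pt → 𝔸}
    (hf : DifferentiableAt ℝ f x) (hg : DifferentiableAt ℝ g x) :
    pd m (fun y => f y * g y) x = f x * pd m g x + pd m f x * g x := by
  simp only [pd]; rw [fderiv_fun_mul' hf hg]; rfl

theorem pd_comp_coord {f : ℝ → F} {f' : F} (n : Idx) (hf : HasDerivAt f f' (x n)) :
    pd m (fun y => f (y n)) x = if m = n then f' else 0 := by
  have h1 : HasFDerivAt (fun y : Pt => y n) (ContinuousLinearMap.proj (R := ℝ) n) x :=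
    (ContinuousLinearMap.proj (R := ℝ) (φ := fun _ : Idx => ℝ) n).hasFDerivAt
  have h := hf.hasFDerivAt.comp x h1
  simp only [pd]
  rw [show (fun y : Pt => f (y n)) = f ∘ fun y => y n from rfl, h.fderiv]
  by_cases hmn : m = n
  · subst hmn; simp
  · simp [hmn]

theorem pd_coord_ofReal (n : Idx) (x : Pt) : pd m (fun y => (y n : ℂ)) x = if m = n then 1 else 0 :=
  pd_comp_coord m n ((hasDerivAt_id (x n)).ofReal_comp)

/-- A function is constant if its coordinate derivatives vanish. -/
theorem eq_of_pd_eq_zero {f : Pt → F} (hf : Differentiable ℝ f) (h : ∀ m x, pd m f x = 0) (x y : Pt) :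
    f x = f y := by
  refine is_const_of_fderiv_eq_zero (𝕜 := ℝ) hf (fun z => ?_) x y
  refine ContinuousLinearMap.coe_injective ((Pi.basisFun ℝ Idx).ext fun m => ?_)
  simpa [pd] using h m z

theorem contDiff_pd {f : Pt → F} (hf : ContDiff ℝ ∞ f) : ContDiff ℝ ∞ (pd m f) :=
  (hf.fderiv_right (m := ∞) le_rfl).clm_apply contDiff_const

theorem pd_comm {f : Pt → F} (hf : ContDiff ℝ ∞ f) (n : Idx) (x : Pt) :
    pd m (pd n f) x = pd n (pd m f) x := by
  have hd : DifferentiableAt ℝ (fderiv ℝ f) x :=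
    ((hf.fderiv_right (m := ∞) le_rfl).differentiable (by simp)) x
  -- The second derivative of `f` as a bilinear form.
  have key (a b : Idx) : pd a (pd b f) x = fderiv ℝ (fderiv ℝ f) x (Pi.single a 1) (Pi.single b 1) := by
    have := fderiv_clm_apply hd (differentiableAt_const (Pi.single b (1 : ℝ) : Pt))
    change fderiv ℝ (fun y => fderiv ℝ f y (Pi.single b 1)) x (Pi.single a 1) = _
    rw [this]; simp
  rw [key, key]
  exact (hf.contDiffAt.isSymmSndFDerivAt
    (by
      simp only [minSmoothness_of_isRCLikeNormedField]
      exact WithTop.coe_le_coe.2 (le_top (a := (2 : ℕ∞))))).eq _ _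

end pd

/-! ### The metric and its Levi-Civita connection -/

/-- The quadratic form `∑ Bᵢ (xⁱ)²`. -/
def quad (B : Fin 9 → ℝ) (x : Pt) : ℝ := ∑ i, B i * x (Sum.inr i) ^ 2

theorem pd_quad_inl (B : Fin 9 → ℝ) (x : Pt) (a : Fin 2) : pd (Sum.inl a) (quad B) x = 0 := by
  unfold quad
  rw [pd_sum _ _ (fun i _ => by fun_prop)]
  refine Finset.sum_eq_zero fun i _ => ?_
  have := pd_comp_coord (Sum.inl a) (Sum.inr i) (x := x)
    (((hasDerivAt_id (x (Sum.inr i))).pow 2).const_mul (B i))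
  simpa using this

theorem pd_quad_inr (B : Fin 9 → ℝ) (x : Pt) (k : Fin 9) :
    pd (Sum.inr k) (quad B) x = 2 * (B k * x (Sum.inr k)) := by
  unfold quad
  rw [pd_sum _ _ (fun i _ => by fun_prop), Finset.sum_eq_single k]
  · have := pd_comp_coord (Sum.inr k) (Sum.inr k) (x := x)
      (((hasDerivAt_id (x (Sum.inr k))).pow 2).const_mul (B k))
    rw [if_pos rfl] at this
    refine Eq.trans this ?_
    simp; ring
  · intro i _ hik
    have := pd_comp_coord (Sum.inr k) (Sum.inr i) (x := x)
      (((hasDerivAt_id (x (Sum.inr i))).pow 2).const_mul (B i))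
    rw [if_neg (by simpa using Ne.symm hik)] at this
    exact this
  · simp

theorem differentiable_quad (B : Fin 9 → ℝ) : Differentiable ℝ (quad B) := by
  unfold quad; fun_prop

theorem cwMetric_apply (B : Fin 9 → ℝ) (x : Pt) (m n : Idx) :
    cwMetric B x m n = flatForm m n - quad B x * if m = minus ∧ n = minus then 1 else 0 := by
  simp only [cwMetric, quad, Matrix.sub_apply, Matrix.smul_apply, Matrix.single_apply, smul_eq_mul,
    eq_comm (a := minus)]

theorem pd_cwMetric (B : Fin 9 → ℝ) (x : Pt) (k m n : Idx) :
    pd k (fun y => cwMetric B y m n) x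
      = -(pd k (quad B) x * if m = minus ∧ n = minus then 1 else 0) := by
  simp only [cwMetric_apply]
  rw [pd_sub k (by fun_prop) ((differentiable_quad B x).mul_const _), pd_const,
    pd_mul k (differentiable_quad B x) (by fun_prop), pd_const]
  ring

section LeviCivita

variable (B : Fin 9 → ℝ) (Y : VectorField) (x : Pt) (i : Idx)

/-- The non-constant entry of the metric is `g₋₋`, so only the Christoffel symbols with two
indices `-` survive. -/
theorem leviCivita_apply (j : Idx) : leviCivita (cwMetric B) Y x i j =
    ∑ k, (((flatForm j k - quad B x * if j = minus ∧ k = minus then 1 else 0 : ℝ) : ℂ) * pd i Y x k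
      + (((-(pd i (quad B) x * if k = minus ∧ j = minus then 1 else 0)
        + -(pd k (quad B) x * if i = minus ∧ j = minus then 1 else 0)
        - -(pd j (quad B) x * if i = minus ∧ k = minus then 1 else 0)) / 2 : ℝ) : ℂ) * Y x k) := by
  simp only [leviCivita, christoffel, pd_cwMetric]
  simp only [cwMetric_apply]

theorem leviCivita_plus : leviCivita (cwMetric B) Y x i plus = pd i Y x minus := by
  simp [leviCivita_apply, pd_quad_inl, flatForm, Fintype.sum_sum_type, Fin.sum_univ_two]

theorem leviCivita_minus : leviCivita (cwMetric B) Y x i minus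
    = pd i Y x plus - quad B x * pd i Y x minus - (pd i (quad B) x / 2 : ℝ) * Y x minus
      - if i = minus then ∑ k, (B k * x (Sum.inr k) : ℂ) * Y x (Sum.inr k) else 0 := by
  by_cases hi : i = minus
  · subst hi
    simp [leviCivita_apply, pd_quad_inl, pd_quad_inr, flatForm,
      Fintype.sum_sum_type, Fin.sum_univ_two]
    simp only [← Finset.sum_neg_distrib, sub_eq_add_neg]
    congr 1
    refine Finset.sum_congr rfl fun k _ => ?_
    ring
  · simp [leviCivita_apply, pd_quad_inl, flatForm,
      Fintype.sum_sum_type, Fin.sum_univ_two, hi]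
    ring

theorem leviCivita_inr (k : Fin 9) : leviCivita (cwMetric B) Y x i (Sum.inr k)
    = pd i Y x (Sum.inr k) + if i = minus then (B k * x (Sum.inr k) : ℂ) * Y x minus else 0 := by
  by_cases hi : i = minus
  · subst hi
    simp [leviCivita_apply, pd_quad_inl, pd_quad_inr, flatForm,
      Fintype.sum_sum_type, Fin.sum_univ_two, apply_ite Complex.ofReal, ite_mul]
    ring
  · simp [leviCivita_apply, pd_quad_inr, flatForm,
      Fintype.sum_sum_type, hi, apply_ite Complex.ofReal, ite_mul]

end LeviCivita

/-- Evaluation of a covector `f` on a vector of the adapted frame. -/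
theorem sum_frame_mul (B : Fin 9 → ℝ) (a : Idx) (x : Pt) (f : Idx → ℂ) :
    ∑ i, (frame B a x i : ℂ) * f i = f a + if a = minus then (quad B x / 2 : ℂ) * f plus else 0 := by
  have h (i : Idx) : (frame B a x i : ℂ) * f i = (if i = a then f i else 0)
      + if i = plus then (if a = minus then (quad B x / 2 : ℂ) * f i else 0) else 0 := by
    unfold frame
    rw [← quad]
    by_cases h1 : i = a <;> by_cases h2 : i = plus <;> by_cases h3 : a = minus <;>
      simp [Pi.single_apply, h1, h2, h3] <;> simp_all
  simp only [h, Finset.sum_add_distrib]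
  simp

/-- The infinitesimal null rotation `∑ₖ aₖ (E₋ₖ - Eₖ₋)`. -/
def nullRot (a : Fin 9 → ℂ) : Matrix Idx Idx ℂ :=
  ∑ k, a k • (Matrix.single minus (Sum.inr k) 1 - Matrix.single (Sum.inr k) minus 1)

theorem nullRot_apply (a : Fin 9 → ℂ) (m n : Idx) : nullRot a m n =
    (if m = minus then (Sum.elim 0 a n : ℂ) else 0)
      - (if n = minus then (Sum.elim 0 a m : ℂ) else 0) := by
  simp only [nullRot, Matrix.sum_apply, Matrix.smul_apply, Matrix.sub_apply, Matrix.single_apply,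
    smul_eq_mul, mul_sub, Finset.sum_sub_distrib]
  rcases m with m | m <;> rcases n with n | n
  · simp
  · by_cases hm : m = 1
    · subst hm; simp
    · simp [hm, Ne.symm hm]
  · by_cases hn : n = 1
    · subst hn; simp
    · simp [hn, Ne.symm hn]
  · simp

theorem pd_frame (B : Fin 9 → ℝ) (b m : Idx) (x : Pt) :
    pd m (fun y j => (frame B b y j : ℂ)) x
      = Pi.single plus (if b = minus then ((pd m (quad B) x / 2 : ℝ) : ℂ) else 0) := by
  have h : (fun y j => (frame B b y j : ℂ)) = fun y => (Pi.single b 1 : Idx → ℂ)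
      + (if b = minus then ((quad B y : ℝ) : ℂ) / 2 else 0) • (Pi.single plus 1 : Idx → ℂ) := by
    ext y j
    unfold frame
    rw [← quad]
    split_ifs <;> simp [Pi.single_apply] <;> split_ifs <;> simp
  have hd : DifferentiableAt ℝ (fun y => ((quad B y : ℝ) : ℂ)) x :=
    Complex.ofRealCLM.differentiableAt.comp x (differentiable_quad B x)
  have hq : pd m (fun y => ((quad B y : ℝ) : ℂ)) x = ((pd m (quad B) x : ℝ) : ℂ) :=
    pd_clm m Complex.ofRealCLM (differentiable_quad B x)
  rw [h]
  split_ifs with hb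
  · rw [pd_add m (by fun_prop) (by fun_prop), pd_const, pd_smul_const m (by fun_prop)]
    simp only [div_eq_inv_mul]
    rw [show (fun y => (2 : ℂ)⁻¹ * ((quad B y : ℝ) : ℂ)) = fun y => (2 : ℂ)⁻¹ • ((quad B y : ℝ) : ℂ)
      from rfl, pd_const_smul m _ hd, hq]
    ext j; simp [Pi.single_apply]
  · simp [pd_const]

/-- Parallel transport along `∂₊` and `∂ᵢ` preserves the adapted frame; along `∂₋` the frame
undergoes an infinitesimal null rotation with parameter `-B x`. -/
theorem connForm_eq (B : Fin 9 → ℝ) (x : Pt) (m : Idx) : connForm B x m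
    = nullRot (fun k => if m = minus then -(B k * x (Sum.inr k) : ℂ) else 0) := by
  ext a b
  have hm (b : Idx) : (frame B b x minus : ℂ) = if b = minus then 1 else 0 := by
    unfold frame; by_cases hb : b = minus <;> simp [hb, eq_comm]
  have hk (k : Fin 9) (b : Idx) :
      (frame B b x (Sum.inr k) : ℂ) = if b = Sum.inr k then 1 else 0 := by
    unfold frame; by_cases hb : b = minus <;> simp [hb, Pi.single_apply, eq_comm] <;> split_ifs <;> simp
  rw [connForm, Matrix.of_apply, sum_frame_mul, nullRot_apply]
  simp only [leviCivita_plus, pd_frame]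
  rcases a with a | a
  · fin_cases a
    · change leviCivita _ _ _ _ plus + _ = _
      rw [leviCivita_plus, pd_frame]; simp
    · change leviCivita _ _ _ _ minus + _ = _
      rw [leviCivita_minus]
      simp only [pd_frame, hm, hk]
      rcases b with b | b
      · fin_cases b <;> simp
      · split_ifs <;> simp_all
  · rw [leviCivita_inr]
    simp only [pd_frame, hm]
    rcases b with b | b
    · fin_cases b <;> split_ifs <;> simp_all
    · simp

/-- If `∇K` has no `∂₊`-components, its matrix is the same in the adapted frame and in the
coordinate frame. -/
theorem nablaEnd_eq (B : Fin 9 → ℝ) (K : VectorField) (x : Pt)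
    (h1 : ∀ j, leviCivita (cwMetric B) K x j plus = 0)
    (h2 : ∀ j, leviCivita (cwMetric B) K x plus j = 0) :
    nablaEnd B K x = Matrix.of fun a b => leviCivita (cwMetric B) K x b a := by
  ext a b
  simp only [nablaEnd, Matrix.of_apply, mul_assoc, ← Finset.mul_sum, sum_frame_mul, h1, h2]
  simp

namespace SpinModule

variable (M : SpinModule) (p : Params)

theorem spinRep_add (A A' : Matrix Idx Idx ℂ) : M.spinRep (A + A') = M.spinRep A + M.spinRep A' := by
  simp only [spinRep, Matrix.add_apply, add_smul, Finset.sum_add_distrib, smul_add]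

theorem spinRep_smul (c : ℂ) (A : Matrix Idx Idx ℂ) : M.spinRep (c • A) = c • M.spinRep A := by
  simp only [spinRep, Matrix.smul_apply, smul_eq_mul, mul_smul, ← Finset.smul_sum]
  rw [smul_comm]

theorem spinRep_zero : M.spinRep 0 = 0 := by
  simpa using M.spinRep_smul 0 0

theorem spinRep_sum {ι : Type*} (s : Finset ι) (A : ι → Matrix Idx Idx ℂ) :
    M.spinRep (∑ i ∈ s, A i) = ∑ i ∈ s, M.spinRep (A i) := by
  classical
  induction s using Finset.induction_on with
  | empty => simp [spinRep_zero]
  | insert a s ha ih => rw [Finset.sum_insert ha, Finset.sum_insert ha, spinRep_add, ih]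

theorem spinRep_single_sub (a b : Idx) :
    M.spinRep (Matrix.single a b 1 - Matrix.single b a 1)
      = -(1 / 4 : ℂ) • (M.Γup a * M.Γup b - M.Γup b * M.Γup a) := by
  have key (a b : Idx) : M.spinRep (Matrix.single a b 1)
      = -(1 / 8 : ℂ) • (M.Γup a * M.Γup b - M.Γup b * M.Γup a) := by
    rw [spinRep, Finset.sum_eq_single a, Finset.sum_eq_single b]
    · rw [Matrix.single_apply_same, one_smul, smul_smul]; norm_num
    · intro c _ hc; simp [Ne.symm hc]
    · simp
    · intro c _ hc
      refine Finset.sum_eq_zero fun e _ => ?_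
      simp [Ne.symm hc]
    · simp
  rw [sub_eq_add_neg, ← neg_one_smul ℂ (Matrix.single b a 1), spinRep_add, spinRep_smul, key, key]
  module

theorem Γup_minus : M.Γup minus = M.Γ plus := by
  simp [Γup, flatForm, Fintype.sum_sum_type, Fin.sum_univ_two]

theorem Γup_inr (i : Fin 9) : M.Γup (Sum.inr i) = M.Γ (Sum.inr i) := by
  simp [Γup, flatForm, Fintype.sum_sum_type]

theorem sMinus_spinRep_nullRot (a : Fin 9 → ℂ) (ξ : Spinor) :
    sMinus (M.spinRep (nullRot a) *ᵥ ξ) = -(rt / 2) • ∑ k, a k • M.γ k *ᵥ sPlus ξ := by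
  simp only [nullRot, spinRep_sum, spinRep_smul, spinRep_single_sub, Γup_minus, Γup_inr,
    Matrix.sum_mulVec, sMinus_sum, Matrix.smul_mulVec, Matrix.sub_mulVec, ← Matrix.mulVec_mulVec,
    sMinus_smul, sMinus_sub, sMinus_Γplus, sMinus_Γ, sPlus_Γ, Finset.smul_sum, Matrix.mulVec_smul]
  refine Finset.sum_congr rfl fun k _ => ?_
  module

theorem sPlus_spinRep_nullRot (a : Fin 9 → ℂ) (ξ : Spinor) :
    sPlus (M.spinRep (nullRot a) *ᵥ ξ) = 0 := by
  simp only [nullRot, spinRep_sum, spinRep_smul, spinRep_single_sub, Γup_minus, Γup_inr,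
    Matrix.sum_mulVec, sPlus_sum, Matrix.smul_mulVec, Matrix.sub_mulVec, ← Matrix.mulVec_mulVec,
    sPlus_smul, sPlus_sub, sPlus_Γplus, sPlus_Γ, Matrix.mulVec_zero, sub_self, smul_zero,
    Finset.sum_const_zero]

theorem spinRep_rot (i j : Fin 9) :
    M.spinRep (Matrix.single (Sum.inr i) (Sum.inr j) 1 - Matrix.single (Sum.inr j) (Sum.inr i) 1)
      = M.rhoRot i j := by
  rw [spinRep_single_sub, Γup_inr, Γup_inr, rhoRot, smul_smul]
  norm_num

end SpinModule

/-! ### The generators of the Killing algebra -/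

section Generators

variable (p : Params) (i j : Fin 9) (m : Idx) (x : Pt)

theorem coe_coord_contDiff (n : Idx) : ContDiff ℝ ∞ fun x : Pt => (x n : ℂ) :=
  Complex.ofRealCLM.contDiff.comp (contDiff_apply ℝ ℝ n)

theorem hasDerivAt_cos_lam (c : ℂ) (t : ℝ) :
    HasDerivAt (fun t : ℝ => Complex.cos (c * t)) (-(c * Complex.sin (c * t))) t := by
  have h := ((hasDerivAt_id (t : ℂ)).const_mul c).ccos.comp_ofReal
  simpa [mul_comm] using h

theorem hasDerivAt_sin_lam (c : ℂ) (t : ℝ) :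
    HasDerivAt (fun t : ℝ => Complex.sin (c * t)) (c * Complex.cos (c * t)) t := by
  have h := ((hasDerivAt_id (t : ℂ)).const_mul c).csin.comp_ofReal
  simpa [mul_comm] using h

theorem contDiff_cos_lam (c : ℂ) (n : Idx) : ContDiff ℝ ∞ fun x : Pt => Complex.cos (c * x n) :=
  (Complex.contDiff_cos.restrict_scalars ℝ).comp (contDiff_const.mul (coe_coord_contDiff n))

theorem contDiff_sin_lam (c : ℂ) (n : Idx) : ContDiff ℝ ∞ fun x : Pt => Complex.sin (c * x n) :=
  (Complex.contDiff_sin.restrict_scalars ℝ).comp (contDiff_const.mul (coe_coord_contDiff n))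

theorem contDiff_KPlus : ContDiff ℝ ∞ KPlus := contDiff_const

theorem contDiff_KMinus : ContDiff ℝ ∞ KMinus := contDiff_const

theorem contDiff_KVec : ContDiff ℝ ∞ (KVec p i) :=
  ((contDiff_cos_lam _ _).smul contDiff_const).add
    (((contDiff_const.mul (contDiff_sin_lam _ _)).mul (coe_coord_contDiff _)).smul contDiff_const)

theorem contDiff_KStar : ContDiff ℝ ∞ (KStar p i) :=
  ((contDiff_const.mul (contDiff_sin_lam _ _)).smul contDiff_const).sub
    (((contDiff_const.mul (contDiff_cos_lam _ _)).mul (coe_coord_contDiff _)).smul contDiff_const)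

theorem contDiff_KRot : ContDiff ℝ ∞ (KRot i j) :=
  ((coe_coord_contDiff _).smul contDiff_const).sub ((coe_coord_contDiff _).smul contDiff_const)

theorem _root_.ContDiff.diffAt {F : Type*} [NormedAddCommGroup F] [NormedSpace ℝ F] {f : Pt → F}
    (h : ContDiff ℝ ∞ f) (x : Pt) : DifferentiableAt ℝ f x :=
  (h.differentiable (by simp)) x

theorem pd_KPlus : pd m KPlus x = 0 := pd_const m _ x

theorem pd_KMinus : pd m KMinus x = 0 := pd_const m _ x

theorem pd_KVec : pd m (KVec p i) x = (if m = minus then -KStar p i x else 0)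
    + if m = Sum.inr i then (p.lam i * Complex.sin (p.lam i * x minus)) • Pi.single plus 1 else 0 := by
  have h1 := (contDiff_cos_lam (p.lam i) minus).diffAt x
  have h2 := (contDiff_const (c := p.lam i)).mul (contDiff_sin_lam (p.lam i) minus)
  have h3 := (coe_coord_contDiff (Sum.inr i)).diffAt x
  have h23 : DifferentiableAt ℝ
      (fun x : Pt => p.lam i * Complex.sin (p.lam i * x minus) * x (Sum.inr i)) x :=
    (h2.diffAt x).mul h3
  unfold KVec coordField
  rw [pd_add m (h1.smul_const _) (h23.smul_const _), pd_smul_const m h1,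
    pd_smul_const m h23, pd_mul m (h2.diffAt x) h3, pd_coord_ofReal,
    pd_comp_coord m minus (hasDerivAt_cos_lam _ _),
    pd_comp_coord m minus ((hasDerivAt_sin_lam _ _).const_mul (p.lam i))]
  unfold KStar coordField
  by_cases hm : m = minus
  · subst hm; simp; module
  · by_cases hi : m = Sum.inr i
    · subst hi; simp
    · simp [hm, hi]

theorem pd_KStar : pd m (KStar p i) x = (if m = minus then (p.lam i ^ 2) • KVec p i x else 0)
    - if m = Sum.inr i then (p.lam i ^ 2 * Complex.cos (p.lam i * x minus)) • Pi.single plus 1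
      else 0 := by
  have h1 := ((contDiff_const (c := p.lam i)).mul (contDiff_sin_lam (p.lam i) minus)).diffAt x
  have h2 := ((contDiff_const (c := p.lam i ^ 2)).mul (contDiff_cos_lam (p.lam i) minus)).diffAt x
  have h3 := (coe_coord_contDiff (Sum.inr i)).diffAt x
  have h23 : DifferentiableAt ℝ
      (fun x : Pt => p.lam i ^ 2 * Complex.cos (p.lam i * x minus) * x (Sum.inr i)) x := h2.mul h3
  unfold KStar coordField
  rw [pd_sub m (h1.smul_const _) (h23.smul_const _), pd_smul_const m h1, pd_smul_const m h23,
    pd_mul m h2 h3, pd_coord_ofReal,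
    pd_comp_coord m minus ((hasDerivAt_cos_lam _ _).const_mul (p.lam i ^ 2)),
    pd_comp_coord m minus ((hasDerivAt_sin_lam _ _).const_mul (p.lam i))]
  unfold KVec coordField
  by_cases hm : m = minus
  · subst hm; simp; module
  · by_cases hi : m = Sum.inr i
    · subst hi; simp
    · simp [hm, hi]

theorem pd_KRot : pd m (KRot i j) x = (if m = Sum.inr j then Pi.single (Sum.inr i) 1 else 0)
    - if m = Sum.inr i then Pi.single (Sum.inr j) 1 else 0 := by
  have h1 := (coe_coord_contDiff (Sum.inr i)).diffAt x
  have h2 := (coe_coord_contDiff (Sum.inr j)).diffAt x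
  unfold KRot coordField
  rw [pd_sub m (h2.smul_const _) (h1.smul_const _), pd_smul_const m h1, pd_smul_const m h2,
    pd_coord_ofReal, pd_coord_ofReal]
  simp

@[simp] theorem KPlus_apply (n : Idx) : KPlus x n = if n = plus then 1 else 0 := by
  simp [KPlus, coordField, Pi.single_apply]
@[simp] theorem KMinus_apply (n : Idx) : KMinus x n = if n = minus then 1 else 0 := by
  simp [KMinus, coordField, Pi.single_apply]
@[simp] theorem KVec_minus : KVec p i x minus = 0 := by simp [KVec, coordField]
@[simp] theorem KStar_minus : KStar p i x minus = 0 := by simp [KStar, coordField]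
@[simp] theorem KRot_minus : KRot i j x minus = 0 := by simp [KRot, coordField]
@[simp] theorem KVec_plus : KVec p i x plus
    = p.lam i * Complex.sin (p.lam i * x minus) * x (Sum.inr i) := by simp [KVec, coordField]
@[simp] theorem KStar_plus : KStar p i x plus
    = -(p.lam i ^ 2 * Complex.cos (p.lam i * x minus) * x (Sum.inr i)) := by
  simp [KStar, coordField]
@[simp] theorem KVec_inr (k : Fin 9) : KVec p i x (Sum.inr k)
    = if k = i then Complex.cos (p.lam i * x minus) else 0 := by
  simp [KVec, coordField, Pi.single_apply]
@[simp] theorem KStar_inr (k : Fin 9) : KStar p i x (Sum.inr k)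
    = if k = i then p.lam i * Complex.sin (p.lam i * x minus) else 0 := by
  simp [KStar, coordField, Pi.single_apply]
@[simp] theorem KRot_inr (k : Fin 9) : KRot i j x (Sum.inr k)
    = (if k = i then (x (Sum.inr j) : ℂ) else 0) - if k = j then (x (Sum.inr i) : ℂ) else 0 := by
  simp [KRot, coordField, Pi.single_apply]

end Generators

/-! ### Commutators -/

theorem commutator_apply (X Y : VectorField) (x : Pt) :
    commutator X Y x = ∑ m, X x m • pd m Y x - ∑ m, Y x m • pd m X x := by
  rw [commutator, Finset.sum_sub_distrib]

theorem commutator_comm (X Y : VectorField) : commutator X Y = -commutator Y X := by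
  ext x : 1; rw [Pi.neg_apply, commutator_apply, commutator_apply, neg_sub]

theorem commutator_add_right (X : VectorField) {Y Z : VectorField} (hY : ContDiff ℝ ∞ Y)
    (hZ : ContDiff ℝ ∞ Z) : commutator X (Y + Z) = commutator X Y + commutator X Z := by
  ext x : 1
  have h (m : Idx) : pd m (Y + Z) x = pd m Y x + pd m Z x := pd_add m (hY.diffAt x) (hZ.diffAt x)
  simp only [Pi.add_apply, commutator_apply, h, smul_add, add_smul, Finset.sum_add_distrib]
  abel

theorem commutator_smul_right (X : VectorField) {Y : VectorField} (hY : ContDiff ℝ ∞ Y) (c : ℂ) :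
    commutator X (c • Y) = c • commutator X Y := by
  ext x : 1
  have h (m : Idx) : pd m (c • Y) x = c • pd m Y x := pd_const_smul m c (hY.diffAt x)
  simp only [Pi.smul_apply, commutator_apply, h, smul_sub, Finset.smul_sum, smul_smul, smul_eq_mul,
    mul_comm c]

theorem commutator_zero_right (X : VectorField) : commutator X 0 = 0 := by
  have := commutator_smul_right X (Y := 0) contDiff_const 0
  simpa using this

theorem commutator_add_left {X Y : VectorField} (Z : VectorField) (hX : ContDiff ℝ ∞ X)
    (hY : ContDiff ℝ ∞ Y) : commutator (X + Y) Z = commutator X Z + commutator Y Z := by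
  rw [commutator_comm, commutator_add_right Z hX hY, commutator_comm X, commutator_comm Y, neg_add]

theorem commutator_smul_left {X : VectorField} (Z : VectorField) (hX : ContDiff ℝ ∞ X) (c : ℂ) :
    commutator (c • X) Z = c • commutator X Z := by
  rw [commutator_comm, commutator_smul_right Z hX, commutator_comm X, smul_neg]

theorem contDiff_fieldSum {ι : Type*} (s : Finset ι) {Y : ι → VectorField}
    (hY : ∀ i ∈ s, ContDiff ℝ ∞ (Y i)) : ContDiff ℝ ∞ (∑ i ∈ s, Y i) := by
  have : (∑ i ∈ s, Y i) = fun x => ∑ i ∈ s, Y i x := by ext x : 1; simp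
  rw [this]; exact ContDiff.sum hY

theorem commutator_sum_right (X : VectorField) {ι : Type*} (s : Finset ι) {Y : ι → VectorField}
    (hY : ∀ i ∈ s, ContDiff ℝ ∞ (Y i)) :
    commutator X (∑ i ∈ s, Y i) = ∑ i ∈ s, commutator X (Y i) := by
  classical
  induction s using Finset.induction_on with
  | empty => simp [commutator_zero_right]
  | insert a s ha ih =>
    have hs : ∀ i ∈ s, ContDiff ℝ ∞ (Y i) := fun i hi => hY i (Finset.mem_insert_of_mem hi)
    rw [Finset.sum_insert ha, Finset.sum_insert ha,
      commutator_add_right X (hY a (Finset.mem_insert_self a s)) (contDiff_fieldSum s hs), ih hs]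

section Table

variable (p : Params) (i j k l : Fin 9)

theorem commutator_KPlus_KMinus : commutator KPlus KMinus = 0 := by
  ext x : 1; simp [commutator_apply, pd_KPlus, pd_KMinus]

theorem commutator_KPlus_KVec : commutator KPlus (KVec p i) = 0 := by
  ext x : 1; simp [commutator_apply, pd_KPlus, pd_KVec]

theorem commutator_KPlus_KStar : commutator KPlus (KStar p i) = 0 := by
  ext x : 1; simp [commutator_apply, pd_KPlus, pd_KStar]

theorem commutator_KPlus_KRot : commutator KPlus (KRot i j) = 0 := by
  ext x : 1; simp [commutator_apply, pd_KPlus, pd_KRot]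

theorem commutator_KMinus_KVec : commutator KMinus (KVec p i) = -KStar p i := by
  ext x : 1; simp [commutator_apply, pd_KMinus, pd_KVec]

theorem commutator_KMinus_KStar : commutator KMinus (KStar p i) = (p.lam i ^ 2) • KVec p i := by
  ext x : 1; simp [commutator_apply, pd_KMinus, pd_KStar]

theorem commutator_KMinus_KRot : commutator KMinus (KRot i j) = 0 := by
  ext x : 1; simp [commutator_apply, pd_KMinus, pd_KRot]

theorem commutator_KVec_KVec : commutator (KVec p i) (KVec p j) = 0 := by
  ext x : 1
  simp only [commutator_apply, pd_KVec, smul_add, smul_ite, smul_zero, Finset.sum_add_distrib,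
    Finset.sum_ite_eq', Finset.mem_univ, if_true, KVec_minus, zero_smul, KVec_inr, ite_smul]
  by_cases h : i = j
  · subst h; simp
  · simp [h, Ne.symm h]

theorem commutator_KStar_KStar : commutator (KStar p i) (KStar p j) = 0 := by
  ext x : 1
  simp only [commutator_apply, pd_KStar, smul_sub, smul_ite, smul_zero, Finset.sum_sub_distrib,
    Finset.sum_ite_eq', Finset.mem_univ, if_true, KStar_minus, zero_smul, KStar_inr, ite_smul]
  by_cases h : i = j
  · subst h; simp
  · simp [h, Ne.symm h]

theorem commutator_KVec_KStar : commutator (KVec p i) (KStar p j)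
    = if i = j then -(p.lam i ^ 2) • KPlus else 0 := by
  ext x : 1
  simp only [commutator_apply, pd_KStar, pd_KVec, smul_sub, smul_add, smul_ite, smul_zero,
    Finset.sum_sub_distrib, Finset.sum_add_distrib, KVec_inr, KStar_inr,
    Finset.sum_ite_eq', Finset.mem_univ, if_true, KStar_minus, KVec_minus, zero_smul, ite_smul]
  by_cases h : i = j
  · subst h
    have := Complex.sin_sq_add_cos_sq (p.lam i * x minus)
    have e : KPlus x = Pi.single plus 1 := rfl
    simp only [if_true, Pi.smul_apply, e, zero_sub, zero_add, smul_smul]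
    rw [← neg_smul, ← sub_smul]
    congr 1
    linear_combination (-p.lam i ^ 2) * this
  · simp [h, Ne.symm h]

theorem sum_apply_smul_pd_KRot (X : VectorField) (x : Pt) : ∑ m, X x m • pd m (KRot i j) x
    = X x (Sum.inr j) • Pi.single (Sum.inr i) 1 - X x (Sum.inr i) • Pi.single (Sum.inr j) 1 := by
  simp only [pd_KRot, smul_sub, smul_ite, smul_zero, Finset.sum_sub_distrib, Finset.sum_ite_eq',
    Finset.mem_univ, if_true]

theorem lam_eq_of_block {i j : Fin 9} (h : block i = block j) : p.lam i = p.lam j := by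
  unfold Params.lam
  congr 1
  fin_cases i <;> fin_cases j <;> simp_all [block, Params.μ]

theorem commutator_KRot_KVec (h : block i = block j) : commutator (KRot i j) (KVec p k)
    = (if k = i then KVec p j else 0) - (if k = j then KVec p i else 0) := by
  have e := lam_eq_of_block p h
  ext x : 1
  simp only [commutator_apply, sum_apply_smul_pd_KRot, pd_KVec, smul_add, smul_ite, smul_zero,
    Finset.sum_add_distrib, Finset.sum_ite_eq', Finset.mem_univ, if_true, KRot_minus, zero_smul,
    KRot_inr, KVec_inr, ite_smul]
  by_cases h1 : k = i <;> by_cases h2 : k = j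
  · subst h1; subst h2; simp
  · subst h1; simp [h2, Ne.symm h2, KVec, coordField, e]; module
  · subst h2; simp [h1, Ne.symm h1, KVec, coordField, e]; module
  · simp [h1, h2, Ne.symm h1, Ne.symm h2]

theorem commutator_KRot_KStar (h : block i = block j) : commutator (KRot i j) (KStar p k)
    = (if k = i then KStar p j else 0) - (if k = j then KStar p i else 0) := by
  have e := lam_eq_of_block p h
  ext x : 1
  simp only [commutator_apply, sum_apply_smul_pd_KRot, pd_KStar, smul_sub, smul_ite, smul_zero,
    Finset.sum_sub_distrib, Finset.sum_ite_eq', Finset.mem_univ, if_true, KRot_minus, zero_smul,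
    KRot_inr, KStar_inr, ite_smul]
  by_cases h1 : k = i <;> by_cases h2 : k = j
  · subst h1; subst h2; simp
  · subst h1; simp [h2, Ne.symm h2, KStar, coordField, e]; module
  · subst h2; simp [h1, Ne.symm h1, KStar, coordField, e]; module
  · simp [h1, h2, Ne.symm h1, Ne.symm h2]

theorem commutator_KRot_KRot : commutator (KRot i j) (KRot k l)
    = (if k = i then KRot j l else 0) - (if k = j then KRot i l else 0)
      + (if l = i then KRot k j else 0) - (if l = j then KRot k i else 0) := by
  ext x : 1
  simp only [commutator_apply, sum_apply_smul_pd_KRot, KRot_inr, Pi.add_apply, Pi.sub_apply]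
  rw [ite_apply, ite_apply, ite_apply, ite_apply]
  simp only [KRot, coordField, Pi.zero_apply]
  split_ifs <;> subst_vars <;> first | (exfalso; tauto) | module

end Table

/-! ### Linear differential equations with constant coefficients -/

/-- `exp (-t a)` as a function of the real variable `t`. -/
def expV (a : Matrix VIdx VIdx ℂ) (t : ℝ) : Matrix VIdx VIdx ℂ := NormedSpace.exp (-(t : ℂ) • a)

theorem expV_zero (a : Matrix VIdx VIdx ℂ) : expV a 0 = 1 := by simp [expV]

theorem exp_liftV (a : Matrix VIdx VIdx ℂ) (c : ℂ) :
    NormedSpace.exp (c • liftV a) = liftV (NormedSpace.exp (c • a)) := by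
  let : NormedRing (Matrix VIdx VIdx ℂ) := Matrix.linftyOpNormedRing
  let : NormedAlgebra ℚ (Matrix VIdx VIdx ℂ) := Matrix.linftyOpNormedAlgebra
  let : NormedRing (Matrix SIdx SIdx ℂ) := Matrix.linftyOpNormedRing
  let : NormedAlgebra ℚ (Matrix SIdx SIdx ℂ) := Matrix.linftyOpNormedAlgebra
  have : @CompleteSpace (Matrix VIdx VIdx ℂ) PseudoMetricSpace.toUniformSpace := by
    let : NormedAlgebra ℝ (Matrix VIdx VIdx ℂ) := Matrix.linftyOpNormedAlgebra
    exact FiniteDimensional.complete ℝ _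
  let f : Matrix VIdx VIdx ℂ →+* Matrix SIdx SIdx ℂ :=
    { toFun := liftV
      map_one' := by simp [liftV]
      map_mul' := fun a b => by simp [liftV, ← Matrix.mul_kronecker_mul]
      map_zero' := by simp [liftV]
      map_add' := fun a b => by simp [liftV, Matrix.kronecker_add] }
  have hf : Continuous f := by
    refine continuous_matrix fun i j => ?_
    change Continuous fun a : Matrix VIdx VIdx ℂ => (1 : Matrix (Fin 2) (Fin 2) ℂ) i.1 j.1 * a i.2 j.2
    exact continuous_const.mul (continuous_id.matrix_elem i.2 j.2)
  have h := NormedSpace.map_exp f hf (c • a)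
  have hs : f (c • a) = c • liftV a := by
    change liftV (c • a) = _
    simp [liftV, Matrix.kronecker_smul]
  rw [← hs]; exact h.symm

theorem expV_commute {a b : Matrix VIdx VIdx ℂ} (h : Commute b a) (t : ℝ) : Commute b (expV a t) := by
  let : NormedRing (Matrix VIdx VIdx ℂ) := Matrix.linftyOpNormedRing
  let : NormedAlgebra ℚ (Matrix VIdx VIdx ℂ) := Matrix.linftyOpNormedAlgebra
  exact (h.smul_right _).exp_right

theorem expV_mulVec_comm {a b : Matrix VIdx VIdx ℂ} (h : Commute b a) (t : ℝ) (v : VIdx → ℂ) :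
    b *ᵥ (expV a t *ᵥ v) = expV a t *ᵥ (b *ᵥ v) := by
  rw [Matrix.mulVec_mulVec, Matrix.mulVec_mulVec, (expV_commute h t).eq]

/-- Multiplication by a matrix as a real continuous linear map. -/
def mulVecL (a : Matrix VIdx VIdx ℂ) : (VIdx → ℂ) →L[ℝ] (VIdx → ℂ) :=
  LinearMap.toContinuousLinearMap ((Matrix.mulVecLin a).restrictScalars ℝ)

theorem mulVecL_apply (a : Matrix VIdx VIdx ℂ) (v : VIdx → ℂ) : mulVecL a v = a *ᵥ v := rfl

theorem hasDerivAt_expV_mulVec (a : Matrix VIdx VIdx ℂ) (v : VIdx → ℂ) (t : ℝ) :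
    HasDerivAt (fun t => expV a t *ᵥ v) (-(a *ᵥ (expV a t *ᵥ v))) t := by
  let : NormedRing (Matrix VIdx VIdx ℂ) := Matrix.linftyOpNormedRing
  let : NormedAlgebra ℝ (Matrix VIdx VIdx ℂ) := Matrix.linftyOpNormedAlgebra
  have h : HasDerivAt (expV a) (-a * expV a t) t := by
    have h0 := hasDerivAt_exp_smul_const' (𝕂 := ℝ) (-a) t
    have e : expV a = fun u : ℝ => NormedSpace.exp (u • -a) := by
      ext1 u; rw [expV, smul_neg, neg_smul]; rfl
    rw [e]; exact h0
  let L : Matrix VIdx VIdx ℂ →L[ℝ] (VIdx → ℂ) := LinearMap.toContinuousLinearMap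
    { toFun := fun b => b *ᵥ v
      map_add' := fun b c => Matrix.add_mulVec b c v
      map_smul' := fun r b => by simp [Matrix.smul_mulVec] }
  have h2 := L.hasFDerivAt.comp_hasDerivAt t h
  have h3 : L (-a * expV a t) = -(a *ᵥ (expV a t *ᵥ v)) := by
    change (-a * expV a t) *ᵥ v = _
    rw [← Matrix.mulVec_mulVec, Matrix.neg_mulVec]
  exact h2.congr_deriv h3

/-- Uniqueness for `f' = a f`. -/
theorem eq_of_hasDerivAt_mulVec {a : Matrix VIdx VIdx ℂ} {f g : ℝ → VIdx → ℂ}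
    (hf : ∀ t, HasDerivAt f (a *ᵥ f t) t) (hg : ∀ t, HasDerivAt g (a *ᵥ g t) t) (h0 : f 0 = g 0) :
    f = g :=
  ODE_solution_unique_univ (v := fun _ => mulVecL a) (s := fun _ => Set.univ) (t₀ := 0)
    (fun _ => (mulVecL a).lipschitz.lipschitzOnWith) (fun t => ⟨hf t, trivial⟩)
    (fun t => ⟨hg t, trivial⟩) h0

/-- By induction on the order, from the differential equation satisfied by the exponential. -/
theorem contDiff_expV_mulVec (a : Matrix VIdx VIdx ℂ) (v : VIdx → ℂ) :
    ContDiff ℝ ∞ fun t => expV a t *ᵥ v := by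
  rw [contDiff_infty]
  intro n
  induction n with
  | zero => exact contDiff_zero.2 (continuous_iff_continuousAt.2 fun t =>
      (hasDerivAt_expV_mulVec a v t).continuousAt)
  | succ n ih =>
    have e : deriv (fun t => expV a t *ᵥ v) = fun t => -(mulVecL a (expV a t *ᵥ v)) :=
      funext fun t => (hasDerivAt_expV_mulVec a v t).deriv
    push_cast
    refine contDiff_succ_iff_deriv.2 ⟨fun t => (hasDerivAt_expV_mulVec a v t).differentiableAt,
      by simp, ?_⟩
    rw [e]
    exact ((mulVecL a).contDiff.comp ih).neg

/-! ### The spinor fields of the odd part -/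

namespace SpinModule

variable (M : SpinModule) (p : Params)

theorem sPlus_parField (ζ : Spinor) (x : Pt) :
    sPlus (M.parField p ζ x) = expV (M.d p) (x minus) *ᵥ sPlus ζ := by
  simp only [parField, exp_liftV, sPlus_add, sPlus_liftV, sPlus_projMinus, Matrix.mulVec_zero,
    Matrix.add_mulVec, Matrix.one_mulVec, Matrix.smul_mulVec, Matrix.sum_mulVec, sPlus_smul,
    sPlus_sum, ← Matrix.mulVec_mulVec, sPlus_Γplus, smul_zero, Finset.sum_const_zero,
    sPlus_projPlus, zero_add, add_zero]
  rfl

theorem sMinus_parField (ζ : Spinor) (x : Pt) :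
    sMinus (M.parField p ζ x) = expV (M.cbar p) (x minus) *ᵥ sMinus ζ
      + ∑ i, (x (Sum.inr i) : ℂ) •
          ((rt / 2) • M.s p i *ᵥ (expV (M.d p) (x minus) *ᵥ sPlus ζ)) := by
  simp only [parField, exp_liftV, sMinus_add, sMinus_liftV, sMinus_projMinus, sMinus_projPlus,
    Matrix.mulVec_zero, Matrix.add_mulVec, Matrix.one_mulVec, Matrix.smul_mulVec,
    Matrix.sum_mulVec, sMinus_smul, sMinus_sum, ← Matrix.mulVec_mulVec, sMinus_Γplus, sPlus_liftV,
    sPlus_projPlus, zero_add]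
  congr 1
  rw [Finset.smul_sum]
  refine Finset.sum_congr rfl fun i _ => ?_
  rw [expV]
  module

theorem contDiff_comp_coord {F : Type*} [NormedAddCommGroup F] [NormedSpace ℝ F] {f : ℝ → F}
    (hf : ContDiff ℝ ∞ f) (n : Idx) : ContDiff ℝ ∞ fun x : Pt => f (x n) :=
  hf.comp (contDiff_apply ℝ ℝ n)

theorem contDiff_parMinusTerm (i : Fin 9) (w : VIdx → ℂ) : ContDiff ℝ ∞ fun x : Pt =>
    (x (Sum.inr i) : ℂ) • ((rt / 2) • M.s p i *ᵥ (expV (M.d p) (x minus) *ᵥ w)) :=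
  (coe_coord_contDiff (Sum.inr i)).smul ((contDiff_const (c := rt / 2)).smul
    ((mulVecL (M.s p i)).contDiff.comp (contDiff_comp_coord (contDiff_expV_mulVec (M.d p) w) minus)))

theorem contDiff_parField (ζ : Spinor) : ContDiff ℝ ∞ (M.parField p ζ) := by
  have h1 : ContDiff ℝ ∞ fun x => sMinus (M.parField p ζ x) := by
    simp only [sMinus_parField]
    exact (contDiff_comp_coord (contDiff_expV_mulVec _ _) minus).add
      (ContDiff.sum fun i _ => M.contDiff_parMinusTerm p i _)
  have h2 : ContDiff ℝ ∞ fun x => sPlus (M.parField p ζ x) := by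
    simp only [sPlus_parField]
    exact contDiff_comp_coord (contDiff_expV_mulVec _ _) minus
  refine contDiff_pi.2 fun ⟨i, a⟩ => ?_
  fin_cases i
  · exact contDiff_pi.1 h1 a
  · exact contDiff_pi.1 h2 a

end SpinModule

/-- `sMinus` as a real continuous linear map. -/
def sMinusL : Spinor →L[ℝ] (VIdx → ℂ) :=
  LinearMap.toContinuousLinearMap ⟨⟨sMinus, fun _ _ => rfl⟩, fun _ _ => rfl⟩

/-- `sPlus` as a real continuous linear map. -/
def sPlusL : Spinor →L[ℝ] (VIdx → ℂ) :=
  LinearMap.toContinuousLinearMap ⟨⟨sPlus, fun _ _ => rfl⟩, fun _ _ => rfl⟩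

theorem sMinus_pd {ξ : SpinorField} {x : Pt} (h : DifferentiableAt ℝ ξ x) (m : Idx) :
    sMinus (pd m ξ x) = pd m (fun y => sMinus (ξ y)) x := (pd_clm m sMinusL h).symm

theorem sPlus_pd {ξ : SpinorField} {x : Pt} (h : DifferentiableAt ℝ ξ x) (m : Idx) :
    sPlus (pd m ξ x) = pd m (fun y => sPlus (ξ y)) x := (pd_clm m sPlusL h).symm

theorem pd_smul {F : Type*} [NormedAddCommGroup F] [NormedSpace ℝ F] [NormedSpace ℂ F]
    [IsScalarTower ℝ ℂ F] (m : Idx) {f : Pt → ℂ} {g : Pt → F} {x : Pt}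
    (hf : DifferentiableAt ℝ f x) (hg : DifferentiableAt ℝ g x) :
    pd m (fun y => f y • g y) x = f x • pd m g x + pd m f x • g x := by
  simp only [pd]; rw [fderiv_fun_smul hf hg]; rfl

namespace SpinModule

variable (M : SpinModule) (p : Params)

theorem sPlus_pd_parField (ζ : Spinor) (m : Idx) (x : Pt) : sPlus (pd m (M.parField p ζ) x)
    = if m = minus then -(M.d p *ᵥ sPlus (M.parField p ζ x)) else 0 := by
  rw [sPlus_pd ((M.contDiff_parField p ζ).diffAt x)]
  simp only [sPlus_parField]
  exact pd_comp_coord m minus (hasDerivAt_expV_mulVec _ _ _)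

theorem sMinus_pd_parField (ζ : Spinor) (m : Idx) (x : Pt) : sMinus (pd m (M.parField p ζ) x)
    = (if m = minus then -(M.cbar p *ᵥ (expV (M.cbar p) (x minus) *ᵥ sMinus ζ))
        - ∑ i, (x (Sum.inr i) : ℂ) •
            ((rt / 2) • M.s p i *ᵥ (M.d p *ᵥ sPlus (M.parField p ζ x))) else 0)
      + ∑ i, if m = Sum.inr i then (rt / 2) • M.s p i *ᵥ sPlus (M.parField p ζ x) else 0 := by
  rw [sMinus_pd ((M.contDiff_parField p ζ).diffAt x)]
  simp only [sMinus_parField, sPlus_parField]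
  have hd (i : Fin 9) : HasDerivAt
      (fun t : ℝ => (rt / 2) • M.s p i *ᵥ (expV (M.d p) t *ᵥ sPlus ζ))
      ((rt / 2) • M.s p i *ᵥ (-(M.d p *ᵥ (expV (M.d p) (x minus) *ᵥ sPlus ζ)))) (x minus) :=
    (((mulVecL (M.s p i)).hasFDerivAt.comp_hasDerivAt (x minus)
      (hasDerivAt_expV_mulVec (M.d p) (sPlus ζ) (x minus))).const_smul (rt / 2))
  have hterm (i : Fin 9) : pd m (fun y : Pt => (y (Sum.inr i) : ℂ) •
      ((rt / 2) • M.s p i *ᵥ (expV (M.d p) (y minus) *ᵥ sPlus ζ))) x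
      = (if m = minus then -((x (Sum.inr i) : ℂ) •
          ((rt / 2) • M.s p i *ᵥ (M.d p *ᵥ (expV (M.d p) (x minus) *ᵥ sPlus ζ)))) else 0)
        + if m = Sum.inr i then (rt / 2) • M.s p i *ᵥ (expV (M.d p) (x minus) *ᵥ sPlus ζ)
          else 0 := by
    have hg : DifferentiableAt ℝ (fun y : Pt => (rt / 2) • M.s p i *ᵥ
        (expV (M.d p) (y minus) *ᵥ sPlus ζ)) x :=
      ((contDiff_const (c := rt / 2)).smul ((mulVecL (M.s p i)).contDiff.comp
        (contDiff_comp_coord (contDiff_expV_mulVec (M.d p) (sPlus ζ)) minus))).diffAt x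
    rw [pd_smul m ((coe_coord_contDiff _).diffAt x) hg, pd_coord_ofReal,
      pd_comp_coord m minus (hd i)]
    split_ifs <;> simp [Matrix.mulVec_neg, -Matrix.mulVec_mulVec]
  rw [pd_add m ((contDiff_comp_coord (contDiff_expV_mulVec _ _) minus).diffAt x)
    ((ContDiff.sum fun i _ => M.contDiff_parMinusTerm p i _).diffAt x),
    pd_sum m _ (fun i _ => (M.contDiff_parMinusTerm p i _).diffAt x),
    pd_comp_coord m minus (hasDerivAt_expV_mulVec _ _ _)]
  simp only [hterm, Finset.sum_add_distrib]
  split_ifs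
  · rw [Finset.sum_neg_distrib]; abel
  · simp

theorem commute_γ1234_d : Commute M.γ1234 (M.d p) := by
  have h := M.γ1234_mul_γ125
  have h2 := M.γ1234_sq
  have e : M.d p = ((p.αp' + p.αm') / 2) • M.γ125 + ((p.αp' - p.αm') / 2) • (M.γ1234 * M.γ125) := by
    simp only [d, Xp, Xm]
    simp only [Matrix.add_mul, Matrix.smul_mul, Matrix.sub_mul, one_mul]
    module
  have c1 : Commute M.γ1234 M.γ125 := h
  rw [e]
  exact (c1.smul_right _).add_right (((Commute.refl _).mul_right c1).smul_right _)

/-- `exp(-t d)` preserves the image of `X⁺`, since `γ₁₂₃₄` commutes with `d`. -/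
theorem expV_d_mem {v : VIdx → ℂ} (h : M.γ1234 *ᵥ v = v) (t : ℝ) :
    M.γ1234 *ᵥ (expV (M.d p) t *ᵥ v) = expV (M.d p) t *ᵥ v := by
  rw [expV_mulVec_comm (M.commute_γ1234_d p), h]

/-- The `S⁺`-component of `parField ζ` stays in the image of `X⁺`. -/
theorem parField_mem {ζ : Spinor} (h : ζ ∈ M.constants) (x : Pt) :
    M.γ1234 *ᵥ sPlus (M.parField p ζ x) = sPlus (M.parField p ζ x) := by
  rw [sPlus_parField]; exact M.expV_d_mem p ((M.mem_constants_iff ζ).1 h) _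

/-! ### The Levi-Civita spin connection and parallel fields -/

theorem sMinus_nabla (B : Fin 9 → ℝ) (m : Idx) (ξ : SpinorField) (x : Pt) :
    sMinus (M.nabla B m ξ x) = sMinus (pd m ξ x) + if m = minus then
      (rt / 2) • ∑ k, (B k * x (Sum.inr k) : ℂ) • M.γ k *ᵥ sPlus (ξ x) else 0 := by
  rw [nabla, connForm_eq, sMinus_add, sMinus_spinRep_nullRot]
  split_ifs with h
  · simp only [neg_smul, Finset.sum_neg_distrib, smul_neg, neg_neg]
  · simp

theorem sPlus_nabla (B : Fin 9 → ℝ) (m : Idx) (ξ : SpinorField) (x : Pt) :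
    sPlus (M.nabla B m ξ x) = sPlus (pd m ξ x) := by
  rw [nabla, connForm_eq, sPlus_add, sPlus_spinRep_nullRot, add_zero]

variable {p} {B : Fin 9 → ℝ}

/-- Along `∂₋`, the terms linear in `x` cancel by the vanishing of the curvature on the image of
`X⁺`; this is where `ζ ∈ constants` enters. -/
theorem conn_parField (hB : ∀ i, (B i : ℂ) = -(p.μ i) ^ 2) {ζ : Spinor}
    (h : ζ ∈ M.constants) (m : Idx) : M.conn p B m (M.parField p ζ) = 0 := by
  ext x : 1
  have hx := M.parField_mem p h x
  refine spinor_ext ?_ ?_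
  · rw [conn, sMinus_add, sMinus_nabla, sMinus_pd_parField]
    rcases m with m | m
    · fin_cases m
      · simp [rho]
      · change _ + sMinus (M.rho p minus *ᵥ _) = 0
        rw [sMinus_rho_minus]
        simp only [if_true, Fin.mk_one, reduceCtorEq, if_false, Finset.sum_const_zero, add_zero]
        rw [sMinus_parField, ← sPlus_parField, Matrix.mulVec_add, Matrix.mulVec_sum,
          Finset.smul_sum]
        have key (i : Fin 9) : M.cbar p *ᵥ ((x (Sum.inr i) : ℂ) • (rt / 2) • M.s p i *ᵥ
              sPlus (M.parField p ζ x))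
            = (x (Sum.inr i) : ℂ) • ((rt / 2) • M.s p i *ᵥ (M.d p *ᵥ sPlus (M.parField p ζ x)))
              - (rt / 2) • (B i * x (Sum.inr i) : ℂ) • M.γ i *ᵥ sPlus (M.parField p ζ x) := by
          have := M.cbar_s_sub_s_d p hx i
          rw [Matrix.mulVec_smul, Matrix.mulVec_smul, eq_add_of_sub_eq this, hB]
          module
        simp only [key, Finset.sum_sub_distrib]
        abel
    · rw [sMinus_rho_vec]
      simp
  · rw [conn, sPlus_add, sPlus_nabla, sPlus_pd_parField]
    rcases m with m | m
    · fin_cases m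
      · simp [rho]
      · change _ + sPlus (M.rho p minus *ᵥ _) = 0
        rw [sPlus_rho_minus]; simp
    · rw [sPlus_rho_vec]; simp

theorem isParallel_parField (hB : ∀ i, (B i : ℂ) = -(p.μ i) ^ 2) {ζ : Spinor}
    (h : ζ ∈ M.constants) :
    IsParallel (M.conn p B) (M.parField p ζ) :=
  ⟨M.contDiff_parField p ζ, fun m => M.conn_parField hB h m⟩

end SpinModule

/-! ### The covariant derivatives of the generators -/

section NablaEnd

variable {p : Params} {B : Fin 9 → ℝ} (x : Pt) (i j : Fin 9)

theorem B_eq_of_block (hB : ∀ i, (B i : ℂ) = -(p.μ i) ^ 2) {i j : Fin 9} (h : block i = block j) :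
    B i = B j := by
  have : (B i : ℂ) = B j := by
    rw [hB, hB]; congr 2
    fin_cases i <;> fin_cases j <;> simp_all [block, Params.μ]
  exact_mod_cast this

theorem lam_sq (hB : ∀ i, (B i : ℂ) = -(p.μ i) ^ 2) (i : Fin 9) : p.lam i ^ 2 = B i := by
  rw [hB, Params.lam, mul_pow, neg_sq, Complex.I_sq, neg_one_mul]

theorem nablaEnd_KPlus : nablaEnd B KPlus x = 0 := by
  have h (j k : Idx) : leviCivita (cwMetric B) KPlus x j k = 0 := by
    rcases k with k | k
    · fin_cases k
      · change leviCivita _ _ _ _ plus = _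
        simp [leviCivita_plus, pd_KPlus]
      · change leviCivita _ _ _ _ minus = _
        simp [leviCivita_minus, pd_KPlus]
    · simp [leviCivita_inr, pd_KPlus]
  rw [nablaEnd_eq _ _ _ (fun _ => h _ _) (fun _ => h _ _)]
  ext a b; simp [h]

theorem nablaEnd_KMinus :
    nablaEnd B KMinus x = nullRot (fun k => -(B k * x (Sum.inr k) : ℂ)) := by
  rw [nablaEnd_eq]
  · ext a b
    rw [Matrix.of_apply, nullRot_apply]
    rcases a with a | a
    · fin_cases a
      · change leviCivita _ _ _ _ plus = _
        rcases b with b | b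
        · fin_cases b <;> simp [leviCivita_plus, pd_KMinus]
        · simp [leviCivita_plus, pd_KMinus]
      · change leviCivita _ _ _ _ minus = _
        rcases b with b | b
        · fin_cases b <;> simp [leviCivita_minus, pd_KMinus, pd_quad_inl]
        · simp [leviCivita_minus, pd_KMinus, pd_quad_inr]
    · rcases b with b | b
      · fin_cases b <;> simp [leviCivita_inr, pd_KMinus]
      · simp [leviCivita_inr, pd_KMinus]
  · intro j; simp [leviCivita_plus, pd_KMinus]
  · intro j
    rcases j with j | j
    · fin_cases j
      · change leviCivita _ _ _ _ plus = _
        simp [leviCivita_plus, pd_KMinus]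
      · change leviCivita _ _ _ _ minus = _
        simp [leviCivita_minus, pd_KMinus, pd_quad_inl]
    · simp [leviCivita_inr, pd_KMinus]

theorem nablaEnd_KVec (hB : ∀ i, (B i : ℂ) = -(p.μ i) ^ 2) : nablaEnd B (KVec p i) x
    = nullRot (Pi.single i (p.lam i * Complex.sin (p.lam i * x minus))) := by
  have hl := lam_sq hB i
  rw [nablaEnd_eq]
  · ext a b
    rw [Matrix.of_apply, nullRot_apply]
    rcases a with a | a
    · fin_cases a
      · change leviCivita _ _ _ _ plus = _
        rcases b with b | b
        · fin_cases b <;> simp [leviCivita_plus, pd_KVec]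
        · simp [leviCivita_plus, pd_KVec, ite_apply]
      · change leviCivita _ _ _ _ minus = _
        rcases b with b | b
        · fin_cases b
          · simp [leviCivita_minus, pd_KVec, pd_quad_inl]
          · simp [leviCivita_minus, pd_KVec, hl]; ring
        · by_cases hb : b = i
          · subst hb; simp [leviCivita_minus, pd_KVec]
          · simp [leviCivita_minus, pd_KVec, hb]
    · rcases b with b | b
      · fin_cases b
        · simp [leviCivita_inr, pd_KVec]
        · by_cases ha : a = i
          · subst ha; simp [leviCivita_inr, pd_KVec]
          · simp [leviCivita_inr, pd_KVec, ha]
      · simp [leviCivita_inr, pd_KVec, ite_apply]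
  · intro j; simp [leviCivita_plus, pd_KVec, ite_apply]
  · intro j
    rcases j with j | j
    · fin_cases j
      · change leviCivita _ _ _ _ plus = _
        simp [leviCivita_plus, pd_KVec]
      · change leviCivita _ _ _ _ minus = _
        simp [leviCivita_minus, pd_KVec, pd_quad_inl]
    · simp [leviCivita_inr, pd_KVec]

theorem nablaEnd_KStar (hB : ∀ i, (B i : ℂ) = -(p.μ i) ^ 2) : nablaEnd B (KStar p i) x
    = nullRot (Pi.single i (-(B i * Complex.cos (p.lam i * x minus)))) := by
  have hl := lam_sq hB i
  rw [nablaEnd_eq]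
  · ext a b
    rw [Matrix.of_apply, nullRot_apply]
    rcases a with a | a
    · fin_cases a
      · change leviCivita _ _ _ _ plus = _
        rcases b with b | b
        · fin_cases b <;> simp [leviCivita_plus, pd_KStar]
        · simp [leviCivita_plus, pd_KStar, ite_apply]
      · change leviCivita _ _ _ _ minus = _
        rcases b with b | b
        · fin_cases b
          · simp [leviCivita_minus, pd_KStar, pd_quad_inl]
          · simp [leviCivita_minus, pd_KStar, hl]; ring
        · by_cases hb : b = i
          · subst hb; simp [leviCivita_minus, pd_KStar, hl]
          · simp [leviCivita_minus, pd_KStar, hb]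
    · rcases b with b | b
      · fin_cases b
        · simp [leviCivita_inr, pd_KStar]
        · by_cases ha : a = i
          · subst ha; simp [leviCivita_inr, pd_KStar, hl]
          · simp [leviCivita_inr, pd_KStar, ha]
      · simp [leviCivita_inr, pd_KStar, ite_apply]
  · intro j; simp [leviCivita_plus, pd_KStar, ite_apply]
  · intro j
    rcases j with j | j
    · fin_cases j
      · change leviCivita _ _ _ _ plus = _
        simp [leviCivita_plus, pd_KStar]
      · change leviCivita _ _ _ _ minus = _
        simp [leviCivita_minus, pd_KStar, pd_quad_inl]
    · simp [leviCivita_inr, pd_KStar]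

theorem nablaEnd_KRot {i j : Fin 9} (h : B i = B j) : nablaEnd B (KRot i j) x
    = Matrix.single (Sum.inr i) (Sum.inr j) 1 - Matrix.single (Sum.inr j) (Sum.inr i) 1 := by
  rw [nablaEnd_eq]
  · ext a b
    rw [Matrix.of_apply]
    rcases a with a | a
    · fin_cases a
      · change leviCivita _ _ _ _ plus = _
        simp [leviCivita_plus, pd_KRot, ite_apply]
      · change leviCivita _ _ _ _ minus = _
        simp [leviCivita_minus, pd_KRot, ite_apply, mul_sub, Finset.sum_sub_distrib, h]
        intro _; ring
    · rw [leviCivita_inr, pd_KRot, KRot_minus]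
      simp only [Matrix.sub_apply, Matrix.single_apply, Pi.sub_apply, ite_apply, Pi.single_apply,
        Pi.zero_apply, mul_zero, ite_self, add_zero, Sum.inr.injEq]
      congr 1
      · by_cases h1 : b = Sum.inr j <;> by_cases h2 : a = i <;> simp [h1, h2, eq_comm]
        · intro h; exact absurd h.symm h2
      · by_cases h1 : b = Sum.inr i <;> by_cases h2 : a = j <;> simp [h1, h2, eq_comm]
        · intro h; exact absurd h.symm h2
  · intro j; simp [leviCivita_plus, pd_KRot, ite_apply]
  · intro j
    rcases j with j | j
    · fin_cases j
      · change leviCivita _ _ _ _ plus = _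
        simp [leviCivita_plus, pd_KRot]
      · change leviCivita _ _ _ _ minus = _
        simp [leviCivita_minus, pd_KRot, pd_quad_inl]
    · simp [leviCivita_inr, pd_KRot]

end NablaEnd

namespace SpinModule

variable (M : SpinModule) {p : Params} {B : Fin 9 → ℝ}

/-! ### The spinorial Lie derivatives of the parallel fields -/

/-- Since `parField ζ` is parallel, `∇` may be replaced by `-ρ` in the spinorial Lie derivative. -/
theorem sPlus_spinLie (hB : ∀ i, (B i : ℂ) = -(p.μ i) ^ 2) (K : VectorField) {ζ : Spinor}
    (h : ζ ∈ M.constants) (x : Pt) : sPlus (M.spinLie B K (M.parField p ζ) x)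
      = -(K x minus • M.d p *ᵥ sPlus (M.parField p ζ x))
        - sPlus (M.spinRep (nablaEnd B K x) *ᵥ M.parField p ζ x) := by
  have hn (m : Idx) : M.nabla B m (M.parField p ζ) x = -(M.rho p m *ᵥ M.parField p ζ x) :=
    eq_neg_of_add_eq_zero_left (congrFun (M.conn_parField hB h m) x)
  simp only [spinLie, hn]
  rw [sPlus_sub, sPlus_sum, Fintype.sum_sum_type, Fin.sum_univ_two]
  simp [sPlus_rho_minus, sPlus_rho_vec]

theorem sMinus_spinLie (hB : ∀ i, (B i : ℂ) = -(p.μ i) ^ 2) (K : VectorField) {ζ : Spinor}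
    (h : ζ ∈ M.constants) (x : Pt) : sMinus (M.spinLie B K (M.parField p ζ) x)
      = -(K x minus • M.cbar p *ᵥ sMinus (M.parField p ζ x))
        + ∑ i, K x (Sum.inr i) • ((rt / 2) • M.s p i *ᵥ sPlus (M.parField p ζ x))
        - sMinus (M.spinRep (nablaEnd B K x) *ᵥ M.parField p ζ x) := by
  have hn (m : Idx) : M.nabla B m (M.parField p ζ) x = -(M.rho p m *ᵥ M.parField p ζ x) :=
    eq_neg_of_add_eq_zero_left (congrFun (M.conn_parField hB h m) x)
  simp only [spinLie, hn]
  rw [sMinus_sub, sMinus_sum, Fintype.sum_sum_type, Fin.sum_univ_two]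
  simp [sMinus_rho_minus, sMinus_rho_vec]

/-- Both sides solve `f' = -c̄ f` with the same initial value; for the right hand side this is
`c̄ s_{c̄,d}(eᵢ) - s_{c̄,d}(eᵢ) d = -Bᵢ γᵢ` together with `s_{c̄,d}(eᵢ) = c̄ γᵢ - γᵢ d`. -/
theorem expV_cbar_s (hB : ∀ i, (B i : ℂ) = -(p.μ i) ^ 2) {v : VIdx → ℂ} (hv : M.γ1234 *ᵥ v = v)
    (i : Fin 9) (t : ℝ) : expV (M.cbar p) t *ᵥ (M.s p i *ᵥ v)
      = Complex.cos (p.lam i * t) • M.s p i *ᵥ (expV (M.d p) t *ᵥ v)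
        + (p.lam i * Complex.sin (p.lam i * t)) • M.γ i *ᵥ (expV (M.d p) t *ᵥ v) := by
  have key := eq_of_hasDerivAt_mulVec (a := -M.cbar p)
    (f := fun t => expV (M.cbar p) t *ᵥ (M.s p i *ᵥ v))
    (g := fun t : ℝ => Complex.cos (p.lam i * t) • mulVecL (M.s p i) (expV (M.d p) t *ᵥ v)
        + (p.lam i * Complex.sin (p.lam i * t)) • mulVecL (M.γ i) (expV (M.d p) t *ᵥ v))
    (fun t => ?_) (fun t => ?_) ?_
  · exact congrFun key t
  · rw [Matrix.neg_mulVec]; exact hasDerivAt_expV_mulVec _ _ _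
  · have h := ((hasDerivAt_cos_lam (p.lam i) t).smul ((mulVecL (M.s p i)).hasFDerivAt.comp_hasDerivAt
      t (hasDerivAt_expV_mulVec (M.d p) v t))).add
      (((hasDerivAt_sin_lam (p.lam i) t).const_mul (p.lam i)).smul
      ((mulVecL (M.γ i)).hasFDerivAt.comp_hasDerivAt t (hasDerivAt_expV_mulVec (M.d p) v t)))
    refine h.congr_deriv ?_
    have hw := M.expV_d_mem p hv t
    have h1 := M.cbar_s_sub_s_d p hw i
    have h2 := M.s_mulVec p i (expV (M.d p) t *ᵥ v)
    simp only [mulVecL_apply, Matrix.mulVec_neg, Matrix.neg_mulVec, Matrix.mulVec_add,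
      Matrix.mulVec_smul, eq_add_of_sub_eq h1, (eq_add_of_sub_eq h2.symm), Function.comp_apply]
    have e : p.μ i ^ 2 = -p.lam i ^ 2 := by rw [lam_sq hB, hB, neg_neg]
    rw [e]
    module
  · simp [expV_zero, mulVecL_apply, -Matrix.mulVec_mulVec]

/-- The companion of `expV_cbar_s` for `Bᵢ γᵢ`, by the same argument. -/
theorem expV_cbar_γ (hB : ∀ i, (B i : ℂ) = -(p.μ i) ^ 2) {v : VIdx → ℂ} (hv : M.γ1234 *ᵥ v = v)
    (i : Fin 9) (t : ℝ) : expV (M.cbar p) t *ᵥ ((B i : ℂ) • M.γ i *ᵥ v)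
      = (B i * Complex.cos (p.lam i * t)) • M.γ i *ᵥ (expV (M.d p) t *ᵥ v)
        - (p.lam i * Complex.sin (p.lam i * t)) • M.s p i *ᵥ (expV (M.d p) t *ᵥ v) := by
  have key := eq_of_hasDerivAt_mulVec (a := -M.cbar p)
    (f := fun t => expV (M.cbar p) t *ᵥ ((B i : ℂ) • M.γ i *ᵥ v))
    (g := fun t : ℝ => (B i * Complex.cos (p.lam i * t)) • mulVecL (M.γ i) (expV (M.d p) t *ᵥ v)
        - (p.lam i * Complex.sin (p.lam i * t)) • mulVecL (M.s p i) (expV (M.d p) t *ᵥ v))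
    (fun t => ?_) (fun t => ?_) ?_
  · exact congrFun key t
  · rw [Matrix.neg_mulVec]; exact hasDerivAt_expV_mulVec _ _ _
  · have h := (((hasDerivAt_cos_lam (p.lam i) t).const_mul (B i : ℂ)).smul
      ((mulVecL (M.γ i)).hasFDerivAt.comp_hasDerivAt t (hasDerivAt_expV_mulVec (M.d p) v t))).sub
      (((hasDerivAt_sin_lam (p.lam i) t).const_mul (p.lam i)).smul
      ((mulVecL (M.s p i)).hasFDerivAt.comp_hasDerivAt t (hasDerivAt_expV_mulVec (M.d p) v t)))
    refine h.congr_deriv ?_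
    have hw := M.expV_d_mem p hv t
    have h1 := M.cbar_s_sub_s_d p hw i
    have h2 := M.s_mulVec p i (expV (M.d p) t *ᵥ v)
    simp only [mulVecL_apply, Matrix.mulVec_neg, Matrix.neg_mulVec, Matrix.mulVec_sub,
      Matrix.mulVec_smul, eq_add_of_sub_eq h1, (eq_add_of_sub_eq h2.symm), Function.comp_apply]
    have e : p.μ i ^ 2 = -p.lam i ^ 2 := by rw [lam_sq hB, hB, neg_neg]
    rw [e, ← lam_sq hB i]
    module
  · simp [expV_zero, mulVecL_apply]

theorem spinLie_KPlus (hB : ∀ i, (B i : ℂ) = -(p.μ i) ^ 2) {ζ : Spinor} (h : ζ ∈ M.constants) :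
    M.spinLie B KPlus (M.parField p ζ) = 0 := by
  ext x : 1
  refine spinor_ext ?_ ?_
  · rw [M.sMinus_spinLie hB _ h, nablaEnd_KPlus, spinRep_zero]; simp
  · rw [M.sPlus_spinLie hB _ h, nablaEnd_KPlus, spinRep_zero]; simp

theorem spinLie_KMinus (hB : ∀ i, (B i : ℂ) = -(p.μ i) ^ 2) {ζ : Spinor} (h : ζ ∈ M.constants) :
    M.spinLie B KMinus (M.parField p ζ) = -M.parField p (M.rho p minus *ᵥ ζ) := by
  ext x : 1
  rw [Pi.neg_apply]
  refine spinor_ext ?_ ?_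
  · rw [M.sMinus_spinLie hB _ h, nablaEnd_KMinus, sMinus_spinRep_nullRot, sMinus_neg,
      sMinus_parField, sMinus_parField, sMinus_rho_minus, sPlus_rho_minus,
      ← expV_mulVec_comm (Commute.refl (M.d p)), ← sPlus_parField,
      ← expV_mulVec_comm (Commute.refl (M.cbar p)), Matrix.mulVec_add, Matrix.mulVec_sum,
      Finset.smul_sum]
    have hx := M.parField_mem p h x
    have key (i : Fin 9) : M.cbar p *ᵥ ((x (Sum.inr i) : ℂ) • (rt / 2) • M.s p i *ᵥ
          sPlus (M.parField p ζ x))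
        = (x (Sum.inr i) : ℂ) • ((rt / 2) • M.s p i *ᵥ (M.d p *ᵥ sPlus (M.parField p ζ x)))
          + -(rt / 2) • -(B i * x (Sum.inr i) : ℂ) • M.γ i *ᵥ sPlus (M.parField p ζ x) * (-1) := by
      have := M.cbar_s_sub_s_d p hx i
      rw [Matrix.mulVec_smul, Matrix.mulVec_smul, eq_add_of_sub_eq this, hB, mul_neg, mul_one]
      module
    simp only [key, Finset.sum_add_distrib, mul_neg, mul_one, Finset.sum_neg_distrib, KMinus_apply,
      reduceCtorEq, if_false, if_true, zero_smul, one_smul, Finset.sum_const_zero]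
    abel
  · rw [M.sPlus_spinLie hB _ h, nablaEnd_KMinus, sPlus_spinRep_nullRot, sPlus_neg, sPlus_parField,
      sPlus_parField, sPlus_rho_minus, expV_mulVec_comm (Commute.refl (M.d p))]
    simp

theorem spinLie_KVec (hB : ∀ i, (B i : ℂ) = -(p.μ i) ^ 2) {ζ : Spinor} (h : ζ ∈ M.constants)
    (i : Fin 9) : M.spinLie B (KVec p i) (M.parField p ζ)
      = -M.parField p (M.rho p (Sum.inr i) *ᵥ ζ) := by
  ext x : 1
  rw [Pi.neg_apply]
  refine spinor_ext ?_ ?_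
  · rw [M.sMinus_spinLie hB _ h, nablaEnd_KVec _ _ hB, sMinus_spinRep_nullRot, sMinus_neg,
      M.sMinus_parField p (M.rho p (Sum.inr i) *ᵥ ζ), sMinus_rho_vec, sPlus_rho_vec,
      Matrix.mulVec_neg, Matrix.mulVec_smul,
      M.expV_cbar_s hB ((M.mem_constants_iff ζ).1 h), ← sPlus_parField]
    simp only [KVec_minus, KVec_inr, ite_smul, zero_smul, Finset.sum_ite_eq', Finset.mem_univ,
      if_true, Pi.single_apply, Matrix.mulVec_zero, smul_zero, Finset.sum_const_zero]
    module
  · rw [M.sPlus_spinLie hB _ h, nablaEnd_KVec _ _ hB, sPlus_spinRep_nullRot, sPlus_neg,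
      M.sPlus_parField p (M.rho p (Sum.inr i) *ᵥ ζ), sPlus_rho_vec]
    simp

theorem spinLie_KStar (hB : ∀ i, (B i : ℂ) = -(p.μ i) ^ 2) {ζ : Spinor} (h : ζ ∈ M.constants)
    (i : Fin 9) : M.spinLie B (KStar p i) (M.parField p ζ)
      = -M.parField p (M.rhoStar B i *ᵥ ζ) := by
  ext x : 1
  rw [Pi.neg_apply]
  refine spinor_ext ?_ ?_
  · rw [M.sMinus_spinLie hB _ h, nablaEnd_KStar _ _ hB, sMinus_spinRep_nullRot, sMinus_neg,
      M.sMinus_parField p (M.rhoStar B i *ᵥ ζ), sMinus_rhoStar, sPlus_rhoStar, mul_smul,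
      Matrix.mulVec_smul, M.expV_cbar_γ hB ((M.mem_constants_iff ζ).1 h), ← sPlus_parField]
    simp only [KStar_minus, KStar_inr, ite_smul, zero_smul, Finset.sum_ite_eq', Finset.mem_univ,
      if_true, Pi.single_apply, Matrix.mulVec_zero, smul_zero, Finset.sum_const_zero]
    module
  · rw [M.sPlus_spinLie hB _ h, nablaEnd_KStar _ _ hB, sPlus_spinRep_nullRot, sPlus_neg,
      M.sPlus_parField p (M.rhoStar B i *ᵥ ζ), sPlus_rhoStar]
    simp

theorem commute_of_mulVec {a b : Matrix VIdx VIdx ℂ} (h : ∀ v, a *ᵥ (b *ᵥ v) = b *ᵥ (a *ᵥ v)) :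
    Commute a b := by
  refine Matrix.mulVec_injective (funext fun v => ?_)
  rw [← Matrix.mulVec_mulVec, ← Matrix.mulVec_mulVec, h]

theorem spinLie_KRot (hB : ∀ i, (B i : ℂ) = -(p.μ i) ^ 2) {ζ : Spinor} (h : ζ ∈ M.constants)
    {i j : Fin 9} (hij : block i = block j) : M.spinLie B (KRot i j) (M.parField p ζ)
      = -M.parField p (M.rhoRot i j *ᵥ ζ) := by
  have cc : Commute (M.rot i j) (M.cbar p) :=
    (commute_of_mulVec (M.cbar_rot_mulVec p hij)).symm
  have cd : Commute (M.rot i j) (M.d p) := (commute_of_mulVec (M.d_rot_mulVec p hij)).symm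
  ext x : 1
  rw [Pi.neg_apply]
  refine spinor_ext ?_ ?_
  · rw [M.sMinus_spinLie hB _ h, nablaEnd_KRot _ (B_eq_of_block hB hij), spinRep_rot,
      sMinus_rhoRot, sMinus_neg, sMinus_parField, sMinus_parField, sMinus_rhoRot, sPlus_rhoRot,
      ← expV_mulVec_comm cd, ← sPlus_parField, ← expV_mulVec_comm cc]
    simp only [Matrix.mulVec_add, Matrix.mulVec_sum, M.s_rot_mulVec p hij, KRot_minus,
      KRot_inr, sub_smul, ite_smul, zero_smul,
      Finset.sum_sub_distrib, Finset.sum_ite_eq', Finset.mem_univ, if_true, smul_add, smul_sub,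
      smul_ite, smul_zero, Finset.sum_add_distrib, Matrix.mulVec_smul]
    module
  · rw [M.sPlus_spinLie hB _ h, nablaEnd_KRot _ (B_eq_of_block hB hij), spinRep_rot,
      sPlus_rhoRot, sPlus_neg, sPlus_parField, sPlus_parField, sPlus_rhoRot, expV_mulVec_comm cd]
    simp

end SpinModule

namespace SpinModule

variable (M : SpinModule) {p : Params} {B : Fin 9 → ℝ}

/-! ### The odd-odd bracket -/

theorem coeffPlus_comm (ζ θ : Spinor) : M.coeffPlus ζ θ = M.coeffPlus θ ζ := by
  rw [coeffPlus_eq, coeffPlus_eq, form_comm]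

theorem coeffMinus_comm (ζ θ : Spinor) : M.coeffMinus ζ θ = M.coeffMinus θ ζ := by
  rw [coeffMinus_eq, coeffMinus_eq, form_comm]

theorem coeffVec_comm (i : Fin 9) (ζ θ : Spinor) : M.coeffVec i ζ θ = M.coeffVec i θ ζ := by
  rw [coeffVec_eq, coeffVec_eq, add_comm]

theorem coeffStar_comm (i : Fin 9) (ζ θ : Spinor) :
    M.coeffStar p B i ζ θ = M.coeffStar p B i θ ζ := by
  rw [coeffStar_eq, coeffStar_eq, add_comm]

theorem coeffRot_comm (i j : Fin 9) (ζ θ : Spinor) :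
    M.coeffRot p i j ζ θ = M.coeffRot p i j θ ζ := by
  rw [coeffRot_eq, coeffRot_eq, M.form_comm (M.s p j *ᵥ sPlus ζ), M.form_comm (M.γ i *ᵥ sPlus ζ),
    add_comm]

theorem oddBracket_comm (ζ θ : Spinor) : M.oddBracket p B ζ θ = M.oddBracket p B θ ζ := by
  simp only [oddBracket, M.coeffPlus_comm ζ, M.coeffMinus_comm ζ, M.coeffVec_comm _ ζ,
    M.coeffStar_comm _ ζ, M.coeffRot_comm _ _ ζ]

theorem oddBracket_add_right (ζ θ θ' : Spinor) :
    M.oddBracket p B ζ (θ + θ') = M.oddBracket p B ζ θ + M.oddBracket p B ζ θ' := by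
  have h1 : M.coeffPlus ζ (θ + θ') = M.coeffPlus ζ θ + M.coeffPlus ζ θ' := by
    simp only [coeffPlus_eq, sMinus_add, form_add_right]; ring
  have h2 : M.coeffMinus ζ (θ + θ') = M.coeffMinus ζ θ + M.coeffMinus ζ θ' := by
    simp only [coeffMinus_eq, sPlus_add, form_add_right]; ring
  have h3 (i : Fin 9) : M.coeffVec i ζ (θ + θ') = M.coeffVec i ζ θ + M.coeffVec i ζ θ' := by
    simp only [coeffVec_eq, sPlus_add, sMinus_add, form_add_right, form_add_left,
      Matrix.mulVec_add]; ring
  have h4 (i : Fin 9) : M.coeffStar p B i ζ (θ + θ')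
      = M.coeffStar p B i ζ θ + M.coeffStar p B i ζ θ' := by
    simp only [coeffStar_eq, sPlus_add, sMinus_add, form_add_right, form_add_left,
      Matrix.mulVec_add]; ring
  have h5 (i j : Fin 9) : M.coeffRot p i j ζ (θ + θ')
      = M.coeffRot p i j ζ θ + M.coeffRot p i j ζ θ' := by
    simp only [coeffRot_eq, sPlus_add, form_add_right, Matrix.mulVec_add]; ring
  have h6 (i j : Fin 9) : (if block i = block j then
      M.coeffRot p i j ζ θ • KRot i j + M.coeffRot p i j ζ θ' • KRot i j else 0)
      = (if block i = block j then M.coeffRot p i j ζ θ • KRot i j else 0)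
        + if block i = block j then M.coeffRot p i j ζ θ' • KRot i j else 0 := by
    split_ifs <;> simp
  have h7 (a a' b b' c c' d d' e e' : VectorField) :
      a + a' + (b + b') + (c + c') + (d + d') + (e + e')
        = a + b + c + d + e + (a' + b' + c' + d' + e') := by abel
  simp only [oddBracket, h1, h2, h3, h4, h5, h6, add_smul, Finset.sum_add_distrib, smul_add]
  exact h7 _ _ _ _ _ _ _ _ _ _

theorem oddBracket_smul_right (c : ℂ) (ζ θ : Spinor) :
    M.oddBracket p B ζ (c • θ) = c • M.oddBracket p B ζ θ := by
  have h1 : M.coeffPlus ζ (c • θ) = c * M.coeffPlus ζ θ := by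
    simp only [coeffPlus_eq, sMinus_smul, form_smul_right]; ring
  have h2 : M.coeffMinus ζ (c • θ) = c * M.coeffMinus ζ θ := by
    simp only [coeffMinus_eq, sPlus_smul, form_smul_right]; ring
  have h3 (i : Fin 9) : M.coeffVec i ζ (c • θ) = c * M.coeffVec i ζ θ := by
    simp only [coeffVec_eq, sPlus_smul, sMinus_smul, form_smul_right, form_smul_left,
      Matrix.mulVec_smul]; ring
  have h4 (i : Fin 9) : M.coeffStar p B i ζ (c • θ) = c * M.coeffStar p B i ζ θ := by
    simp only [coeffStar_eq, sPlus_smul, sMinus_smul, form_smul_right, form_smul_left,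
      Matrix.mulVec_smul]; ring
  have h5 (i j : Fin 9) : M.coeffRot p i j ζ (c • θ) = c * M.coeffRot p i j ζ θ := by
    simp only [coeffRot_eq, sPlus_smul, form_smul_right, Matrix.mulVec_smul]; ring
  have h6 (i j : Fin 9) : (if block i = block j then
      c • M.coeffRot p i j ζ θ • KRot i j else 0)
      = c • (if block i = block j then M.coeffRot p i j ζ θ • KRot i j else 0) := by
    split_ifs <;> simp
  simp only [oddBracket, h1, h2, h3, h4, h5, h6, mul_smul, smul_add, Finset.smul_sum]
  simp only [smul_comm (1 / 2 : ℂ) c]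

theorem oddBracket_add_left (ζ ζ' θ : Spinor) :
    M.oddBracket p B (ζ + ζ') θ = M.oddBracket p B ζ θ + M.oddBracket p B ζ' θ := by
  rw [oddBracket_comm, oddBracket_add_right, M.oddBracket_comm θ, M.oddBracket_comm θ]

theorem oddBracket_smul_left (c : ℂ) (ζ θ : Spinor) :
    M.oddBracket p B (c • ζ) θ = c • M.oddBracket p B ζ θ := by
  rw [oddBracket_comm, oddBracket_smul_right, M.oddBracket_comm θ]

theorem oddBracket_mem (ζ θ : Spinor) : M.oddBracket p B ζ θ ∈ killingAlgebra p := by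
  have mem {X : VectorField} (h : X ∈ ({KPlus, KMinus} ∪ Set.range (KVec p) ∪ Set.range (KStar p)
    ∪ {X | ∃ i j, block i = block j ∧ X = KRot i j} : Set VectorField)) : X ∈ killingAlgebra p :=
    Submodule.subset_span h
  refine add_mem (add_mem (add_mem (add_mem ?_ ?_) ?_) ?_) ?_
  · exact Submodule.smul_mem _ _ (mem (by simp))
  · exact Submodule.smul_mem _ _ (mem (by simp))
  · exact sum_mem fun i _ => Submodule.smul_mem _ _ (mem (by simp))
  · exact sum_mem fun i _ => Submodule.smul_mem _ _ (mem (by simp))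
  · refine Submodule.smul_mem _ _ (sum_mem fun i _ => sum_mem fun j _ => ?_)
    split_ifs with h
    · exact Submodule.smul_mem _ _ (mem (Or.inr ⟨i, j, h, rfl⟩))
    · exact zero_mem _

/-! ### The rotational coefficients on the space of constants -/

theorem coeffRot_of_mem {ζ θ : Spinor} (hζ : ζ ∈ M.constants) (hθ : θ ∈ M.constants)
    (i j : Fin 9) : M.coeffRot p i j ζ θ = -(1 / 2) * (Complex.I * rt) * p.μ j *
      (M.form (M.γ125 *ᵥ (M.γ j *ᵥ sPlus ζ)) (M.γ i *ᵥ sPlus θ)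
        - M.form (M.γ125 *ᵥ (M.γ i *ᵥ sPlus ζ)) (M.γ j *ᵥ sPlus θ)) := by
  rw [coeffRot_eq, M.s_mulVec_of_mem p ((M.mem_constants_iff ζ).1 hζ),
    M.s_mulVec_of_mem p ((M.mem_constants_iff θ).1 hθ), form_smul_left, form_smul_right,
    M.form_γ125 (M.γ i *ᵥ sPlus ζ)]
  ring

/-- The coefficients between different blocks vanish on constants. If `γ₁₂₃₄` distinguishes the
blocks, each of the two terms pairs different eigenspaces of `γ₁₂₃₄`; otherwise `γ₁₂₅` distinguishes
them, and the two terms cancel. -/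
theorem coeffRot_of_block_ne {ζ θ : Spinor} (hζ : ζ ∈ M.constants) (hθ : θ ∈ M.constants)
    {i j : Fin 9} (h : block i ≠ block j) : M.coeffRot p i j ζ θ = 0 := by
  have hz := (M.mem_constants_iff ζ).1 hζ
  have ht := (M.mem_constants_iff θ).1 hθ
  have hij : i ≠ j := by rintro rfl; exact h rfl
  have e (a b : Fin 9) : M.form (M.γ125 *ᵥ (M.γ b *ᵥ sPlus ζ)) (M.γ a *ᵥ sPlus θ)
      = sign125 a * M.form (M.γ125 *ᵥ (M.γ a *ᵥ (M.γ b *ᵥ sPlus ζ))) (sPlus θ) := by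
    rw [← form_γ, γ_γ125_mulVec, form_smul_left]
  rw [M.coeffRot_of_mem hζ hθ]
  rcases sign_of_block_ne h with h1 | h1
  · rw [e, e, M.γ_γ_mulVec j i, swapSign, if_neg hij.symm, h1, Matrix.mulVec_smul, form_smul_left]
    ring
  · have o (a b : Fin 9) (hab : sign1234 a = -sign1234 b) :
        M.form (M.γ125 *ᵥ (M.γ b *ᵥ sPlus ζ)) (M.γ a *ᵥ sPlus θ) = 0 := by
      have h2 := M.form_γ1234 (M.γ125 *ᵥ (M.γ b *ᵥ sPlus ζ)) (M.γ a *ᵥ sPlus θ)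
      rw [γ1234_γ125_mulVec, γ1234_γ_mulVec, γ1234_γ_mulVec, hz, ht, Matrix.mulVec_smul,
        form_smul_left, form_smul_right, hab] at h2
      have h3 : sign1234 b ≠ 0 := by rw [sign1234_eq]; split_ifs <;> norm_num
      refine (mul_eq_zero.1 ?_).resolve_left h3
      linear_combination h2 / 2
    rw [o i j h1, o j i (by rw [h1, neg_neg])]
    ring

/-- Within a block this holds because `μᵢ = μⱼ`. -/
theorem coeffRot_antisymm {ζ θ : Spinor} (hζ : ζ ∈ M.constants) (hθ : θ ∈ M.constants)
    (i j : Fin 9) : M.coeffRot p i j ζ θ = -M.coeffRot p j i ζ θ := by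
  by_cases h : block i = block j
  · have : p.μ i = p.μ j := by fin_cases i <;> fin_cases j <;> simp_all [block, Params.μ]
    rw [M.coeffRot_of_mem hζ hθ, M.coeffRot_of_mem hζ hθ, this]
    ring
  · rw [M.coeffRot_of_block_ne hζ hθ h, M.coeffRot_of_block_ne hζ hθ (Ne.symm h), neg_zero]

/-- On constants the restriction to `i`, `j` in the same block may be dropped. -/
theorem oddBracket_of_mem {ζ θ : Spinor} (hζ : ζ ∈ M.constants) (hθ : θ ∈ M.constants) :
    M.oddBracket p B ζ θ = M.coeffPlus ζ θ • KPlus + M.coeffMinus ζ θ • KMinus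
      + ∑ i, M.coeffVec i ζ θ • KVec p i + ∑ i, M.coeffStar p B i ζ θ • KStar p i
      + (1 / 2 : ℂ) • ∑ i, ∑ j, M.coeffRot p i j ζ θ • KRot i j := by
  rw [oddBracket]
  congr 2
  refine Finset.sum_congr rfl fun i _ => Finset.sum_congr rfl fun j _ => ?_
  split_ifs with h
  · rfl
  · rw [M.coeffRot_of_block_ne hζ hθ h, zero_smul]

theorem commutator_oddBracket (X : VectorField) {ζ θ : Spinor} (hζ : ζ ∈ M.constants)
    (hθ : θ ∈ M.constants) : commutator X (M.oddBracket p B ζ θ)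
      = M.coeffPlus ζ θ • commutator X KPlus + M.coeffMinus ζ θ • commutator X KMinus
      + ∑ i, M.coeffVec i ζ θ • commutator X (KVec p i)
      + ∑ i, M.coeffStar p B i ζ θ • commutator X (KStar p i)
      + (1 / 2 : ℂ) • ∑ i, ∑ j, M.coeffRot p i j ζ θ • commutator X (KRot i j) := by
  have c {Y : VectorField} (hY : ContDiff ℝ ∞ Y) (a : ℂ) : ContDiff ℝ ∞ (a • Y) :=
    contDiff_const.smul hY
  have c1 := c contDiff_KPlus (M.coeffPlus ζ θ)
  have c2 := c contDiff_KMinus (M.coeffMinus ζ θ)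
  have c3 (i : Fin 9) := c (contDiff_KVec p i) (M.coeffVec i ζ θ)
  have c4 (i : Fin 9) := c (contDiff_KStar p i) (M.coeffStar p B i ζ θ)
  have c5 (i j : Fin 9) := c (contDiff_KRot i j) (M.coeffRot p i j ζ θ)
  have s3 := contDiff_fieldSum Finset.univ (fun i _ => c3 i)
  have s4 := contDiff_fieldSum Finset.univ (fun i _ => c4 i)
  have s5 (i : Fin 9) := contDiff_fieldSum Finset.univ (fun j _ => c5 i j)
  have s6 := contDiff_fieldSum Finset.univ (fun i _ => s5 i)
  have a {Y Z : VectorField} (hY : ContDiff ℝ ∞ Y) (hZ : ContDiff ℝ ∞ Z) :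
      ContDiff ℝ ∞ (Y + Z) := hY.add hZ
  rw [M.oddBracket_of_mem hζ hθ, commutator_add_right X (a (a (a c1 c2) s3) s4) (c s6 _),
    commutator_add_right X (a (a c1 c2) s3) s4, commutator_add_right X (a c1 c2) s3,
    commutator_add_right X c1 c2, commutator_smul_right X contDiff_KPlus,
    commutator_smul_right X contDiff_KMinus, commutator_sum_right X _ (fun i _ => c3 i),
    commutator_sum_right X _ (fun i _ => c4 i), commutator_smul_right X s6,
    commutator_sum_right X _ (fun i _ => s5 i)]
  simp only [commutator_sum_right X _ (fun j _ => c5 _ j),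
    commutator_smul_right X (contDiff_KVec p _), commutator_smul_right X (contDiff_KStar p _),
    commutator_smul_right X (contDiff_KRot _ _)]

/-! ### Invariance of the odd-odd bracket -/

/-- The endomorphism `R` leaves the space of constants invariant, and `ad X` acts on the odd-odd
bracket of constants through `-R`. -/
def Compat (p : Params) (B : Fin 9 → ℝ) (X : VectorField) (R : Matrix SIdx SIdx ℂ) : Prop :=
  (∀ ζ ∈ M.constants, R *ᵥ ζ ∈ M.constants) ∧
  ∀ ζ ∈ M.constants, ∀ θ ∈ M.constants, commutator X (M.oddBracket p B ζ θ)
    = -(M.oddBracket p B (R *ᵥ ζ) θ + M.oddBracket p B ζ (R *ᵥ θ))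

/-- Invariance of the bracket in terms of the coefficients. Terms linear in `ζ` and `θ` are
collected, so that each coefficient can be compared separately. -/
theorem compat_of_coeff {X : VectorField} {R : Matrix SIdx SIdx ℂ}
    (hR : ∀ ζ ∈ M.constants, R *ᵥ ζ ∈ M.constants)
    (h : ∀ ζ ∈ M.constants, ∀ θ ∈ M.constants, commutator X (M.oddBracket p B ζ θ)
      = -((M.coeffPlus (R *ᵥ ζ) θ + M.coeffPlus ζ (R *ᵥ θ)) • KPlus
        + (M.coeffMinus (R *ᵥ ζ) θ + M.coeffMinus ζ (R *ᵥ θ)) • KMinus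
        + ∑ i, (M.coeffVec i (R *ᵥ ζ) θ + M.coeffVec i ζ (R *ᵥ θ)) • KVec p i
        + ∑ i, (M.coeffStar p B i (R *ᵥ ζ) θ + M.coeffStar p B i ζ (R *ᵥ θ)) • KStar p i
        + (1 / 2 : ℂ) • ∑ i, ∑ j,
          (M.coeffRot p i j (R *ᵥ ζ) θ + M.coeffRot p i j ζ (R *ᵥ θ)) • KRot i j)) :
    M.Compat p B X R := by
  refine ⟨hR, fun ζ hζ θ hθ => ?_⟩
  rw [h ζ hζ θ hθ, M.oddBracket_of_mem (hR ζ hζ) hθ, M.oddBracket_of_mem hζ (hR θ hθ)]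
  simp only [add_smul, Finset.sum_add_distrib, smul_add]
  abel

theorem compat_KPlus : M.Compat p B KPlus 0 := by
  refine ⟨fun ζ _ => by simp, fun ζ hζ θ hθ => ?_⟩
  have h1 : commutator KPlus KPlus = 0 := by
    ext x : 1; simp [commutator_apply]
  have h2 : M.oddBracket p B 0 θ = 0 := by simpa using M.oddBracket_smul_left (p := p) (B := B) 0 0 θ
  have h3 : M.oddBracket p B ζ 0 = 0 := by simpa using M.oddBracket_smul_right (p := p) (B := B) 0 ζ 0
  rw [M.commutator_oddBracket _ hζ hθ]
  simp [h1, h2, h3, commutator_KPlus_KMinus, commutator_KPlus_KVec, commutator_KPlus_KStar,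
    commutator_KPlus_KRot]

theorem mem_constants_of_sPlus {ζ : Spinor} (h : sPlus ζ = 0) : ζ ∈ M.constants := by
  rw [mem_constants_iff, h, Matrix.mulVec_zero]

theorem form_γ_γ_add (i j : Fin 9) (v w : VIdx → ℂ) :
    M.form (M.γ i *ᵥ v) (M.γ j *ᵥ w) + M.form (M.γ j *ᵥ v) (M.γ i *ᵥ w)
      = if i = j then -2 * M.form v w else 0 := by
  rw [form_γ, form_γ]
  by_cases h : i = j
  · subst h; rw [if_pos rfl, γ_γ_self_mulVec, form_neg_right]; ring
  · rw [if_neg h, M.γ_γ_mulVec i j, swapSign, if_neg h, form_smul_right]; ring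

theorem compat_KMinus (hB : ∀ i, (B i : ℂ) = -(p.μ i) ^ 2) (hB0 : ∀ i, B i ≠ 0) :
    M.Compat p B KMinus (M.rho p minus) := by
  refine M.compat_of_coeff (fun ζ hζ => ?_) (fun ζ hζ θ hθ => ?_)
  · rw [mem_constants_iff] at hζ ⊢
    rw [sPlus_rho_minus, M.d_mulVec_mem p hζ]
  have hz := (M.mem_constants_iff ζ).1 hζ
  have ht := (M.mem_constants_iff θ).1 hθ
  have hB0' (i : Fin 9) : (B i : ℂ) ≠ 0 := by exact_mod_cast hB0 i
  have e1 : M.coeffPlus (M.rho p minus *ᵥ ζ) θ + M.coeffPlus ζ (M.rho p minus *ᵥ θ) = 0 := by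
    simp only [coeffPlus_eq, sMinus_rho_minus, form_cbar]; ring
  have e2 : M.coeffMinus (M.rho p minus *ᵥ ζ) θ + M.coeffMinus ζ (M.rho p minus *ᵥ θ) = 0 := by
    simp only [coeffMinus_eq, sPlus_rho_minus, form_d]; ring
  have e3 (i : Fin 9) : M.coeffVec i (M.rho p minus *ᵥ ζ) θ + M.coeffVec i ζ (M.rho p minus *ᵥ θ)
      = -(B i * M.coeffStar p B i ζ θ) := by
    have := hB0' i
    simp only [coeffVec_eq, coeffStar_eq, sPlus_rho_minus, sMinus_rho_minus, form_cbar, s_mulVec,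
      form_sub_right]
    field_simp
    ring
  -- The vanishing of the curvature on the image of `X⁺`, at `sPlus ζ` and `sPlus θ`.
  have e4 (i : Fin 9) : M.coeffStar p B i (M.rho p minus *ᵥ ζ) θ
      + M.coeffStar p B i ζ (M.rho p minus *ᵥ θ) = M.coeffVec i ζ θ := by
    have := hB0' i
    have h1 := M.cbar_s_sub_s_d p hz i
    have h2 := M.cbar_s_sub_s_d p ht i
    have hb : p.μ i ^ 2 = -(B i : ℂ) := by rw [hB, neg_neg]
    rw [hb] at h1 h2
    simp only [coeffVec_eq, coeffStar_eq, sPlus_rho_minus, sMinus_rho_minus, form_cbar,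
      eq_add_of_sub_eq h1, eq_add_of_sub_eq h2, form_add_right, form_smul_right]
    field_simp
    ring
  have e5 (i j : Fin 9) : M.coeffRot p i j (M.rho p minus *ᵥ ζ) θ
      + M.coeffRot p i j ζ (M.rho p minus *ᵥ θ) = 0 := by
    have hz' : M.rho p minus *ᵥ ζ ∈ M.constants := by
      rw [mem_constants_iff, sPlus_rho_minus, M.d_mulVec_mem p hz]
    have ht' : M.rho p minus *ᵥ θ ∈ M.constants := by
      rw [mem_constants_iff, sPlus_rho_minus, M.d_mulVec_mem p ht]
    by_cases h : block i = block j
    · rw [M.coeffRot_of_mem hz' hθ, M.coeffRot_of_mem hζ ht', sPlus_rho_minus, sPlus_rho_minus,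
        M.d_mulVec_of_mem p hz, M.d_mulVec_of_mem p ht]
      simp only [Matrix.mulVec_smul, γ_γ125_mulVec, γ125_γ125_mulVec, form_smul_left,
        form_smul_right, form_γ125, block_sign125 h]
      ring
    · rw [M.coeffRot_of_block_ne hz' hθ h, M.coeffRot_of_block_ne hζ ht' h, add_zero]
  have h0 : commutator KMinus KPlus = 0 := by rw [commutator_comm, commutator_KPlus_KMinus, neg_zero]
  have h1 : commutator KMinus KMinus = 0 := by ext x : 1; simp [commutator_apply]
  rw [M.commutator_oddBracket _ hζ hθ]
  simp only [e1, e2, e3, e4, e5, h0, h1, commutator_KMinus_KVec, commutator_KMinus_KStar,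
    commutator_KMinus_KRot, lam_sq hB, smul_zero, zero_smul, Finset.sum_const_zero, smul_neg,
    neg_smul, Finset.sum_neg_distrib, smul_smul, add_zero, zero_add, neg_add, neg_neg,
    mul_comm (B _ : ℂ)]
  abel

/-- A combination of commutators with rotations in terms of an antisymmetric coefficient matrix. -/
theorem sum_antisymm_smul (i : Fin 9) {c : Fin 9 → Fin 9 → ℂ} (hc : ∀ k l, c k l = -c l k)
    (K : Fin 9 → VectorField) :
    (1 / 2 : ℂ) • ∑ k, ∑ l, c k l •
      -((if i = k then K l else 0) - if i = l then K k else 0) = ∑ k, c k i • K k := by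
  simp only [smul_neg, smul_sub, smul_ite, smul_zero, Finset.sum_neg_distrib,
    Finset.sum_sub_distrib, Finset.sum_ite_eq, Finset.mem_univ, if_true]
  rw [Finset.sum_comm]
  simp only [Finset.sum_ite_eq, Finset.mem_univ, if_true]
  rw [show (∑ l, c i l • K l) = -∑ k, c k i • K k by
    rw [← Finset.sum_neg_distrib]
    exact Finset.sum_congr rfl fun k _ => by rw [hc i k, neg_smul]]
  module

theorem compat_KVec (hB : ∀ i, (B i : ℂ) = -(p.μ i) ^ 2) (hB0 : ∀ i, B i ≠ 0) (i : Fin 9) :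
    M.Compat p B (KVec p i) (M.rho p (Sum.inr i)) := by
  refine M.compat_of_coeff (fun ζ hζ => M.mem_constants_of_sPlus (M.sPlus_rho_vec p i ζ))
    (fun ζ hζ θ hθ => ?_)
  have hz := (M.mem_constants_iff ζ).1 hζ
  have ht := (M.mem_constants_iff θ).1 hθ
  have hB0' (i : Fin 9) : (B i : ℂ) ≠ 0 := by exact_mod_cast hB0 i
  set R := M.rho p (Sum.inr i) with hR
  have m (η : Spinor) : sMinus (R *ᵥ η) = -((rt / 2) • M.s p i *ᵥ sPlus η) := M.sMinus_rho_vec p i η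
  have q (η : Spinor) : sPlus (R *ᵥ η) = 0 := M.sPlus_rho_vec p i η
  have r := rt_mul_rt
  have e1 : M.coeffPlus (R *ᵥ ζ) θ + M.coeffPlus ζ (R *ᵥ θ) = B i * M.coeffStar p B i ζ θ := by
    have := hB0' i
    simp only [coeffPlus_eq, coeffStar_eq, m, form_neg_left, form_neg_right, form_smul_left,
      form_smul_right, M.form_comm (M.s p i *ᵥ sPlus ζ)]
    field_simp
    linear_combination (-(M.form (sMinus θ) (M.s p i *ᵥ sPlus ζ)
      + M.form (sMinus ζ) (M.s p i *ᵥ sPlus θ))) * r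
  have e2 : M.coeffMinus (R *ᵥ ζ) θ + M.coeffMinus ζ (R *ᵥ θ) = 0 := by
    simp only [coeffMinus_eq, q, form_zero_left, form_zero_right]; ring
  have e3 (j : Fin 9) : M.coeffVec j (R *ᵥ ζ) θ + M.coeffVec j ζ (R *ᵥ θ)
      = -M.coeffRot p j i ζ θ := by
    simp only [coeffVec_eq, coeffRot_eq, q, m, form_neg_left, form_smul_left, Matrix.mulVec_zero,
      form_zero_right, M.form_comm (M.s p i *ᵥ sPlus θ)]
    ring
  have e4 (j : Fin 9) : M.coeffStar p B j (R *ᵥ ζ) θ + M.coeffStar p B j ζ (R *ᵥ θ)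
      = -if i = j then M.coeffMinus ζ θ else 0 := by
    have hj := hB0' j
    have h1 := M.form_γ_γ_add i j (sPlus ζ) (sPlus θ)
    simp only [coeffStar_eq, coeffMinus_eq, q, m, form_neg_left, form_smul_left,
      Matrix.mulVec_zero, form_zero_right,
      M.s_mulVec_of_mem p hz, M.s_mulVec_of_mem p ht, form_smul_right, form_γ125, γ125_γ125_mulVec]
    rw [M.form_comm (M.γ i *ᵥ sPlus θ)]
    by_cases h : i = j
    · subst h
      have hb := hB i
      rw [if_pos rfl] at h1 ⊢
      field_simp
      rw [hb]
      linear_combination (-rt * p.μ i ^ 2) * h1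
    · rw [if_neg h] at h1 ⊢
      linear_combination (-Complex.I * (B j : ℂ)⁻¹ * (rt / 2) * p.μ i * p.μ j) * h1
  have e5 (k l : Fin 9) : M.coeffRot p k l (R *ᵥ ζ) θ + M.coeffRot p k l ζ (R *ᵥ θ) = 0 := by
    simp [coeffRot_eq, q, form_zero_left, form_zero_right]
  have h0 : commutator (KVec p i) KPlus = 0 := by rw [commutator_comm, commutator_KPlus_KVec, neg_zero]
  have h1 : commutator (KVec p i) KMinus = KStar p i := by
    rw [commutator_comm, commutator_KMinus_KVec, neg_neg]
  have h2 (k l : Fin 9) : M.coeffRot p k l ζ θ • commutator (KVec p i) (KRot k l)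
      = M.coeffRot p k l ζ θ •
        -((if i = k then KVec p l else 0) - if i = l then KVec p k else 0) := by
    by_cases h : block k = block l
    · rw [commutator_comm, commutator_KRot_KVec p k l i h]
    · rw [M.coeffRot_of_block_ne hζ hθ h, zero_smul, zero_smul]
  rw [M.commutator_oddBracket _ hζ hθ]
  simp only [h2]
  rw [sum_antisymm_smul i (M.coeffRot_antisymm hζ hθ)]
  simp only [e1, e2, e3, e4, e5, h0, h1, commutator_KVec_KVec, commutator_KVec_KStar, lam_sq hB,
    smul_zero, zero_smul, Finset.sum_const_zero, neg_smul, Finset.sum_neg_distrib, ite_smul,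
    smul_ite, Finset.sum_ite_eq, Finset.mem_univ, if_true, smul_neg, smul_smul, add_zero, zero_add,
    neg_add, neg_neg, mul_comm (B _ : ℂ)]
  abel

theorem compat_KStar (hB : ∀ i, (B i : ℂ) = -(p.μ i) ^ 2) (hB0 : ∀ i, B i ≠ 0) (i : Fin 9) :
    M.Compat p B (KStar p i) (M.rhoStar B i) := by
  refine M.compat_of_coeff (fun ζ hζ => M.mem_constants_of_sPlus (M.sPlus_rhoStar B i ζ))
    (fun ζ hζ θ hθ => ?_)
  have hB0' (i : Fin 9) : (B i : ℂ) ≠ 0 := by exact_mod_cast hB0 i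
  set R := M.rhoStar B i with hR
  have m (η : Spinor) : sMinus (R *ᵥ η) = (rt / 2 * B i) • M.γ i *ᵥ sPlus η :=
    M.sMinus_rhoStar B i η
  have q (η : Spinor) : sPlus (R *ᵥ η) = 0 := M.sPlus_rhoStar B i η
  have r := rt_mul_rt
  have e1 : M.coeffPlus (R *ᵥ ζ) θ + M.coeffPlus ζ (R *ᵥ θ) = -(B i * M.coeffVec i ζ θ) := by
    simp only [coeffPlus_eq, coeffVec_eq, m, form_smul_left,
      form_smul_right, M.form_comm (M.γ i *ᵥ sPlus ζ)]
    linear_combination (Complex.I * (B i) / 2 * (M.form (sMinus θ) (M.γ i *ᵥ sPlus ζ)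
      + M.form (sMinus ζ) (M.γ i *ᵥ sPlus θ))) * r
  have e2 : M.coeffMinus (R *ᵥ ζ) θ + M.coeffMinus ζ (R *ᵥ θ) = 0 := by
    simp only [coeffMinus_eq, q, form_zero_left, form_zero_right]; ring
  have e3 (j : Fin 9) : M.coeffVec j (R *ᵥ ζ) θ + M.coeffVec j ζ (R *ᵥ θ)
      = if i = j then B i * M.coeffMinus ζ θ else 0 := by
    have h1 := M.form_γ_γ_add i j (sPlus ζ) (sPlus θ)
    simp only [coeffVec_eq, coeffMinus_eq, q, m, form_smul_left, Matrix.mulVec_zero,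
      form_zero_right, M.form_comm (M.γ i *ᵥ sPlus θ)]
    by_cases h : i = j
    · rw [if_pos h] at h1 ⊢
      linear_combination (-Complex.I * (rt / 2) * B i) * h1
    · rw [if_neg h] at h1 ⊢
      linear_combination (-Complex.I * (rt / 2) * B i) * h1
  have e4 (j : Fin 9) : M.coeffStar p B j (R *ᵥ ζ) θ + M.coeffStar p B j ζ (R *ᵥ θ)
      = -M.coeffRot p j i ζ θ := by
    have h1 : M.coeffStar p B j (R *ᵥ ζ) θ + M.coeffStar p B j ζ (R *ᵥ θ)
        = B i * (B j : ℂ)⁻¹ * M.coeffRot p i j ζ θ := by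
      simp only [coeffStar_eq, coeffRot_eq, q, m, form_smul_left, Matrix.mulVec_zero,
        form_zero_right, M.form_comm (M.γ i *ᵥ sPlus θ)]
      ring
    rw [h1, ← M.coeffRot_antisymm hζ hθ]
    by_cases h : block i = block j
    · rw [B_eq_of_block hB h, mul_inv_cancel₀ (hB0' j), one_mul]
    · rw [M.coeffRot_of_block_ne hζ hθ h, mul_zero]
  have e5 (k l : Fin 9) : M.coeffRot p k l (R *ᵥ ζ) θ + M.coeffRot p k l ζ (R *ᵥ θ) = 0 := by
    simp [coeffRot_eq, q, form_zero_left, form_zero_right]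
  have h0 : commutator (KStar p i) KPlus = 0 := by
    rw [commutator_comm, commutator_KPlus_KStar, neg_zero]
  have h1 : commutator (KStar p i) KMinus = -(B i : ℂ) • KVec p i := by
    rw [commutator_comm, commutator_KMinus_KStar, lam_sq hB, neg_smul]
  have h2 (k l : Fin 9) : M.coeffRot p k l ζ θ • commutator (KStar p i) (KRot k l)
      = M.coeffRot p k l ζ θ •
        -((if i = k then KStar p l else 0) - if i = l then KStar p k else 0) := by
    by_cases h : block k = block l
    · rw [commutator_comm, commutator_KRot_KStar p k l i h]
    · rw [M.coeffRot_of_block_ne hζ hθ h, zero_smul, zero_smul]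
  have h3 (j : Fin 9) : commutator (KStar p i) (KVec p j)
      = if i = j then (B i : ℂ) • KPlus else 0 := by
    rw [commutator_comm, commutator_KVec_KStar]
    by_cases h : i = j
    · subst h; simp [lam_sq hB]
    · rw [if_neg (Ne.symm h), if_neg h, neg_zero]
  rw [M.commutator_oddBracket _ hζ hθ]
  simp only [h2]
  rw [sum_antisymm_smul i (M.coeffRot_antisymm hζ hθ)]
  simp only [e1, e2, e3, e4, e5, h0, h1, h3, commutator_KStar_KStar,
    smul_zero, zero_smul, Finset.sum_const_zero, neg_smul, Finset.sum_neg_distrib, ite_smul,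
    smul_ite, Finset.sum_ite_eq, Finset.mem_univ, if_true, smul_neg, smul_smul, add_zero, zero_add,
    neg_add, neg_neg, mul_comm (B _ : ℂ)]
  abel

theorem compat_KRot (hB : ∀ i, (B i : ℂ) = -(p.μ i) ^ 2) {i j : Fin 9} (h : block i = block j) :
    M.Compat p B (KRot i j) (M.rhoRot i j) := by
  refine M.compat_of_coeff (fun ζ hζ => ?_) (fun ζ hζ θ hθ => ?_)
  · rw [mem_constants_iff] at hζ ⊢
    rw [sPlus_rhoRot, M.γ1234_rot_mulVec h, hζ]
  set R := M.rhoRot i j with hR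
  have m (η : Spinor) : sMinus (R *ᵥ η) = M.rot i j *ᵥ sMinus η := M.sMinus_rhoRot i j η
  have q (η : Spinor) : sPlus (R *ᵥ η) = M.rot i j *ᵥ sPlus η := M.sPlus_rhoRot i j η
  have e1 : M.coeffPlus (R *ᵥ ζ) θ + M.coeffPlus ζ (R *ᵥ θ) = 0 := by
    simp only [coeffPlus_eq, m, form_rot]; ring
  have e2 : M.coeffMinus (R *ᵥ ζ) θ + M.coeffMinus ζ (R *ᵥ θ) = 0 := by
    simp only [coeffMinus_eq, q, form_rot]; ring
  have e3 (k : Fin 9) : M.coeffVec k (R *ᵥ ζ) θ + M.coeffVec k ζ (R *ᵥ θ)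
      = (if k = i then M.coeffVec j ζ θ else 0) - if k = j then M.coeffVec i ζ θ else 0 := by
    simp only [coeffVec_eq, m, q, form_rot, γ_rot_mulVec, form_add_right, form_sub_right]
    split_ifs <;> (try simp only [form_zero_right]) <;> ring
  have e4 (k : Fin 9) : M.coeffStar p B k (R *ᵥ ζ) θ + M.coeffStar p B k ζ (R *ᵥ θ)
      = (if k = i then M.coeffStar p B j ζ θ else 0)
        - if k = j then M.coeffStar p B i ζ θ else 0 := by
    have hb := B_eq_of_block hB h
    simp only [coeffStar_eq, m, q, form_rot, M.s_rot_mulVec p h, form_add_right, form_sub_right]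
    split_ifs with h1 h2 h2
    · subst h1; subst h2; ring
    · subst h1; rw [hb]; simp only [form_zero_right]; ring
    · subst h2; rw [hb]; simp only [form_zero_right]; ring
    · simp only [form_zero_right]; ring
  have e5 (k l : Fin 9) : M.coeffRot p k l (R *ᵥ ζ) θ + M.coeffRot p k l ζ (R *ᵥ θ)
      = (if k = i then M.coeffRot p j l ζ θ else 0) - (if k = j then M.coeffRot p i l ζ θ else 0)
        + (if l = i then M.coeffRot p k j ζ θ else 0)
        - (if l = j then M.coeffRot p k i ζ θ else 0) := by
    simp only [coeffRot_eq, q, M.s_rot_mulVec p h, γ_rot_mulVec, form_add_right, form_sub_right,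
      form_add_left, form_sub_left, form_rot]
    split_ifs <;> (try simp only [form_zero_right, form_zero_left]) <;> ring
  have h0 : commutator (KRot i j) KPlus = 0 := by rw [commutator_comm, commutator_KPlus_KRot, neg_zero]
  have h1 : commutator (KRot i j) KMinus = 0 := by
    rw [commutator_comm, commutator_KMinus_KRot, neg_zero]
  rw [M.commutator_oddBracket _ hζ hθ]
  simp only [e1, e2, e3, e4, e5, h0, h1, commutator_KRot_KVec p i j _ h,
    commutator_KRot_KStar p i j _ h, commutator_KRot_KRot, smul_zero, zero_smul, smul_sub, smul_add,
    sub_smul, add_smul, smul_ite, ite_smul, Finset.sum_add_distrib, Finset.sum_sub_distrib,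
    Finset.sum_ite_eq', Finset.mem_univ, if_true, add_zero, zero_add]
  have c (f : Fin 9 → Fin 9 → VectorField) (a : Fin 9) :
      ∑ k, ∑ l, (if k = a then f k l else 0) = ∑ l, f a l := by
    rw [Finset.sum_comm]; simp
  simp only [c, neg_add, neg_sub]
  abel

end SpinModule

/-! ### The action of the even part -/

theorem leviCivita_add (B : Fin 9 → ℝ) {X Y : VectorField} (hX : ContDiff ℝ ∞ X)
    (hY : ContDiff ℝ ∞ Y) (x : Pt) (i j : Idx) : leviCivita (cwMetric B) (X + Y) x i j
      = leviCivita (cwMetric B) X x i j + leviCivita (cwMetric B) Y x i j := by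
  have h : pd i (X + Y) x = pd i X x + pd i Y x := pd_add i (hX.diffAt x) (hY.diffAt x)
  rw [leviCivita, leviCivita, leviCivita, ← Finset.sum_add_distrib, h]
  refine Finset.sum_congr rfl fun k _ => ?_
  simp only [Pi.add_apply]
  ring

theorem leviCivita_smul (B : Fin 9 → ℝ) {X : VectorField} (hX : ContDiff ℝ ∞ X) (c : ℂ) (x : Pt)
    (i j : Idx) : leviCivita (cwMetric B) (c • X) x i j = c * leviCivita (cwMetric B) X x i j := by
  have h : pd i (c • X) x = c • pd i X x := pd_const_smul i c (hX.diffAt x)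
  rw [leviCivita, leviCivita, Finset.mul_sum, h]
  refine Finset.sum_congr rfl fun k _ => ?_
  simp only [Pi.smul_apply, smul_eq_mul]
  ring

theorem nablaEnd_add (B : Fin 9 → ℝ) {X Y : VectorField} (hX : ContDiff ℝ ∞ X)
    (hY : ContDiff ℝ ∞ Y) (x : Pt) : nablaEnd B (X + Y) x = nablaEnd B X x + nablaEnd B Y x := by
  ext a b
  simp only [nablaEnd, Matrix.of_apply, Matrix.add_apply, leviCivita_add B hX hY, mul_add,
    Finset.sum_add_distrib]

theorem nablaEnd_smul (B : Fin 9 → ℝ) {X : VectorField} (hX : ContDiff ℝ ∞ X) (c : ℂ) (x : Pt) :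
    nablaEnd B (c • X) x = c • nablaEnd B X x := by
  ext a b
  simp only [nablaEnd, Matrix.of_apply, Matrix.smul_apply, leviCivita_smul B hX, smul_eq_mul,
    Finset.mul_sum]
  exact Finset.sum_congr rfl fun i _ => Finset.sum_congr rfl fun j _ => by ring

namespace SpinModule

variable (M : SpinModule) {p : Params} {B : Fin 9 → ℝ}

theorem spinLie_add {X Y : VectorField} (hX : ContDiff ℝ ∞ X) (hY : ContDiff ℝ ∞ Y)
    (ξ : SpinorField) : M.spinLie B (X + Y) ξ = M.spinLie B X ξ + M.spinLie B Y ξ := by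
  ext x : 1
  simp only [spinLie, Pi.add_apply, nablaEnd_add B hX hY, spinRep_add, Matrix.add_mulVec, add_smul,
    Finset.sum_add_distrib]
  abel

theorem spinLie_smul {X : VectorField} (hX : ContDiff ℝ ∞ X) (c : ℂ) (ξ : SpinorField) :
    M.spinLie B (c • X) ξ = c • M.spinLie B X ξ := by
  ext x : 1
  simp only [spinLie, Pi.smul_apply, nablaEnd_smul B hX, spinRep_smul, Matrix.smul_mulVec,
    smul_eq_mul, mul_smul, smul_sub, Finset.smul_sum]

theorem parField_add (ζ θ : Spinor) :
    M.parField p (ζ + θ) = M.parField p ζ + M.parField p θ := by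
  ext x : 1
  simp only [parField, Matrix.mulVec_add, Pi.add_apply]
  abel

theorem parField_smul (c : ℂ) (ζ : Spinor) : M.parField p (c • ζ) = c • M.parField p ζ := by
  ext x : 1
  simp only [parField, Matrix.mulVec_smul, Pi.smul_apply, smul_add]

theorem parField_neg (ζ : Spinor) : M.parField p (-ζ) = -M.parField p ζ := by
  simpa using M.parField_smul (p := p) (-1) ζ

/-- On the space of constants, the vector field `X` of the even part acts through `-R`: the
spinorial Lie derivative of the parallel spinor field with constants `ζ` has constants `-R ζ`, and
`ad X` acts on odd-odd brackets accordingly. -/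
structure Represents (p : Params) (B : Fin 9 → ℝ) (X : VectorField) (R : Matrix SIdx SIdx ℂ) :
    Prop where
  mem : X ∈ killingAlgebra p
  smooth : ContDiff ℝ ∞ X
  spinLie_eq : ∀ ζ ∈ M.constants, M.spinLie B X (M.parField p ζ) = -M.parField p (R *ᵥ ζ)
  compat : M.Compat p B X R

variable {M}

theorem Represents.add {X Y : VectorField} {R S : Matrix SIdx SIdx ℂ}
    (hX : M.Represents p B X R) (hY : M.Represents p B Y S) : M.Represents p B (X + Y) (R + S) where
  mem := add_mem hX.mem hY.mem
  smooth := hX.smooth.add hY.smooth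
  spinLie_eq ζ hζ := by
    rw [M.spinLie_add hX.smooth hY.smooth, hX.spinLie_eq ζ hζ, hY.spinLie_eq ζ hζ,
      Matrix.add_mulVec, parField_add, neg_add]
  compat := by
    refine ⟨fun ζ hζ => ?_, fun ζ hζ θ hθ => ?_⟩
    · rw [Matrix.add_mulVec]; exact add_mem (hX.compat.1 ζ hζ) (hY.compat.1 ζ hζ)
    · rw [commutator_add_left _ hX.smooth hY.smooth, hX.compat.2 ζ hζ θ hθ, hY.compat.2 ζ hζ θ hθ,
        Matrix.add_mulVec, Matrix.add_mulVec, oddBracket_add_left, oddBracket_add_right]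
      abel

theorem Represents.smul {X : VectorField} {R : Matrix SIdx SIdx ℂ} (hX : M.Represents p B X R)
    (c : ℂ) : M.Represents p B (c • X) (c • R) where
  mem := Submodule.smul_mem _ c hX.mem
  smooth := contDiff_const.smul hX.smooth
  spinLie_eq ζ hζ := by
    rw [M.spinLie_smul hX.smooth, hX.spinLie_eq ζ hζ, Matrix.smul_mulVec, parField_smul, smul_neg]
  compat := by
    refine ⟨fun ζ hζ => ?_, fun ζ hζ θ hθ => ?_⟩
    · rw [Matrix.smul_mulVec]; exact Submodule.smul_mem _ c (hX.compat.1 ζ hζ)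
    · rw [commutator_smul_left _ hX.smooth, hX.compat.2 ζ hζ θ hθ, Matrix.smul_mulVec,
        Matrix.smul_mulVec, oddBracket_smul_left, oddBracket_smul_right, smul_neg, smul_add]

theorem Represents.neg {X : VectorField} {R : Matrix SIdx SIdx ℂ} (hX : M.Represents p B X R) :
    M.Represents p B (-X) (-R) := by
  simpa using hX.smul (-1)

theorem Represents.sub {X Y : VectorField} {R S : Matrix SIdx SIdx ℂ}
    (hX : M.Represents p B X R) (hY : M.Represents p B Y S) : M.Represents p B (X - Y) (R - S) := by
  simpa [sub_eq_add_neg] using hX.add hY.neg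

theorem Represents.congr {X : VectorField} {R S : Matrix SIdx SIdx ℂ} (hX : M.Represents p B X R)
    (h : ∀ ζ ∈ M.constants, S *ᵥ ζ = R *ᵥ ζ) : M.Represents p B X S where
  mem := hX.mem
  smooth := hX.smooth
  spinLie_eq ζ hζ := by rw [h ζ hζ, hX.spinLie_eq ζ hζ]
  compat := by
    refine ⟨fun ζ hζ => ?_, fun ζ hζ θ hθ => ?_⟩
    · rw [h ζ hζ]; exact hX.compat.1 ζ hζ
    · rw [h ζ hζ, h θ hθ, hX.compat.2 ζ hζ θ hθ]

/-- The endomorphism representing a vector field is unique on the space of constants: it is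
recovered from the value of the spinorial Lie derivative at the origin. -/
theorem Represents.mulVec_eq {X : VectorField} {R S : Matrix SIdx SIdx ℂ}
    (hR : M.Represents p B X R) (hS : M.Represents p B X S) {ζ : Spinor} (hζ : ζ ∈ M.constants) :
    R *ᵥ ζ = S *ᵥ ζ := by
  have h := congrFun ((hR.spinLie_eq ζ hζ).symm.trans (hS.spinLie_eq ζ hζ)) 0
  simpa only [Pi.neg_apply, parField_zero, neg_inj] using h

variable (M)

theorem represents_KPlus (hB : ∀ i, (B i : ℂ) = -(p.μ i) ^ 2) : M.Represents p B KPlus 0 where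
  mem := Submodule.subset_span (by simp)
  smooth := contDiff_KPlus
  spinLie_eq ζ hζ := by
    have h : M.parField p 0 = 0 := by simpa using M.parField_smul (p := p) 0 0
    rw [M.spinLie_KPlus hB hζ, Matrix.zero_mulVec, h, neg_zero]
  compat := M.compat_KPlus

theorem represents_zero (hB : ∀ i, (B i : ℂ) = -(p.μ i) ^ 2) : M.Represents p B 0 0 := by
  simpa using (M.represents_KPlus hB).smul 0

theorem represents_KMinus (hB : ∀ i, (B i : ℂ) = -(p.μ i) ^ 2) (hB0 : ∀ i, B i ≠ 0) :
    M.Represents p B KMinus (M.rho p minus) where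
  mem := Submodule.subset_span (by simp)
  smooth := contDiff_KMinus
  spinLie_eq _ hζ := M.spinLie_KMinus hB hζ
  compat := M.compat_KMinus hB hB0

theorem represents_KVec (hB : ∀ i, (B i : ℂ) = -(p.μ i) ^ 2) (hB0 : ∀ i, B i ≠ 0) (i : Fin 9) :
    M.Represents p B (KVec p i) (M.rho p (Sum.inr i)) where
  mem := Submodule.subset_span (by simp)
  smooth := contDiff_KVec p i
  spinLie_eq _ hζ := M.spinLie_KVec hB hζ i
  compat := M.compat_KVec hB hB0 i

theorem represents_KStar (hB : ∀ i, (B i : ℂ) = -(p.μ i) ^ 2) (hB0 : ∀ i, B i ≠ 0) (i : Fin 9) :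
    M.Represents p B (KStar p i) (M.rhoStar B i) where
  mem := Submodule.subset_span (by simp)
  smooth := contDiff_KStar p i
  spinLie_eq _ hζ := M.spinLie_KStar hB hζ i
  compat := M.compat_KStar hB hB0 i

theorem represents_KRot (hB : ∀ i, (B i : ℂ) = -(p.μ i) ^ 2) {i j : Fin 9} (h : block i = block j) :
    M.Represents p B (KRot i j) (M.rhoRot i j) where
  mem := Submodule.subset_span (Or.inr ⟨i, j, h, rfl⟩)
  smooth := contDiff_KRot i j
  spinLie_eq _ hζ := M.spinLie_KRot hB hζ h
  compat := M.compat_KRot hB h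

theorem exists_represents (hB : ∀ i, (B i : ℂ) = -(p.μ i) ^ 2) (hB0 : ∀ i, B i ≠ 0)
    {X : VectorField} (hX : X ∈ killingAlgebra p) : ∃ R, M.Represents p B X R := by
  induction hX using Submodule.span_induction with
  | mem X hX =>
    rcases hX with (((rfl | rfl) | ⟨i, rfl⟩) | ⟨i, rfl⟩) | ⟨i, j, h, rfl⟩
    · exact ⟨_, M.represents_KPlus hB⟩
    · exact ⟨_, M.represents_KMinus hB hB0⟩
    · exact ⟨_, M.represents_KVec hB hB0 i⟩
    · exact ⟨_, M.represents_KStar hB hB0 i⟩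
    · exact ⟨_, M.represents_KRot hB h⟩
  | zero => exact ⟨_, M.represents_zero hB⟩
  | add X Y _ _ hX hY => exact ⟨_, hX.choose_spec.add hY.choose_spec⟩
  | smul c X _ hX => exact ⟨_, hX.choose_spec.smul c⟩

/-! ### The commutator and the representation on constants -/

theorem represents_ite (hB : ∀ i, (B i : ℂ) = -(p.μ i) ^ 2) {c : Prop} [Decidable c]
    {X : VectorField} {R : Matrix SIdx SIdx ℂ} (h : c → M.Represents p B X R) :
    M.Represents p B (if c then X else 0) (if c then R else 0) := by
  split_ifs with hc
  · exact h hc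
  · exact M.represents_zero hB

/-- The commutator of `X` and `Y` acts as the commutator of endomorphisms. The order is reversed,
because a vector field acts through minus the endomorphism representing it. -/
def RepresentsBracket (p : Params) (B : Fin 9 → ℝ) (X Y : VectorField)
    (R S : Matrix SIdx SIdx ℂ) : Prop :=
  M.Represents p B X R ∧ M.Represents p B Y S ∧
    M.Represents p B (commutator X Y) (S * R - R * S)

variable {M}

theorem Represents.bracket {X Y : VectorField} {R S T : Matrix SIdx SIdx ℂ}
    (hX : M.Represents p B X R) (hY : M.Represents p B Y S)
    (h : M.Represents p B (commutator X Y) T)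
    (hT : ∀ ζ ∈ M.constants, S *ᵥ (R *ᵥ ζ) - R *ᵥ (S *ᵥ ζ) = T *ᵥ ζ) :
    M.RepresentsBracket p B X Y R S :=
  ⟨hX, hY, h.congr fun ζ hζ => by
    rw [← hT ζ hζ, Matrix.sub_mulVec, ← Matrix.mulVec_mulVec, ← Matrix.mulVec_mulVec]⟩

theorem RepresentsBracket.symm {X Y : VectorField} {R S : Matrix SIdx SIdx ℂ}
    (h : M.RepresentsBracket p B X Y R S) : M.RepresentsBracket p B Y X S R :=
  ⟨h.2.1, h.1, by rw [commutator_comm, ← neg_sub]; exact h.2.2.neg⟩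

/-- The bracket property extends from generators to the span, in the first argument. -/
theorem representsBracket_of_generators (hB : ∀ i, (B i : ℂ) = -(p.μ i) ^ 2) {Y : VectorField}
    {S : Matrix SIdx SIdx ℂ} (hY : M.Represents p B Y S)
    (hplus : M.RepresentsBracket p B KPlus Y 0 S)
    (hminus : M.RepresentsBracket p B KMinus Y (M.rho p minus) S)
    (hvec : ∀ i, M.RepresentsBracket p B (KVec p i) Y (M.rho p (Sum.inr i)) S)
    (hstar : ∀ i, M.RepresentsBracket p B (KStar p i) Y (M.rhoStar B i) S)
    (hrot : ∀ i j, block i = block j → M.RepresentsBracket p B (KRot i j) Y (M.rhoRot i j) S)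
    {X : VectorField} (hX : X ∈ killingAlgebra p) : ∃ R, M.RepresentsBracket p B X Y R S := by
  induction hX using Submodule.span_induction with
  | mem X hX =>
    rcases hX with (((rfl | rfl) | ⟨i, rfl⟩) | ⟨i, rfl⟩) | ⟨i, j, h, rfl⟩
    · exact ⟨_, hplus⟩
    · exact ⟨_, hminus⟩
    · exact ⟨_, hvec i⟩
    · exact ⟨_, hstar i⟩
    · exact ⟨_, hrot i j h⟩
  | zero =>
    refine ⟨0, M.represents_zero hB, hY, ?_⟩
    rw [commutator_comm, commutator_zero_right, neg_zero, Matrix.mul_zero, Matrix.zero_mul, sub_zero]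
    exact M.represents_zero hB
  | add X X' _ _ hX hX' =>
    obtain ⟨R, h1, -, h2⟩ := hX
    obtain ⟨R', h1', -, h2'⟩ := hX'
    refine ⟨R + R', h1.add h1', hY, ?_⟩
    rw [commutator_add_left _ h1.smooth h1'.smooth, mul_add, add_mul, add_sub_add_comm]
    exact h2.add h2'
  | smul c X _ hX =>
    obtain ⟨R, h1, -, h2⟩ := hX
    refine ⟨c • R, h1.smul c, hY, ?_⟩
    rw [commutator_smul_left _ h1.smooth, Matrix.mul_smul, Matrix.smul_mul, ← smul_sub]
    exact h2.smul c

variable (M) in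
theorem bracket_KPlus (hB : ∀ i, (B i : ℂ) = -(p.μ i) ^ 2) (hB0 : ∀ i, B i ≠ 0)
    {Y : VectorField} (hY : Y ∈ killingAlgebra p) {S : Matrix SIdx SIdx ℂ}
    (h : M.Represents p B Y S) :
    M.RepresentsBracket p B KPlus Y 0 S := by
  have h0 : commutator KPlus Y = 0 := by
    induction hY using Submodule.span_induction generalizing S with
    | mem X hX =>
      rcases hX with (((rfl | rfl) | ⟨i, rfl⟩) | ⟨i, rfl⟩) | ⟨i, j, h, rfl⟩
      · ext x : 1; simp [commutator_apply]
      · exact commutator_KPlus_KMinus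
      · exact commutator_KPlus_KVec p i
      · exact commutator_KPlus_KStar p i
      · exact commutator_KPlus_KRot i j
    | zero => exact commutator_zero_right _
    | add X Y hX hY h1 h2 =>
      obtain ⟨R, hR⟩ := M.exists_represents hB hB0 hX
      obtain ⟨R', hR'⟩ := M.exists_represents hB hB0 hY
      rw [commutator_add_right _ hR.smooth hR'.smooth, h1 hR, h2 hR', add_zero]
    | smul c X hX h1 =>
      obtain ⟨R, hR⟩ := M.exists_represents hB hB0 hX
      rw [commutator_smul_right _ hR.smooth, h1 hR, smul_zero]
  refine (M.represents_KPlus hB).bracket h (T := 0) (h0 ▸ M.represents_zero hB) fun ζ _ => ?_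
  simp only [Matrix.zero_mulVec, Matrix.mulVec_zero, sub_zero]

variable (M)

theorem bracket_KMinus_KVec (hB : ∀ i, (B i : ℂ) = -(p.μ i) ^ 2) (hB0 : ∀ i, B i ≠ 0) (i : Fin 9) :
    M.RepresentsBracket p B KMinus (KVec p i) (M.rho p minus) (M.rho p (Sum.inr i)) := by
  refine (M.represents_KMinus hB hB0).bracket (M.represents_KVec hB hB0 i)
    (T := -M.rhoStar B i) ?_ fun ζ hζ => spinor_ext ?_ ?_
  · rw [commutator_KMinus_KVec]; exact (M.represents_KStar hB hB0 i).neg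
  · have h := M.cbar_s_sub_s_d p ((M.mem_constants_iff ζ).1 hζ) i
    rw [← neg_neg (p.μ i ^ 2), ← hB] at h
    rw [sMinus_sub, sMinus_rho_vec, sMinus_rho_minus, sPlus_rho_minus, sMinus_rho_vec,
      Matrix.neg_mulVec, sMinus_neg, sMinus_rhoStar, Matrix.mulVec_neg, Matrix.mulVec_smul,
      eq_add_of_sub_eq h]
    module
  · rw [sPlus_sub, sPlus_rho_vec, sPlus_rho_minus, sPlus_rho_vec, Matrix.neg_mulVec, sPlus_neg,
      sPlus_rhoStar, Matrix.mulVec_zero, sub_zero, neg_zero]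

theorem bracket_KMinus_KStar (hB : ∀ i, (B i : ℂ) = -(p.μ i) ^ 2) (hB0 : ∀ i, B i ≠ 0)
    (i : Fin 9) :
    M.RepresentsBracket p B KMinus (KStar p i) (M.rho p minus) (M.rhoStar B i) := by
  refine (M.represents_KMinus hB hB0).bracket (M.represents_KStar hB hB0 i)
    (T := (B i : ℂ) • M.rho p (Sum.inr i)) ?_ fun ζ hζ => spinor_ext ?_ ?_
  · rw [commutator_KMinus_KStar, lam_sq hB]; exact (M.represents_KVec hB hB0 i).smul _
  · rw [sMinus_sub, sMinus_rhoStar, sMinus_rho_minus, sPlus_rho_minus, sMinus_rhoStar,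
      Matrix.smul_mulVec, sMinus_smul, sMinus_rho_vec, s_mulVec, Matrix.mulVec_smul]
    module
  · rw [sPlus_sub, sPlus_rhoStar, sPlus_rho_minus, sPlus_rhoStar, Matrix.smul_mulVec, sPlus_smul,
      sPlus_rho_vec, Matrix.mulVec_zero, sub_zero, smul_zero]

theorem bracket_KMinus_KRot (hB : ∀ i, (B i : ℂ) = -(p.μ i) ^ 2) (hB0 : ∀ i, B i ≠ 0)
    {i j : Fin 9} (h : block i = block j) :
    M.RepresentsBracket p B KMinus (KRot i j) (M.rho p minus) (M.rhoRot i j) := by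
  refine (M.represents_KMinus hB hB0).bracket (M.represents_KRot hB h)
    (T := 0) ?_ fun ζ hζ => spinor_ext ?_ ?_
  · rw [commutator_KMinus_KRot]; exact M.represents_zero hB
  · rw [sMinus_sub, sMinus_rhoRot, sMinus_rho_minus, sMinus_rho_minus, sMinus_rhoRot,
      M.cbar_rot_mulVec p h, sub_self, Matrix.zero_mulVec, sMinus_zero]
  · rw [sPlus_sub, sPlus_rhoRot, sPlus_rho_minus, sPlus_rho_minus, sPlus_rhoRot,
      M.d_rot_mulVec p h, sub_self, Matrix.zero_mulVec, sPlus_zero]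

theorem bracket_KVec_KVec (hB : ∀ i, (B i : ℂ) = -(p.μ i) ^ 2) (hB0 : ∀ i, B i ≠ 0)
    (i j : Fin 9) : M.RepresentsBracket p B (KVec p i) (KVec p j) (M.rho p (Sum.inr i))
      (M.rho p (Sum.inr j)) := by
  refine (M.represents_KVec hB hB0 i).bracket (M.represents_KVec hB hB0 j)
    (T := 0) ?_ fun ζ hζ => spinor_ext ?_ ?_
  · rw [commutator_KVec_KVec]; exact M.represents_zero hB
  · simp only [sMinus_sub, sMinus_rho_vec, sPlus_rho_vec, Matrix.mulVec_zero, smul_zero, sub_zero,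
      neg_zero, Matrix.zero_mulVec, sMinus_zero]
  · simp only [sPlus_sub, sPlus_rho_vec, sub_zero, Matrix.zero_mulVec, sPlus_zero]

theorem bracket_KStar_KStar (hB : ∀ i, (B i : ℂ) = -(p.μ i) ^ 2) (hB0 : ∀ i, B i ≠ 0)
    (i j : Fin 9) : M.RepresentsBracket p B (KStar p i) (KStar p j) (M.rhoStar B i)
      (M.rhoStar B j) := by
  refine (M.represents_KStar hB hB0 i).bracket (M.represents_KStar hB hB0 j)
    (T := 0) ?_ fun ζ hζ => spinor_ext ?_ ?_
  · rw [commutator_KStar_KStar]; exact M.represents_zero hB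
  · simp only [sMinus_sub, sMinus_rhoStar, sPlus_rhoStar, Matrix.mulVec_zero, smul_zero, sub_zero,
      Matrix.zero_mulVec, sMinus_zero]
  · simp only [sPlus_sub, sPlus_rhoStar, sub_zero, Matrix.zero_mulVec, sPlus_zero]

theorem bracket_KVec_KStar (hB : ∀ i, (B i : ℂ) = -(p.μ i) ^ 2) (hB0 : ∀ i, B i ≠ 0)
    (i j : Fin 9) : M.RepresentsBracket p B (KVec p i) (KStar p j) (M.rho p (Sum.inr i))
      (M.rhoStar B j) := by
  refine (M.represents_KVec hB hB0 i).bracket (M.represents_KStar hB hB0 j)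
    (T := if i = j then -(p.lam i ^ 2) • 0 else 0) ?_ fun ζ hζ => spinor_ext ?_ ?_
  · rw [commutator_KVec_KStar]
    exact M.represents_ite hB fun _ => (M.represents_KPlus hB).smul _
  · simp only [sMinus_sub, sMinus_rhoStar, sMinus_rho_vec, sPlus_rho_vec, sPlus_rhoStar,
      Matrix.mulVec_zero, smul_zero, sub_zero, neg_zero, ite_self, Matrix.zero_mulVec, sMinus_zero]
  · simp only [sPlus_sub, sPlus_rhoStar, sPlus_rho_vec, sub_zero, smul_zero, ite_self,
      Matrix.zero_mulVec, sPlus_zero]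

theorem ite_mulVec (c : Prop) [Decidable c] (R : Matrix SIdx SIdx ℂ) (ζ : Spinor) :
    (if c then R else 0) *ᵥ ζ = if c then R *ᵥ ζ else 0 := by
  split_ifs
  · rfl
  · rw [Matrix.zero_mulVec]

theorem sMinus_ite (c : Prop) [Decidable c] (ζ : Spinor) :
    sMinus (if c then ζ else 0) = if c then sMinus ζ else 0 := by
  split_ifs <;> rfl

theorem sPlus_ite (c : Prop) [Decidable c] (ζ : Spinor) :
    sPlus (if c then ζ else 0) = if c then sPlus ζ else 0 := by
  split_ifs <;> rfl

theorem bracket_KRot_KVec (hB : ∀ i, (B i : ℂ) = -(p.μ i) ^ 2) (hB0 : ∀ i, B i ≠ 0)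
    {i j : Fin 9} (h : block i = block j) (k : Fin 9) :
    M.RepresentsBracket p B (KRot i j) (KVec p k) (M.rhoRot i j) (M.rho p (Sum.inr k)) := by
  refine (M.represents_KRot hB h).bracket (M.represents_KVec hB hB0 k)
    (T := (if k = i then M.rho p (Sum.inr j) else 0) - if k = j then M.rho p (Sum.inr i) else 0)
    ?_ fun ζ hζ => spinor_ext ?_ ?_
  · rw [commutator_KRot_KVec p i j k h]
    exact (M.represents_ite hB fun _ => M.represents_KVec hB hB0 j).sub
      (M.represents_ite hB fun _ => M.represents_KVec hB hB0 i)
  · simp only [sMinus_sub, sMinus_rhoRot, sMinus_rho_vec, sPlus_rhoRot, Matrix.sub_mulVec,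
      ite_mulVec, sMinus_ite, M.s_rot_mulVec p h, Matrix.mulVec_neg, Matrix.mulVec_smul]
    split_ifs <;> module
  · simp only [sPlus_sub, sPlus_rhoRot, sPlus_rho_vec, Matrix.sub_mulVec, ite_mulVec, sPlus_ite,
      Matrix.mulVec_zero, sub_zero, ite_self]

theorem bracket_KRot_KStar (hB : ∀ i, (B i : ℂ) = -(p.μ i) ^ 2) (hB0 : ∀ i, B i ≠ 0)
    {i j : Fin 9} (h : block i = block j) (k : Fin 9) :
    M.RepresentsBracket p B (KRot i j) (KStar p k) (M.rhoRot i j) (M.rhoStar B k) := by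
  refine (M.represents_KRot hB h).bracket (M.represents_KStar hB hB0 k)
    (T := (if k = i then M.rhoStar B j else 0) - if k = j then M.rhoStar B i else 0)
    ?_ fun ζ hζ => spinor_ext ?_ ?_
  · rw [commutator_KRot_KStar p i j k h]
    exact (M.represents_ite hB fun _ => M.represents_KStar hB hB0 j).sub
      (M.represents_ite hB fun _ => M.represents_KStar hB hB0 i)
  · have hb := B_eq_of_block hB h
    simp only [sMinus_sub, sMinus_rhoRot, sMinus_rhoStar, sPlus_rhoRot, Matrix.sub_mulVec,
      ite_mulVec, sMinus_ite, γ_rot_mulVec, Matrix.mulVec_smul]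
    split_ifs with h1 h2 h2
    · subst h1; subst h2; module
    · subst h1; rw [hb]; module
    · subst h2; rw [hb]; module
    · module
  · simp only [sPlus_sub, sPlus_rhoRot, sPlus_rhoStar, Matrix.sub_mulVec, ite_mulVec, sPlus_ite,
      Matrix.mulVec_zero, sub_zero, ite_self]

theorem rot_commutator (i j k l : Fin 9) (v : VIdx → ℂ) :
    M.rot k l *ᵥ (M.rot i j *ᵥ v) - M.rot i j *ᵥ (M.rot k l *ᵥ v)
      = (if k = i then M.rot j l *ᵥ v else 0) - (if k = j then M.rot i l *ᵥ v else 0)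
        + (if l = i then M.rot k j *ᵥ v else 0) - (if l = j then M.rot k i *ᵥ v else 0) := by
  have e (a : Prop) [Decidable a] (b : Matrix VIdx VIdx ℂ) (w : VIdx → ℂ) :
      b *ᵥ (if a then w else 0) = if a then b *ᵥ w else 0 := by
    split_ifs <;> simp
  rw [M.rot_mulVec k l, M.rot_mulVec k l]
  simp only [γ_rot_mulVec, Matrix.mulVec_add, Matrix.mulVec_sub, Matrix.mulVec_smul, e]
  simp only [rot_mulVec]
  split_ifs <;> module

theorem bracket_KRot_KRot (hB : ∀ i, (B i : ℂ) = -(p.μ i) ^ 2)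
    {i j k l : Fin 9} (h : block i = block j) (h' : block k = block l) :
    M.RepresentsBracket p B (KRot i j) (KRot k l) (M.rhoRot i j) (M.rhoRot k l) := by
  refine (M.represents_KRot hB h).bracket (M.represents_KRot hB h')
    (T := (if k = i then M.rhoRot j l else 0) - (if k = j then M.rhoRot i l else 0)
        + (if l = i then M.rhoRot k j else 0) - (if l = j then M.rhoRot k i else 0))
    ?_ fun ζ hζ => spinor_ext ?_ ?_
  · rw [commutator_KRot_KRot]
    refine (((M.represents_ite hB fun e => ?_).sub (M.represents_ite hB fun e => ?_)).add
      (M.represents_ite hB fun e => ?_)).sub (M.represents_ite hB fun e => ?_) <;> subst e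
    · exact M.represents_KRot hB (h.symm.trans h')
    · exact M.represents_KRot hB (h.trans h')
    · exact M.represents_KRot hB (h'.trans h)
    · exact M.represents_KRot hB (h'.trans h.symm)
  · simp only [sMinus_sub, sMinus_add, sMinus_rhoRot, Matrix.sub_mulVec, Matrix.add_mulVec,
      ite_mulVec, sMinus_ite, rot_commutator]
  · simp only [sPlus_sub, sPlus_add, sPlus_rhoRot, Matrix.sub_mulVec, Matrix.add_mulVec,
      ite_mulVec, sPlus_ite, rot_commutator]

theorem exists_representsBracket (hB : ∀ i, (B i : ℂ) = -(p.μ i) ^ 2) (hB0 : ∀ i, B i ≠ 0)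
    {X Y : VectorField} (hX : X ∈ killingAlgebra p) (hY : Y ∈ killingAlgebra p) :
    ∃ R S, M.RepresentsBracket p B X Y R S := by
  induction hY using Submodule.span_induction with
  | mem Y hY =>
    have hY' : Y ∈ killingAlgebra p := Submodule.subset_span hY
    suffices h : ∃ S, M.Represents p B Y S ∧
        M.RepresentsBracket p B KMinus Y (M.rho p minus) S ∧
        (∀ i, M.RepresentsBracket p B (KVec p i) Y (M.rho p (Sum.inr i)) S) ∧
        (∀ i, M.RepresentsBracket p B (KStar p i) Y (M.rhoStar B i) S) ∧
        (∀ i j, block i = block j → M.RepresentsBracket p B (KRot i j) Y (M.rhoRot i j) S) by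
      obtain ⟨S, h, hm, hv, hs, hr⟩ := h
      obtain ⟨R, hR⟩ := representsBracket_of_generators hB h (M.bracket_KPlus hB hB0 hY' h)
        hm hv hs hr hX
      exact ⟨R, S, hR⟩
    have plus {Z : VectorField} {S : Matrix SIdx SIdx ℂ} (h : M.Represents p B Z S) :=
      (M.bracket_KPlus hB hB0 h.mem h).symm
    rcases hY with (((rfl | rfl) | ⟨i, rfl⟩) | ⟨i, rfl⟩) | ⟨i, j, h, rfl⟩
    · exact ⟨0, M.represents_KPlus hB, plus (M.represents_KMinus hB hB0),
        fun i => plus (M.represents_KVec hB hB0 i), fun i => plus (M.represents_KStar hB hB0 i),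
        fun i j h => plus (M.represents_KRot hB h)⟩
    · have h0 := M.represents_KMinus (B := B) hB hB0
      refine ⟨_, h0, ⟨h0, h0, ?_⟩, fun i => (M.bracket_KMinus_KVec hB hB0 i).symm,
        fun i => (M.bracket_KMinus_KStar hB hB0 i).symm,
        fun i j h => (M.bracket_KMinus_KRot hB hB0 h).symm⟩
      have : commutator KMinus KMinus = 0 := by ext x : 1; simp [commutator_apply]
      rw [this, sub_self]
      exact M.represents_zero hB
    · exact ⟨_, M.represents_KVec hB hB0 i, M.bracket_KMinus_KVec hB hB0 i,
        fun j => M.bracket_KVec_KVec hB hB0 j i, fun j => (M.bracket_KVec_KStar hB hB0 i j).symm,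
        fun k l h => M.bracket_KRot_KVec hB hB0 h i⟩
    · exact ⟨_, M.represents_KStar hB hB0 i, M.bracket_KMinus_KStar hB hB0 i,
        fun j => M.bracket_KVec_KStar hB hB0 j i, fun j => M.bracket_KStar_KStar hB hB0 j i,
        fun k l h => M.bracket_KRot_KStar hB hB0 h i⟩
    · exact ⟨_, M.represents_KRot hB h, M.bracket_KMinus_KRot hB hB0 h,
        fun k => (M.bracket_KRot_KVec hB hB0 h k).symm,
        fun k => (M.bracket_KRot_KStar hB hB0 h k).symm,
        fun k l h' => M.bracket_KRot_KRot hB h' h⟩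
  | zero =>
    obtain ⟨R, hR⟩ := M.exists_represents hB hB0 hX
    refine ⟨R, 0, hR, M.represents_zero hB, ?_⟩
    rw [commutator_zero_right, Matrix.mul_zero, Matrix.zero_mul, sub_zero]
    exact M.represents_zero hB
  | add Y Y' _ _ hY hY' =>
    obtain ⟨R, S, hR, hS, h⟩ := hY
    obtain ⟨R', S', hR', hS', h'⟩ := hY'
    refine ⟨R, S + S', hR, hS.add hS', ?_⟩
    rw [commutator_add_right _ hS.smooth hS'.smooth]
    refine (h.add h').congr fun ζ hζ => ?_
    simp only [Matrix.sub_mulVec, Matrix.add_mulVec, ← Matrix.mulVec_mulVec, Matrix.mulVec_add,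
      hR.mulVec_eq hR' hζ, hR.mulVec_eq hR' (hS'.compat.1 ζ hζ)]
    abel
  | smul c Y _ hY =>
    obtain ⟨R, S, hR, hS, h⟩ := hY
    refine ⟨R, c • S, hR, hS.smul c, ?_⟩
    rw [commutator_smul_right _ hS.smooth, Matrix.mul_smul, Matrix.smul_mul, ← smul_sub]
    exact h.smul c

end SpinModule

/-! ### Killing vector fields -/

theorem cwMetric_symm (B : Fin 9 → ℝ) (x : Pt) (m n : Idx) : cwMetric B x m n = cwMetric B x n m := by
  have h : flatForm m n = flatForm n m := by
    rcases m with m | m <;> rcases n with n | n <;> simp [flatForm, eq_comm]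
  simp only [cwMetric_apply, h, and_comm]

/-- The Killing equation says that `g(∇X, ·)` is antisymmetric. -/
theorem isKilling_iff (B : Fin 9 → ℝ) (X : VectorField) : IsKilling (cwMetric B) X ↔
    ∀ x m n, leviCivita (cwMetric B) X x m n + leviCivita (cwMetric B) X x n m = 0 := by
  refine forall_congr' fun x => forall_congr' fun m => forall_congr' fun n => ?_
  rw [leviCivita, leviCivita, ← Finset.sum_add_distrib]
  have h (k : Idx) : X x k * ((pd k (fun y => cwMetric B y m n) x : ℝ) : ℂ)
      + (cwMetric B x k n : ℂ) * pd m X x k + (cwMetric B x m k : ℂ) * pd n X x k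
      = ((cwMetric B x n k : ℂ) * pd m X x k + (christoffel (cwMetric B) x m k n : ℂ) * X x k)
        + ((cwMetric B x m k : ℂ) * pd n X x k + (christoffel (cwMetric B) x n k m : ℂ) * X x k) := by
    have e : christoffel (cwMetric B) x m k n + christoffel (cwMetric B) x n k m
        = pd k (fun y => cwMetric B y m n) x := by
      simp only [christoffel, cwMetric_symm B _ n k, cwMetric_symm B _ m k, cwMetric_symm B _ n m]
      ring
    rw [← e, cwMetric_symm B x k n]
    push_cast
    ring
  simp only [h]

/-- A vector field is Killing if its covariant derivative is antisymmetric in the adapted frame. -/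
theorem isKilling_of_nablaEnd {B : Fin 9 → ℝ} {X : VectorField}
    (h : ∀ x a b, nablaEnd B X x a b + nablaEnd B X x b a = 0) : IsKilling (cwMetric B) X := by
  rw [isKilling_iff]
  intro x
  set F : Idx → Idx → ℂ := fun m n =>
    leviCivita (cwMetric B) X x m n + leviCivita (cwMetric B) X x n m with hF
  have key (a b : Idx) : ∑ i, (frame B a x i : ℂ) * ∑ j, (frame B b x j : ℂ) * F i j = 0 := by
    rw [← h x a b]
    simp only [nablaEnd, Matrix.of_apply, hF]
    rw [Finset.sum_comm (γ := Idx) (f := fun i j => (frame B b x i : ℂ) * (frame B a x j : ℂ) *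
      leviCivita (cwMetric B) X x j i), ← Finset.sum_add_distrib]
    refine Finset.sum_congr rfl fun i _ => ?_
    rw [Finset.mul_sum, ← Finset.sum_add_distrib]
    exact Finset.sum_congr rfl fun j _ => by ring
  simp only [sum_frame_mul] at key
  have hp : F plus plus = 0 := by simpa using key plus plus
  have hp1 (a : Idx) : F a plus = 0 := by simpa [hp] using key a plus
  have hp2 (a : Idx) : F plus a = 0 := by simpa [hp] using key plus a
  intro m n
  simpa [hp1, hp2] using key m n

theorem IsKilling.add {B : Fin 9 → ℝ} {X Y : VectorField} (sX : ContDiff ℝ ∞ X)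
    (sY : ContDiff ℝ ∞ Y) (hX : IsKilling (cwMetric B) X) (hY : IsKilling (cwMetric B) Y) :
    IsKilling (cwMetric B) (X + Y) := by
  rw [isKilling_iff] at *
  intro x m n
  rw [leviCivita_add B sX sY, leviCivita_add B sX sY]
  linear_combination hX x m n + hY x m n

theorem IsKilling.smul {B : Fin 9 → ℝ} {X : VectorField} (sX : ContDiff ℝ ∞ X)
    (hX : IsKilling (cwMetric B) X) (c : ℂ) : IsKilling (cwMetric B) (c • X) := by
  rw [isKilling_iff] at *
  intro x m n
  rw [leviCivita_smul B sX, leviCivita_smul B sX]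
  linear_combination c * hX x m n

theorem nullRot_antisymm (a : Fin 9 → ℂ) (m n : Idx) : nullRot a m n + nullRot a n m = 0 := by
  rw [nullRot_apply, nullRot_apply]; ring

theorem smooth_and_isKilling {p : Params} {B : Fin 9 → ℝ} (hB : ∀ i, (B i : ℂ) = -(p.μ i) ^ 2)
    {X : VectorField} (hX : X ∈ killingAlgebra p) :
    ContDiff ℝ ∞ X ∧ IsKilling (cwMetric B) X := by
  induction hX using Submodule.span_induction with
  | mem X hX =>
    rcases hX with (((rfl | rfl) | ⟨i, rfl⟩) | ⟨i, rfl⟩) | ⟨i, j, h, rfl⟩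
    · exact ⟨contDiff_KPlus, isKilling_of_nablaEnd fun x a b => by simp [nablaEnd_KPlus]⟩
    · exact ⟨contDiff_KMinus, isKilling_of_nablaEnd fun x a b => by
        rw [nablaEnd_KMinus, nullRot_antisymm]⟩
    · exact ⟨contDiff_KVec p i, isKilling_of_nablaEnd fun x a b => by
        rw [nablaEnd_KVec _ _ hB, nullRot_antisymm]⟩
    · exact ⟨contDiff_KStar p i, isKilling_of_nablaEnd fun x a b => by
        rw [nablaEnd_KStar _ _ hB, nullRot_antisymm]⟩
    · refine ⟨contDiff_KRot i j, isKilling_of_nablaEnd fun x a b => ?_⟩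
      rw [nablaEnd_KRot _ (B_eq_of_block hB h)]
      simp only [Matrix.sub_apply, Matrix.single_apply]
      simp only [and_comm (a := Sum.inr j = b), and_comm (a := Sum.inr i = b)]
      ring
  | zero => exact ⟨contDiff_const, fun x m n => by
      have (k : Idx) : pd k (0 : VectorField) x = 0 := pd_const k 0 x
      simp [this]⟩
  | add X Y _ _ hX hY => exact ⟨hX.1.add hY.1, hX.2.add hX.1 hY.1 hY.2⟩
  | smul c X _ hX => exact ⟨contDiff_const.smul hX.1, hX.2.smul hX.1 c⟩

/-! ### Complex conjugation -/

section Conj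

open Complex

variable {p : Params} {B : Fin 9 → ℝ}

/-- `λᵢ` is real or purely imaginary, because its square `Bᵢ` is real. -/
theorem conj_lam (hB : ∀ i, (B i : ℂ) = -(p.μ i) ^ 2) (i : Fin 9) :
    (starRingEnd ℂ) (p.lam i) = p.lam i ∨ (starRingEnd ℂ) (p.lam i) = -p.lam i := by
  refine sq_eq_sq_iff_eq_or_eq_neg.1 ?_
  rw [← map_pow, lam_sq hB, conj_ofReal]

theorem conj_cos_lam (hB : ∀ i, (B i : ℂ) = -(p.μ i) ^ 2) (i : Fin 9) (t : ℝ) :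
    (starRingEnd ℂ) (cos (p.lam i * t)) = cos (p.lam i * t) := by
  rw [← cos_conj, map_mul, conj_ofReal]
  rcases conj_lam hB i with h | h <;> rw [h]
  rw [neg_mul, cos_neg]

theorem conj_lam_sin (hB : ∀ i, (B i : ℂ) = -(p.μ i) ^ 2) (i : Fin 9) (t : ℝ) :
    (starRingEnd ℂ) (p.lam i) * (starRingEnd ℂ) (sin (p.lam i * t))
      = p.lam i * sin (p.lam i * t) := by
  rw [← sin_conj, map_mul, conj_ofReal]
  rcases conj_lam hB i with h | h <;> rw [h]
  rw [neg_mul (p.lam i) (t : ℂ), sin_neg, neg_mul_neg]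

theorem star_coordField (m : Idx) : star (coordField m) = coordField m := by
  ext x n
  by_cases h : n = m <;> simp [coordField, h]

/-- The generators are real, because `cos (λᵢ t)` and `λᵢ sin (λᵢ t)` are even functions of `λᵢ`. -/
theorem star_mem_killingAlgebra (hB : ∀ i, (B i : ℂ) = -(p.μ i) ^ 2) {X : VectorField}
    (hX : X ∈ killingAlgebra p) : star X ∈ killingAlgebra p := by
  have hc (m n : Idx) (x : Pt) : (starRingEnd ℂ) (coordField m x n) = coordField m x n :=
    congrFun (congrFun (star_coordField m) x) n
  induction hX using Submodule.span_induction with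
  | mem X hX =>
    have : star X = X := by
      rcases hX with (((rfl | rfl) | ⟨i, rfl⟩) | ⟨i, rfl⟩) | ⟨i, j, h, rfl⟩
      · exact star_coordField plus
      · exact star_coordField minus
      · ext x n
        simp [KVec, hc, conj_cos_lam hB, conj_lam_sin hB]
      · ext x n
        simp [KStar, hc, conj_cos_lam hB, conj_lam_sin hB, lam_sq hB]
      · ext x n
        simp [KRot, hc]
    rw [this]
    exact Submodule.subset_span hX
  | zero => rw [star_zero]; exact zero_mem _
  | add X Y _ _ hX hY => rw [star_add]; exact add_mem hX hY
  | smul c X _ hX => rw [star_smul]; exact Submodule.smul_mem _ _ hX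

end Conj

/-! ### The Killing equations -/

/-- The Killing equations for the field `u ∂₊ + f ∂₋ + ∑ vₖ ∂ₖ`. Each field is named after a
derivative that it expresses. -/
structure KillingSystem (B : Fin 9 → ℝ) (u f : Pt → ℂ) (v : Fin 9 → Pt → ℂ) : Prop where
  smooth_u : ContDiff ℝ ∞ u
  smooth_f : ContDiff ℝ ∞ f
  smooth_v : ∀ k, ContDiff ℝ ∞ (v k)
  plus_f : ∀ x, pd plus f x = 0
  plus_u : ∀ x, pd plus u x = -pd minus f x
  plus_v : ∀ k x, pd plus (v k) x = -pd (Sum.inr k) f x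
  minus_u : ∀ x, pd minus u x
    = (quad B x : ℂ) * pd minus f x + ∑ k, (B k * x (Sum.inr k) : ℂ) * v k x
  minus_v : ∀ k x, pd minus (v k) x
    = (quad B x : ℂ) * pd (Sum.inr k) f x - pd (Sum.inr k) u x
  inr_v : ∀ j k x, pd (Sum.inr j) (v k) x = -pd (Sum.inr k) (v j) x

theorem IsKilling.system {B : Fin 9 → ℝ} {X : VectorField} (hX : IsKilling (cwMetric B) X)
    (sX : ContDiff ℝ ∞ X) :
    KillingSystem B (fun x => X x plus) (fun x => X x minus) (fun k x => X x (Sum.inr k)) := by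
  rw [isKilling_iff] at hX
  have s (a : Idx) : ContDiff ℝ ∞ fun x => X x a := contDiff_pi.1 sX a
  have d (m a : Idx) (x : Pt) : pd m (fun y => X y a) x = pd m X x a := pd_apply m (sX.diffAt x) a
  have f0 (x : Pt) : pd plus X x minus = 0 := by
    have := hX x plus plus
    rw [leviCivita_plus] at this
    linear_combination this / 2
  refine ⟨s _, s _, fun _ => s _, fun x => ?_, fun x => ?_, fun k x => ?_, fun x => ?_,
    fun k x => ?_, fun j k x => ?_⟩ <;> simp only [d]
  · exact f0 x
  · have := hX x plus minus
    rw [leviCivita_plus, leviCivita_minus, f0, pd_quad_inl, if_neg (by simp)] at this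
    push_cast at this
    linear_combination this
  · have := hX x plus (Sum.inr k)
    rw [leviCivita_plus, leviCivita_inr, if_neg (by simp)] at this
    linear_combination this
  · have := hX x minus minus
    rw [leviCivita_minus, pd_quad_inl, if_pos rfl] at this
    push_cast at this
    linear_combination this / 2
  · have := hX x minus (Sum.inr k)
    rw [leviCivita_minus, leviCivita_inr, if_pos rfl, if_neg (by simp), pd_quad_inr] at this
    push_cast at this
    linear_combination this
  · have := hX x (Sum.inr j) (Sum.inr k)
    rw [leviCivita_inr, leviCivita_inr, if_neg (by simp), if_neg (by simp)] at this
    linear_combination this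

/-- The derivative of `∑ Bₖ xᵏ gₖ`. -/
theorem pd_sum_coord_mul (B : Fin 9 → ℝ) {g : Fin 9 → Pt → ℂ} (hg : ∀ k, ContDiff ℝ ∞ (g k))
    (m : Idx) (x : Pt) : pd m (fun y => ∑ k, (B k * y (Sum.inr k) : ℂ) * g k y) x
      = ∑ k, (B k * x (Sum.inr k) : ℂ) * pd m (g k) x
        + ∑ k, if m = Sum.inr k then (B k : ℂ) * g k x else 0 := by
  have hc (k : Fin 9) : ContDiff ℝ ∞ fun y : Pt => (B k * y (Sum.inr k) : ℂ) :=
    contDiff_const.mul (coe_coord_contDiff _)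
  rw [pd_sum m Finset.univ (f := fun k y => (B k * y (Sum.inr k) : ℂ) * g k y)
    fun k _ => ((hc k).mul (hg k)).diffAt x, ← Finset.sum_add_distrib]
  refine Finset.sum_congr rfl fun k _ => ?_
  rw [pd_mul m ((hc k).diffAt x) ((hg k).diffAt x), pd_mul m (contDiff_const.diffAt x)
    ((coe_coord_contDiff _).diffAt x), pd_const, pd_coord_ofReal]
  split_ifs <;> ring

theorem contDiff_quad (B : Fin 9 → ℝ) : ContDiff ℝ ∞ fun x => (quad B x : ℂ) := by
  have h : ContDiff ℝ ∞ (quad B) := by unfold quad; fun_prop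
  exact Complex.ofRealCLM.contDiff.comp h

theorem pd_quad_mul (B : Fin 9 → ℝ) {g : Pt → ℂ} (hg : ContDiff ℝ ∞ g) (m : Idx) (x : Pt) :
    pd m (fun y => (quad B y : ℂ) * g y) x
      = (quad B x : ℂ) * pd m g x + ((pd m (quad B) x : ℝ) : ℂ) * g x := by
  rw [pd_mul m ((contDiff_quad B).diffAt x) (hg.diffAt x)]
  congr 2
  exact pd_clm m Complex.ofRealCLM ((differentiable_quad B) x)

namespace KillingSystem

variable {B : Fin 9 → ℝ} {u f : Pt → ℂ} {v : Fin 9 → Pt → ℂ}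

/-- The left hand side is symmetric in `j` and `k`; it equals `-∂₊ ∂ⱼ vₖ`, which is
antisymmetric. -/
theorem inr_inr_f (h : KillingSystem B u f v) (j k : Fin 9) (x : Pt) :
    pd (Sum.inr j) (pd (Sum.inr k) f) x = 0 := by
  have e (k : Fin 9) : pd plus (v k) = fun x => -pd (Sum.inr k) f x := funext (h.plus_v k)
  have e' (j k : Fin 9) : pd (Sum.inr j) (v k) = fun x => -pd (Sum.inr k) (v j) x :=
    funext (h.inr_v j k)
  have key (j k : Fin 9) :
      pd (Sum.inr j) (pd (Sum.inr k) f) x = -pd plus (pd (Sum.inr j) (v k)) x := by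
    rw [pd_comm _ (h.smooth_v k), e, pd_neg, neg_neg]
  have h1 := key j k
  have h2 := key k j
  rw [e', pd_neg] at h1
  rw [pd_comm _ h.smooth_f] at h2
  linear_combination (h1 + h2) / 2

/-- From `∂₊ ∂₋ vₖ = ∂₋ ∂₊ vₖ`. -/
theorem minus_inr_f (h : KillingSystem B u f v) (k : Fin 9) (x : Pt) :
    pd minus (pd (Sum.inr k) f) x = 0 := by
  have e : pd minus (v k) = fun x => (quad B x : ℂ) * pd (Sum.inr k) f x - pd (Sum.inr k) u x :=
    funext (h.minus_v k)
  have e1 : pd plus (v k) = fun x => -pd (Sum.inr k) f x := funext (h.plus_v k)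
  have e2 : pd plus u = fun x => -pd minus f x := funext h.plus_u
  have e3 : pd plus f = fun _ => 0 := funext h.plus_f
  have sf := contDiff_pd (Sum.inr k) h.smooth_f
  have h1 := pd_comm plus (h.smooth_v k) minus x
  rw [e, e1, pd_sub _ (((contDiff_quad B).mul sf).diffAt x)
    ((contDiff_pd _ h.smooth_u).diffAt x), pd_quad_mul B sf, pd_comm plus h.smooth_f, e3, pd_const,
    pd_quad_inl, pd_comm plus h.smooth_u, e2, pd_neg, pd_neg,
    pd_comm (Sum.inr k) h.smooth_f] at h1
  push_cast at h1
  linear_combination h1 / 2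

/-- The relation `∂₊ ∂₋ u = ∂₋ ∂₊ u` gives `∂₋ ∂₋ f = ∑ Bₖ xᵏ ∂ₖ f`. Under `∂ₖ` the left hand side
vanishes by `minus_inr_f`, and the right hand side becomes `Bₖ ∂ₖ f`. -/
theorem inr_f (h : KillingSystem B u f v) (hB0 : ∀ i, B i ≠ 0) (k : Fin 9) (x : Pt) :
    pd (Sum.inr k) f x = 0 := by
  have e : pd minus u = fun x =>
    (quad B x : ℂ) * pd minus f x + ∑ k, (B k * x (Sum.inr k) : ℂ) * v k x := funext h.minus_u
  have e1 (k : Fin 9) : pd plus (v k) = fun x => -pd (Sum.inr k) f x := funext (h.plus_v k)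
  have e2 : pd plus u = fun x => -pd minus f x := funext h.plus_u
  have e3 : pd plus f = fun _ => 0 := funext h.plus_f
  have e4 : pd minus (pd (Sum.inr k) f) = fun _ => 0 := funext (h.minus_inr_f k)
  have sf (m : Idx) := contDiff_pd m h.smooth_f
  have ss : ContDiff ℝ ∞ fun x : Pt => ∑ k, (B k * x (Sum.inr k) : ℂ) * v k x :=
    ContDiff.sum fun k _ => (contDiff_const.mul (coe_coord_contDiff _)).mul (h.smooth_v k)
  have h1 : pd minus (pd minus f)
      = fun y => ∑ k, (B k * y (Sum.inr k) : ℂ) * pd (Sum.inr k) f y := by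
    ext y
    have h1 := pd_comm plus h.smooth_u minus y
    rw [e, e2, pd_add _ (((contDiff_quad B).mul (sf _)).diffAt y) (ss.diffAt y),
      pd_quad_mul B (sf _), pd_comm plus h.smooth_f, e3, pd_const, pd_quad_inl, pd_neg,
      pd_sum_coord_mul B h.smooth_v] at h1
    simp only [h.plus_v, mul_neg, Finset.sum_neg_distrib, reduceCtorEq, if_false,
      Finset.sum_const_zero] at h1
    push_cast at h1
    linear_combination h1
  have h2 : pd (Sum.inr k) (pd minus (pd minus f)) x = 0 := by
    rw [pd_comm _ (sf minus), show pd (Sum.inr k) (pd minus f) = fun _ => 0 from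
      funext fun y => by rw [pd_comm _ h.smooth_f, e4], pd_const]
  rw [h1, pd_sum_coord_mul B fun k => sf (Sum.inr k)] at h2
  simp only [h.inr_inr_f, mul_zero, Finset.sum_const_zero, zero_add, Sum.inr.injEq,
    Finset.sum_ite_eq, Finset.mem_univ, if_true, mul_eq_zero, Complex.ofReal_eq_zero, hB0,
    false_or] at h2
  exact h2

/-- The equation `plus_v`, simplified by `inr_f`. -/
theorem plus_v' (h : KillingSystem B u f v) (hB0 : ∀ i, B i ≠ 0) (k : Fin 9) (x : Pt) :
    pd plus (v k) x = 0 := by rw [h.plus_v, h.inr_f hB0, neg_zero]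

/-- The equation `minus_v`, simplified by `inr_f`. -/
theorem minus_v' (h : KillingSystem B u f v) (hB0 : ∀ i, B i ≠ 0) (k : Fin 9) (x : Pt) :
    pd minus (v k) x = -pd (Sum.inr k) u x := by rw [h.minus_v, h.inr_f hB0, mul_zero, zero_sub]

/-- The expression is symmetric in `i`, `j` and antisymmetric in `j`, `k`. -/
theorem inr_inr_v (h : KillingSystem B u f v) (i j k : Fin 9) (x : Pt) :
    pd (Sum.inr i) (pd (Sum.inr j) (v k)) x = 0 := by
  have a (i j k : Fin 9) : pd (Sum.inr i) (pd (Sum.inr j) (v k)) x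
      = -pd (Sum.inr i) (pd (Sum.inr k) (v j)) x := by
    rw [show pd (Sum.inr j) (v k) = fun x => -pd (Sum.inr k) (v j) x from funext (h.inr_v j k),
      pd_neg]
  have s (i j k : Fin 9) := pd_comm (Sum.inr i) (h.smooth_v k) (Sum.inr j) x
  linear_combination (a i j k - s i k j + (-1) * a k i j + s k j i + a j k i + s i j k) / 2

/-- The expression is symmetric in `j` and `k`; it equals `-∂₋ ∂ⱼ vₖ`, which is antisymmetric. -/
theorem inr_inr_u (h : KillingSystem B u f v) (hB0 : ∀ i, B i ≠ 0) (j k : Fin 9) (x : Pt) :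
    pd (Sum.inr j) (pd (Sum.inr k) u) x = 0 := by
  have key (j k : Fin 9) : pd minus (pd (Sum.inr j) (v k)) x
      = -pd (Sum.inr j) (pd (Sum.inr k) u) x := by
    rw [pd_comm _ (h.smooth_v k), show pd minus (v k) = fun x => -pd (Sum.inr k) u x from
      funext (h.minus_v' hB0 k), pd_neg]
  have h1 := key j k
  have h2 := key k j
  rw [show pd (Sum.inr j) (v k) = fun x => -pd (Sum.inr k) (v j) x from funext (h.inr_v j k),
    pd_neg] at h1
  rw [pd_comm (Sum.inr k) h.smooth_u] at h2
  linear_combination (h1 + h2) / 2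

theorem minus_inr_v (h : KillingSystem B u f v) (hB0 : ∀ i, B i ≠ 0) (j k : Fin 9) (x : Pt) :
    pd minus (pd (Sum.inr j) (v k)) x = 0 := by
  rw [pd_comm _ (h.smooth_v k), show pd minus (v k) = fun x => -pd (Sum.inr k) u x from
      funext (h.minus_v' hB0 k), pd_neg, h.inr_inr_u hB0, neg_zero]

theorem minus_minus_v (h : KillingSystem B u f v) (hB0 : ∀ i, B i ≠ 0) (k : Fin 9) (x : Pt) :
    pd minus (pd minus (v k)) x = -(2 * (B k * x (Sum.inr k)) * pd minus f x + B k * v k x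
      + ∑ l, (B l * x (Sum.inr l) : ℂ) * pd (Sum.inr k) (v l) x) := by
  have ss : ContDiff ℝ ∞ fun x : Pt => ∑ k, (B k * x (Sum.inr k) : ℂ) * v k x :=
    ContDiff.sum fun k _ => (contDiff_const.mul (coe_coord_contDiff _)).mul (h.smooth_v k)
  have sf := contDiff_pd minus h.smooth_f
  rw [show pd minus (v k) = fun x => -pd (Sum.inr k) u x from funext (h.minus_v' hB0 k), pd_neg,
    pd_comm _ h.smooth_u, show pd minus u = fun x => (quad B x : ℂ) * pd minus f x
      + ∑ k, (B k * x (Sum.inr k) : ℂ) * v k x from funext h.minus_u,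
    pd_add _ (((contDiff_quad B).mul sf).diffAt x) (ss.diffAt x), pd_quad_mul B sf,
    pd_comm _ h.smooth_f, h.minus_inr_f, pd_sum_coord_mul B h.smooth_v, pd_quad_inr]
  simp only [Sum.inr.injEq, Finset.sum_ite_eq, Finset.mem_univ, if_true]
  push_cast
  ring

/-- The third derivatives `∂ⱼ ∂₋ ∂₋ vₖ` vanish; by `minus_minus_v`, this is an algebraic
constraint. -/
theorem constraint (h : KillingSystem B u f v) (hB0 : ∀ i, B i ≠ 0) (j k : Fin 9) (x : Pt) :
    (if j = k then 2 * B k * pd minus f x else 0) + B k * pd (Sum.inr j) (v k) x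
      + B j * pd (Sum.inr k) (v j) x = 0 := by
  have sf := contDiff_pd minus h.smooth_f
  have sv (m : Idx) (k : Fin 9) := contDiff_pd m (h.smooth_v k)
  have h1 : pd (Sum.inr j) (pd minus (pd minus (v k))) x = 0 := by
    rw [pd_comm _ (sv minus k), show pd (Sum.inr j) (pd minus (v k)) = fun _ => 0 from
      funext fun y => by rw [pd_comm _ (h.smooth_v k), h.minus_inr_v hB0], pd_const]
  have c1 : ContDiff ℝ ∞ fun x : Pt => 2 * (B k * x (Sum.inr k) : ℂ) :=
    contDiff_const.mul (contDiff_const.mul (coe_coord_contDiff _))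
  have c2 : ContDiff ℝ ∞ fun x : Pt => (B k : ℂ) * v k x := contDiff_const.mul (h.smooth_v k)
  have c3 : ContDiff ℝ ∞ fun x : Pt => ∑ l, (B l * x (Sum.inr l) : ℂ) * pd (Sum.inr k) (v l) x :=
    ContDiff.sum fun l _ => (contDiff_const.mul (coe_coord_contDiff _)).mul (sv _ l)
  rw [show pd minus (pd minus (v k)) = _ from funext (h.minus_minus_v hB0 k), pd_neg,
    pd_add _ (((c1.mul sf).add c2).diffAt x) (c3.diffAt x),
    pd_add _ ((c1.mul sf).diffAt x) (c2.diffAt x), pd_mul _ (c1.diffAt x) (sf.diffAt x),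
    pd_mul _ (contDiff_const.diffAt x) ((contDiff_const.mul (coe_coord_contDiff _)).diffAt x),
    pd_mul _ (contDiff_const.diffAt x) ((coe_coord_contDiff _).diffAt x),
    pd_mul _ (contDiff_const.diffAt x) ((h.smooth_v k).diffAt x),
    pd_sum_coord_mul B fun l => sv _ l, pd_coord_ofReal, pd_comm _ h.smooth_f, h.minus_inr_f] at h1
  simp only [pd_const, h.inr_inr_v, Sum.inr.injEq, Finset.sum_ite_eq, Finset.mem_univ, if_true,
    mul_zero, Finset.sum_const_zero] at h1
  split_ifs at h1 ⊢ <;> linear_combination -h1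

/-- The case `j = k` of `constraint`. -/
theorem minus_f (h : KillingSystem B u f v) (hB0 : ∀ i, B i ≠ 0) (x : Pt) :
    pd minus f x = 0 := by
  have h1 := h.constraint hB0 0 0 x
  have h2 := h.inr_v 0 0 x
  have h3 : (B 0 : ℂ) ≠ 0 := by exact_mod_cast hB0 0
  rw [if_pos rfl] at h1
  refine (mul_eq_zero.1 ?_).resolve_left h3
  linear_combination h1 / 2 - B 0 * h2 / 2

/-- The case `j ≠ k` of `constraint`, combined with the antisymmetry of `∂ⱼ vₖ`. -/
theorem inr_v_eq_zero (h : KillingSystem B u f v) (hB0 : ∀ i, B i ≠ 0) {j k : Fin 9}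
    (hjk : B j ≠ B k) (x : Pt) : pd (Sum.inr j) (v k) x = 0 := by
  have h1 := h.constraint hB0 j k x
  have h2 := h.inr_v j k x
  have h3 : (B k - B j : ℂ) ≠ 0 := by
    rw [sub_ne_zero]; exact_mod_cast hjk.symm
  rw [if_neg (by rintro rfl; exact hjk rfl)] at h1
  refine (mul_eq_zero.1 ?_).resolve_left h3
  linear_combination h1 - B j * h2

/-- A solution of the Killing equations vanishes if its components, and the derivatives of `v` in
the directions `∂₋` and `∂ⱼ`, vanish at the origin. -/
theorem eq_zero (h : KillingSystem B u f v) (hB0 : ∀ i, B i ≠ 0) (hu : u 0 = 0) (hf : f 0 = 0)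
    (hv : ∀ k, v k 0 = 0) (hmv : ∀ k, pd minus (v k) 0 = 0)
    (hjv : ∀ j k, pd (Sum.inr j) (v k) 0 = 0) : u = 0 ∧ f = 0 ∧ ∀ k, v k = 0 := by
  have diff {g : Pt → ℂ} (hg : ContDiff ℝ ∞ g) : Differentiable ℝ g := fun x => hg.diffAt x
  have const {g : Pt → ℂ} (hg : ContDiff ℝ ∞ g) (h0 : g 0 = 0) (h1 : ∀ x, pd plus g x = 0)
      (h2 : ∀ x, pd minus g x = 0) (h3 : ∀ j x, pd (Sum.inr j) g x = 0) (x : Pt) : g x = 0 := by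
    refine (eq_of_pd_eq_zero (diff hg) (fun m x => ?_) x 0).trans h0
    rcases m with m | m
    · fin_cases m
      · exact h1 x
      · exact h2 x
    · exact h3 m x
  have f0 := const h.smooth_f hf h.plus_f (h.minus_f hB0) (h.inr_f hB0)
  have jv (j k : Fin 9) : ∀ x, pd (Sum.inr j) (v k) x = 0 :=
    const (contDiff_pd _ (h.smooth_v k)) (hjv j k)
      (fun x => by rw [pd_comm _ (h.smooth_v k), show pd plus (v k) = fun _ => 0 from
        funext (h.plus_v' hB0 k), pd_const]) (h.minus_inr_v hB0 j k) fun i => h.inr_inr_v i j k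
  have v0 (k : Fin 9) : ∀ x, v k x = 0 := by
    -- `v k` is a function of `x⁻` with `v'' = -Bₖ v`; `P` and `Q` are first integrals
    obtain ⟨l, hl⟩ : ∃ l : ℂ, l ^ 2 = B k := IsAlgClosed.exists_pow_nat_eq _ two_pos
    have hl0 : l ≠ 0 := by rintro rfl; apply hB0 k; simpa using hl.symm
    have sv := h.smooth_v k
    have sv' := contDiff_pd minus sv
    have sc := contDiff_cos_lam l minus
    have ss := contDiff_sin_lam l minus
    have pc (m : Idx) (x : Pt) : pd m (fun y => Complex.cos (l * y minus)) x
        = if m = minus then -(l * Complex.sin (l * x minus)) else 0 :=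
      pd_comp_coord m minus (hasDerivAt_cos_lam l (x minus))
    have ps (m : Idx) (x : Pt) : pd m (fun y => Complex.sin (l * y minus)) x
        = if m = minus then l * Complex.cos (l * x minus) else 0 :=
      pd_comp_coord m minus (hasDerivAt_sin_lam l (x minus))
    have vv (x : Pt) : pd minus (pd minus (v k)) x = -(l ^ 2 * v k x) := by
      rw [h.minus_minus_v hB0, hl, h.minus_f hB0]
      simp only [jv, mul_zero, Finset.sum_const_zero]
      ring
    have pv (x : Pt) : pd plus (pd minus (v k)) x = 0 := by
      rw [pd_comm _ sv, show pd plus (v k) = fun _ => 0 from funext (h.plus_v' hB0 k), pd_const]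
    have jvv (j : Fin 9) (x : Pt) : pd (Sum.inr j) (pd minus (v k)) x = 0 := by
      rw [pd_comm _ sv, h.minus_inr_v hB0]
    have sP : ContDiff ℝ ∞ fun x : Pt => pd minus (v k) x * Complex.cos (l * x minus)
      + (l * v k x) * Complex.sin (l * x minus) :=
      (sv'.mul sc).add ((contDiff_const.mul sv).mul ss)
    have sQ : ContDiff ℝ ∞ fun x : Pt => pd minus (v k) x * Complex.sin (l * x minus)
      - (l * v k x) * Complex.cos (l * x minus) :=
      (sv'.mul ss).sub ((contDiff_const.mul sv).mul sc)
    have dP (m : Idx) (x : Pt) : pd m (fun x : Pt => pd minus (v k) x * Complex.cos (l * x minus)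
        + (l * v k x) * Complex.sin (l * x minus)) x
        = (pd m (pd minus (v k)) x + if m = minus then l ^ 2 * v k x else 0)
            * Complex.cos (l * x minus)
          + l * (pd m (v k) x - if m = minus then pd minus (v k) x else 0)
            * Complex.sin (l * x minus) := by
      rw [pd_add _ ((sv'.mul sc).diffAt x) (((contDiff_const.mul sv).mul ss).diffAt x),
        pd_mul _ (sv'.diffAt x) (sc.diffAt x),
        pd_mul _ ((contDiff_const.mul sv).diffAt x) (ss.diffAt x),
        pd_mul _ (contDiff_const.diffAt x) (sv.diffAt x), pd_const, pc, ps]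
      split_ifs <;> ring
    have dQ (m : Idx) (x : Pt) : pd m (fun x : Pt => pd minus (v k) x * Complex.sin (l * x minus)
        - (l * v k x) * Complex.cos (l * x minus)) x
        = (pd m (pd minus (v k)) x + if m = minus then l ^ 2 * v k x else 0)
            * Complex.sin (l * x minus)
          - l * (pd m (v k) x - if m = minus then pd minus (v k) x else 0)
            * Complex.cos (l * x minus) := by
      rw [pd_sub _ ((sv'.mul ss).diffAt x) (((contDiff_const.mul sv).mul sc).diffAt x),
        pd_mul _ (sv'.diffAt x) (ss.diffAt x),
        pd_mul _ ((contDiff_const.mul sv).diffAt x) (sc.diffAt x),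
        pd_mul _ (contDiff_const.diffAt x) (sv.diffAt x), pd_const, pc, ps]
      split_ifs <;> ring
    have P0 := const sP (by simp [hmv, hv]) (fun x => by simp [dP, pv, h.plus_v' hB0])
      (fun x => by simp [dP, vv]) (fun j x => by simp [dP, jvv, jv])
    have Q0 := const sQ (by simp [hmv, hv]) (fun x => by simp [dQ, pv, h.plus_v' hB0])
      (fun x => by simp [dQ, vv]) (fun j x => by simp [dQ, jvv, jv])
    intro x
    refine (mul_eq_zero.1 ?_).resolve_left hl0
    linear_combination Complex.sin (l * x minus) * P0 x - Complex.cos (l * x minus) * Q0 x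
      - l * v k x * Complex.sin_sq_add_cos_sq (l * x minus)
  have mv (k : Fin 9) (x : Pt) : pd minus (v k) x = 0 := by
    rw [show v k = fun _ => 0 from funext (v0 k), pd_const]
  have u0 := const h.smooth_u hu (fun x => by rw [h.plus_u, h.minus_f hB0, neg_zero])
    (fun x => by rw [h.minus_u, h.minus_f hB0]; simp [v0])
    (fun j x => by rw [← neg_eq_zero, ← h.minus_v' hB0, mv])
  exact ⟨funext u0, funext f0, fun k => funext (v0 k)⟩

end KillingSystem

/-! ### Classification of the Killing vector fields -/

theorem pd_fieldAdd {X Y : VectorField} (hX : ContDiff ℝ ∞ X) (hY : ContDiff ℝ ∞ Y) (m : Idx)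
    (x : Pt) : pd m (X + Y) x = pd m X x + pd m Y x := pd_add m (hX.diffAt x) (hY.diffAt x)

theorem pd_fieldSmul {X : VectorField} (hX : ContDiff ℝ ∞ X) (c : ℂ) (m : Idx)
    (x : Pt) : pd m (c • X) x = c • pd m X x := pd_const_smul m c (hX.diffAt x)

theorem pd_fieldSum {ι : Type*} (s : Finset ι) {Y : ι → VectorField}
    (hY : ∀ i ∈ s, ContDiff ℝ ∞ (Y i)) (m : Idx) (x : Pt) :
    pd m (∑ i ∈ s, Y i) x = ∑ i ∈ s, pd m (Y i) x := by
  rw [← pd_sum m s fun i hi => (hY i hi).diffAt x]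
  congr 1
  ext y : 1
  simp

/-- The difference of `X` and the element of the even part with the same 1-jet at the origin is a
Killing vector field that vanishes by `KillingSystem.eq_zero`. The block condition enters through
`KillingSystem.inr_v_eq_zero`: only rotations within blocks are needed. -/
theorem IsKilling.mem_killingAlgebra {p : Params} {B : Fin 9 → ℝ}
    (hB : ∀ i, (B i : ℂ) = -(p.μ i) ^ 2) (hB0 : ∀ i, B i ≠ 0)
    (hblock : ∀ i j, B i = B j → block i = block j) {X : VectorField} (sX : ContDiff ℝ ∞ X)
    (hX : IsKilling (cwMetric B) X) : X ∈ killingAlgebra p := by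
  have hs := hX.system sX
  have d {X : VectorField} (sX : ContDiff ℝ ∞ X) (m a : Idx) (x : Pt) :
      pd m (fun y => X y a) x = pd m X x a := pd_apply m (sX.diffAt x) a
  set A : Fin 9 → Fin 9 → ℂ := fun i j => pd (Sum.inr j) X 0 (Sum.inr i) with hA
  have A_symm (i j : Fin 9) : A i j = -A j i := by
    have := hs.inr_v j i 0
    rwa [d sX, d sX] at this
  have A_block {i j : Fin 9} (h : block i ≠ block j) : A i j = 0 := by
    have := hs.inr_v_eq_zero hB0 (fun e => h (hblock j i e).symm) 0
    rwa [d sX] at this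
  -- the element of the even part with the same initial data at the origin
  set T1 : VectorField := X 0 plus • KPlus with hT1
  set T2 : VectorField := X 0 minus • KMinus with hT2
  set T3 : VectorField := ∑ k, X 0 (Sum.inr k) • KVec p k with hT3
  set T4 : VectorField := ∑ k, (pd minus X 0 (Sum.inr k) / B k) • KStar p k with hT4
  set T5 : VectorField := (1 / 2 : ℂ) • ∑ i, ∑ j, A i j • KRot i j with hT5
  have c {Y : VectorField} (hY : ContDiff ℝ ∞ Y) (a : ℂ) : ContDiff ℝ ∞ (a • Y) :=
    contDiff_const.smul hY
  have a {Y Z : VectorField} (hY : ContDiff ℝ ∞ Y) (hZ : ContDiff ℝ ∞ Z) :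
      ContDiff ℝ ∞ (Y + Z) := hY.add hZ
  have s1 : ContDiff ℝ ∞ T1 := c contDiff_KPlus _
  have s2 : ContDiff ℝ ∞ T2 := c contDiff_KMinus _
  have s3' (k : Fin 9) := c (contDiff_KVec p k) (X 0 (Sum.inr k))
  have s4' (k : Fin 9) := c (contDiff_KStar p k) (pd minus X 0 (Sum.inr k) / B k)
  have s5' (i j : Fin 9) := c (contDiff_KRot i j) (A i j)
  have s5'' (i : Fin 9) := contDiff_fieldSum Finset.univ (fun j _ => s5' i j)
  have s5''' := contDiff_fieldSum Finset.univ (fun i _ => s5'' i)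
  have s3 : ContDiff ℝ ∞ T3 := contDiff_fieldSum _ fun k _ => s3' k
  have s4 : ContDiff ℝ ∞ T4 := contDiff_fieldSum _ fun k _ => s4' k
  have s5 : ContDiff ℝ ∞ T5 := c s5''' _
  have mem {X : VectorField} (h : X ∈ ({KPlus, KMinus} ∪ Set.range (KVec p) ∪ Set.range (KStar p)
    ∪ {X | ∃ i j, block i = block j ∧ X = KRot i j} : Set VectorField)) : X ∈ killingAlgebra p :=
    Submodule.subset_span h
  set T : VectorField := T1 + T2 + T3 + T4 + T5 with hT
  have hTmem : T ∈ killingAlgebra p := by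
    refine add_mem (add_mem (add_mem (add_mem ?_ ?_) ?_) ?_) ?_
    · exact Submodule.smul_mem _ _ (mem (by simp))
    · exact Submodule.smul_mem _ _ (mem (by simp))
    · exact sum_mem fun i _ => Submodule.smul_mem _ _ (mem (by simp))
    · exact sum_mem fun i _ => Submodule.smul_mem _ _ (mem (by simp))
    · refine Submodule.smul_mem _ _ (sum_mem fun i _ => sum_mem fun j _ => ?_)
      by_cases h : block i = block j
      · exact Submodule.smul_mem _ _ (mem (Or.inr ⟨i, j, h, rfl⟩))
      · rw [A_block h, zero_smul]; exact zero_mem _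
  have sT : ContDiff ℝ ∞ T := a (a (a (a s1 s2) s3) s4) s5
  have v3 (k : Fin 9) : KVec p k 0 = Pi.single (Sum.inr k) 1 := by simp [KVec, coordField]
  have v4 (k : Fin 9) : KStar p k 0 = 0 := by simp [KStar]
  have v5 (i j : Fin 9) : KRot i j 0 = 0 := by simp [KRot]
  have T0 : T 0 = X 0 := by
    have e : T 0 = X 0 plus • Pi.single plus 1 + X 0 minus • Pi.single minus 1
        + ∑ k, X 0 (Sum.inr k) • (Pi.single (Sum.inr k) 1 : Idx → ℂ) := by
      simp [hT, hT1, hT2, hT3, hT4, hT5, KPlus, KMinus, v3, v4, v5, coordField]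
    rw [e]
    ext m
    rcases m with m | m
    · fin_cases m <;> simp [Finset.sum_apply, plus, minus]
    · simp [Finset.sum_apply, Pi.single_apply, plus, minus]
  have pdT (m : Idx) : pd m T 0 = X 0 plus • pd m KPlus 0 + X 0 minus • pd m KMinus 0
      + ∑ k, X 0 (Sum.inr k) • pd m (KVec p k) 0
      + ∑ k, (pd minus X 0 (Sum.inr k) / B k) • pd m (KStar p k) 0
      + (1 / 2 : ℂ) • ∑ i, ∑ j, A i j • pd m (KRot i j) 0 := by
    rw [hT, pd_fieldAdd (a (a (a s1 s2) s3) s4) s5, pd_fieldAdd (a (a s1 s2) s3) s4,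
      pd_fieldAdd (a s1 s2) s3, pd_fieldAdd s1 s2, hT1, pd_fieldSmul contDiff_KPlus, hT2,
      pd_fieldSmul contDiff_KMinus, hT3, pd_fieldSum _ fun k _ => s3' k, hT4,
      pd_fieldSum _ fun k _ => s4' k, hT5, pd_fieldSmul s5''', pd_fieldSum _ fun i _ => s5'' i]
    simp only [pd_fieldSum _ fun j _ => s5' _ j, pd_fieldSmul (contDiff_KVec p _),
      pd_fieldSmul (contDiff_KStar p _), pd_fieldSmul (contDiff_KRot _ _)]
  have pdT_minus (k : Fin 9) : pd minus T 0 (Sum.inr k) = pd minus X 0 (Sum.inr k) := by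
    have hb : (B k : ℂ) ≠ 0 := by exact_mod_cast hB0 k
    rw [pdT]
    simp [pd_KPlus, pd_KMinus, pd_KVec, pd_KStar, pd_KRot, v3, v4, lam_sq hB, Finset.sum_apply,
      Pi.single_apply, hb]
  have pdT_inr (j k : Fin 9) : pd (Sum.inr j) T 0 (Sum.inr k) = pd (Sum.inr j) X 0 (Sum.inr k) := by
    rw [pdT]
    have q1 (f : Fin 9 → Fin 9 → ℂ) :
        ∑ x, ∑ y, (if j = y ∧ k = x then f x y else 0) = f k j := by simp [ite_and]
    have q2 (f : Fin 9 → Fin 9 → ℂ) :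
        ∑ x, ∑ y, (if j = x ∧ k = y then f x y else 0) = f j k := by
      rw [Finset.sum_comm]; simp [ite_and]
    have e : (∑ i, ∑ l, A i l • pd (Sum.inr j) (KRot i l) 0) (Sum.inr k) = A k j - A j k := by
      simp [pd_KRot, Finset.sum_apply, Pi.single_apply, mul_sub, Finset.sum_sub_distrib,
        ite_apply, ← ite_and, q1, q2]
    simp only [Pi.add_apply, Pi.smul_apply, e]
    simp [pd_KPlus, pd_KMinus, pd_KVec, pd_KStar, Finset.sum_apply, ite_apply]
    rw [A_symm j k]
    ring
  obtain ⟨-, kT⟩ := smooth_and_isKilling hB hTmem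
  have sZ : ContDiff ℝ ∞ (X + (-1 : ℂ) • T) := a sX (c sT _)
  have kZ : IsKilling (cwMetric B) (X + (-1 : ℂ) • T) := hX.add sX (c sT _) (kT.smul sT _)
  have pdZ (m a : Idx) : pd m (fun y => (X + (-1 : ℂ) • T) y a) 0 = pd m X 0 a - pd m T 0 a := by
    rw [d sZ, pd_fieldAdd sX (c sT _), pd_fieldSmul sT]
    simp [sub_eq_add_neg]
  obtain ⟨hu, hf, hv⟩ := (kZ.system sZ).eq_zero hB0 (by simp [T0]) (by simp [T0])
    (fun k => by simp [T0]) (fun k => by rw [pdZ, pdT_minus, sub_self])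
    (fun j k => by rw [pdZ, pdT_inr, sub_self])
  have hZ : X + (-1 : ℂ) • T = 0 := by
    ext x m
    rcases m with m | m
    · fin_cases m
      · exact congrFun hu x
      · exact congrFun hf x
    · exact congrFun (hv m) x
  have hXT : X = T := by rwa [neg_one_smul, add_neg_eq_zero] at hZ
  rw [hXT]
  exact hTmem

/-! ### Indecomposability -/

/-- If `B eᵢ = 0`, then `eᵢ` spans an invariant non-degenerate subspace. -/
theorem IsIndecomposable.ne_zero {B : Fin 9 → ℝ} (h : IsIndecomposable B) (i : Fin 9) :
    B i ≠ 0 := by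
  intro hi
  set e : Idx → ℝ := Pi.single (Sum.inr i) 1 with he
  have hf (z : Idx → ℝ) : z ⬝ᵥ flatForm *ᵥ e = z (Sum.inr i) := by
    rw [he, Matrix.mulVec_single_one]
    simp [dotProduct, flatForm, Matrix.col]
  have h1 (v : Fin 9 → ℝ) (z : Idx → ℝ) (hz : z ∈ ℝ ∙ e) : dualAction B v z ∈ ℝ ∙ e := by
    obtain ⟨c, rfl⟩ := Submodule.mem_span_singleton.1 hz
    have : dualAction B v (c • e) = 0 := by
      rw [dualAction]
      simp only [Matrix.mulVec_smul, dotProduct_smul, hf]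
      simp [hi]
    rw [this]
    exact zero_mem _
  have h2 (z : Idx → ℝ) (hz : z ∈ ℝ ∙ e) (hw : ∀ w ∈ ℝ ∙ e, z ⬝ᵥ flatForm *ᵥ w = 0) : z = 0 := by
    obtain ⟨c, rfl⟩ := Submodule.mem_span_singleton.1 hz
    have := hw e (Submodule.mem_span_singleton_self e)
    rw [hf] at this
    have hc : c = 0 := by simpa [he] using this
    rw [hc, zero_smul]
  rcases h (ℝ ∙ e) h1 h2 with h3 | h3
  · have : e = 0 := by simpa using h3
    have := congrFun this (Sum.inr i)
    simp [he] at this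
  · have : (Pi.single plus 1 : Idx → ℝ) ∈ (ℝ ∙ e) := by rw [h3]; trivial
    obtain ⟨c, hc⟩ := Submodule.mem_span_singleton.1 this
    have := congrFun hc plus
    simp [he] at this

namespace SpinModule

variable (M : SpinModule) (p : Params)

/-! ### The components of the connection and its curvature -/

/-- The endomorphism of `S⁻` in `D_m`. -/
def connA (m : Idx) : Matrix VIdx VIdx ℂ := if m = minus then M.cbar p else 0

/-- The endomorphism of `S⁺` in `D_m`. -/
def connE (m : Idx) : Matrix VIdx VIdx ℂ := if m = minus then M.d p else 0

/-- The constant part of the map `S⁺ → S⁻` in `D_m`. -/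
def connV (m : Idx) : Matrix VIdx VIdx ℂ := Sum.elim 0 (fun i => -(rt / 2) • M.s p i) m

/-- The coefficient of `xᵏ` in the map `S⁺ → S⁻` in `D_m`. -/
def connW (B : Fin 9 → ℝ) (m : Idx) (k : Fin 9) : Matrix VIdx VIdx ℂ :=
  if m = minus then (rt / 2 * B k) • M.γ k else 0

/-- The part of the map `S⁺ → S⁻` in `D_m` that is linear in `x`. -/
def connQ (B : Fin 9 → ℝ) (m : Idx) (x : Pt) : Matrix VIdx VIdx ℂ :=
  ∑ k, (x (Sum.inr k) : ℂ) • M.connW B m k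

variable {p} {B : Fin 9 → ℝ}

theorem sPlus_conn (m : Idx) {ξ : SpinorField} {x : Pt} (h : DifferentiableAt ℝ ξ x) :
    sPlus (M.conn p B m ξ x) = pd m (fun y => sPlus (ξ y)) x + M.connE p m *ᵥ sPlus (ξ x) := by
  rw [conn, sPlus_add, sPlus_nabla, sPlus_pd h]
  congr 1
  rcases m with m | m
  · fin_cases m
    · simp [connE, rho]
    · exact M.sPlus_rho_minus p _
  · rw [sPlus_rho_vec]; simp [connE]

theorem sMinus_conn (m : Idx) {ξ : SpinorField} {x : Pt} (h : DifferentiableAt ℝ ξ x) :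
    sMinus (M.conn p B m ξ x) = pd m (fun y => sMinus (ξ y)) x + M.connA p m *ᵥ sMinus (ξ x)
      + M.connV p m *ᵥ sPlus (ξ x) + M.connQ B m x *ᵥ sPlus (ξ x) := by
  have hQ : M.connQ B m x *ᵥ sPlus (ξ x) = if m = minus then
      (rt / 2) • ∑ k, (B k * x (Sum.inr k) : ℂ) • M.γ k *ᵥ sPlus (ξ x) else 0 := by
    unfold connQ connW
    split_ifs
    · rw [Matrix.sum_mulVec, Finset.smul_sum]
      refine Finset.sum_congr rfl fun k _ => ?_
      rw [Matrix.smul_mulVec, Matrix.smul_mulVec]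
      module
    · simp
  rw [conn, sMinus_add, sMinus_nabla, sMinus_pd h, hQ, add_assoc, add_comm (ite _ _ _), ← add_assoc,
    add_assoc (pd _ _ _) (M.connA p m *ᵥ _)]
  congr 2
  rcases m with m | m
  · fin_cases m
    · simp [connA, connV, rho]
    · change sMinus (M.rho p minus *ᵥ _) = _
      rw [sMinus_rho_minus]; simp [connA, connV]
  · rw [sMinus_rho_vec]
    simp [connA, connV, Matrix.neg_mulVec, Matrix.smul_mulVec]

theorem contDiff_of_halves {ξ : SpinorField} (h1 : ContDiff ℝ ∞ fun x => sMinus (ξ x))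
    (h2 : ContDiff ℝ ∞ fun x => sPlus (ξ x)) : ContDiff ℝ ∞ ξ := by
  refine contDiff_pi.2 fun ⟨i, a⟩ => ?_
  fin_cases i
  · exact contDiff_pi.1 h1 a
  · exact contDiff_pi.1 h2 a

theorem contDiff_sMinus {ξ : SpinorField} (h : ContDiff ℝ ∞ ξ) :
    ContDiff ℝ ∞ fun x => sMinus (ξ x) := sMinusL.contDiff.comp h

theorem contDiff_sPlus {ξ : SpinorField} (h : ContDiff ℝ ∞ ξ) :
    ContDiff ℝ ∞ fun x => sPlus (ξ x) := sPlusL.contDiff.comp h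

theorem contDiff_mulVec (a : Matrix VIdx VIdx ℂ) {g : Pt → VIdx → ℂ} (hg : ContDiff ℝ ∞ g) :
    ContDiff ℝ ∞ fun x => a *ᵥ g x := (mulVecL a).contDiff.comp hg

theorem contDiff_connQ_mulVec (m : Idx) {g : Pt → VIdx → ℂ} (hg : ContDiff ℝ ∞ g) :
    ContDiff ℝ ∞ fun x => M.connQ B m x *ᵥ g x := by
  simp only [connQ, Matrix.sum_mulVec, Matrix.smul_mulVec]
  exact ContDiff.sum fun k _ => (coe_coord_contDiff _).smul (contDiff_mulVec _ hg)

theorem pd_mulVec (a : Matrix VIdx VIdx ℂ) {g : Pt → VIdx → ℂ} (hg : ContDiff ℝ ∞ g) (m : Idx)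
    (x : Pt) : pd m (fun y => a *ᵥ g y) x = a *ᵥ pd m g x :=
  pd_clm m (mulVecL a) (hg.diffAt x)

theorem pd_connQ_mulVec (n : Idx) {g : Pt → VIdx → ℂ} (hg : ContDiff ℝ ∞ g) (m : Idx)
    (x : Pt) : pd m (fun y => M.connQ B n y *ᵥ g y) x = M.connQ B n x *ᵥ pd m g x
      + (Sum.elim 0 (M.connW B n) m : Matrix VIdx VIdx ℂ) *ᵥ g x := by
  simp only [connQ, Matrix.sum_mulVec, Matrix.smul_mulVec]
  have c (k : Fin 9) := contDiff_mulVec (M.connW B n k) hg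
  rw [pd_sum m Finset.univ (f := fun k y => (y (Sum.inr k) : ℂ) • M.connW B n k *ᵥ g y)
    fun k _ => ((coe_coord_contDiff (Sum.inr k)).smul (c k)).diffAt x]
  have e (k : Fin 9) : pd m (fun y => (y (Sum.inr k) : ℂ) • M.connW B n k *ᵥ g y) x
      = (x (Sum.inr k) : ℂ) • M.connW B n k *ᵥ pd m g x
        + if m = Sum.inr k then M.connW B n k *ᵥ g x else 0 := by
    rw [pd_smul m ((coe_coord_contDiff _).diffAt x) ((c k).diffAt x), pd_mulVec _ hg,
      pd_coord_ofReal, ite_smul, one_smul, zero_smul]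
  simp only [e, Finset.sum_add_distrib]
  congr 1
  rcases m with m | m <;> simp

theorem contDiff_conn (m : Idx) {ξ : SpinorField} (h : ContDiff ℝ ∞ ξ) :
    ContDiff ℝ ∞ (M.conn p B m ξ) := by
  have h1 := contDiff_sMinus h
  have h2 := contDiff_sPlus h
  refine contDiff_of_halves ?_ ?_
  · simp only [M.sMinus_conn m (h.diffAt _)]
    exact (((contDiff_pd m h1).add (contDiff_mulVec _ h1)).add (contDiff_mulVec _ h2)).add
      (M.contDiff_connQ_mulVec m h2)
  · simp only [M.sPlus_conn m (h.diffAt _)]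
    exact (contDiff_pd m h2).add (contDiff_mulVec _ h2)

/-- On `S⁺` the connection is flat: only `D₋` has a zeroth order term there. -/
theorem sPlus_conn_conn (m n : Idx) {ξ : SpinorField} (h : ContDiff ℝ ∞ ξ) (x : Pt) :
    sPlus (M.conn p B m (M.conn p B n ξ) x) = sPlus (M.conn p B n (M.conn p B m ξ) x) := by
  have h2 := contDiff_sPlus h
  have key (m n : Idx) : sPlus (M.conn p B m (M.conn p B n ξ) x)
      = pd m (pd n fun y => sPlus (ξ y)) x + M.connE p n *ᵥ pd m (fun y => sPlus (ξ y)) x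
        + (M.connE p m *ᵥ pd n (fun y => sPlus (ξ y)) x
          + M.connE p m *ᵥ (M.connE p n *ᵥ sPlus (ξ x))) := by
    rw [M.sPlus_conn m ((M.contDiff_conn n h).diffAt x)]
    simp only [M.sPlus_conn n (h.diffAt _), Matrix.mulVec_add]
    rw [pd_add m ((contDiff_pd n h2).diffAt x) ((contDiff_mulVec _ h2).diffAt x), pd_mulVec _ h2]
  have c : M.connE p m *ᵥ (M.connE p n *ᵥ sPlus (ξ x))
      = M.connE p n *ᵥ (M.connE p m *ᵥ sPlus (ξ x)) := by
    unfold connE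
    split_ifs <;> simp
  rw [key, key, pd_comm m h2, c]
  abel

/-- The curvature of `D` in the directions `e₋`, `eᵢ`, as a map `S⁺ → S⁻` and up to the factor
`√2 / 2`. -/
def curv (p : Params) (B : Fin 9 → ℝ) (i : Fin 9) : Matrix VIdx VIdx ℂ :=
  M.cbar p * M.s p i - M.s p i * M.d p + (B i : ℂ) • M.γ i

/-- The curvature of `D` is the map `curv` from `S⁺` to `S⁻`. -/
theorem sMinus_conn_conn (m n : Idx) {ξ : SpinorField} (h : ContDiff ℝ ∞ ξ) (x : Pt) :
    sMinus (M.conn p B m (M.conn p B n ξ) x) = sMinus (M.conn p B n (M.conn p B m ξ) x)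
      + (rt / 2) • ((if n = minus then
          (Sum.elim 0 (M.curv p B) m : Matrix VIdx VIdx ℂ) *ᵥ sPlus (ξ x) else 0)
        - if m = minus then
          (Sum.elim 0 (M.curv p B) n : Matrix VIdx VIdx ℂ) *ᵥ sPlus (ξ x) else 0) := by
  have h1 := contDiff_sMinus h
  have h2 := contDiff_sPlus h
  have key (m n : Idx) : sMinus (M.conn p B m (M.conn p B n ξ) x)
      = pd m (pd n fun y => sMinus (ξ y)) x + M.connA p n *ᵥ pd m (fun y => sMinus (ξ y)) x
        + M.connV p n *ᵥ pd m (fun y => sPlus (ξ y)) x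
        + (M.connQ B n x *ᵥ pd m (fun y => sPlus (ξ y)) x
          + (Sum.elim 0 (M.connW B n) m : Matrix VIdx VIdx ℂ) *ᵥ sPlus (ξ x))
        + (M.connA p m *ᵥ pd n (fun y => sMinus (ξ y)) x
          + M.connA p m *ᵥ (M.connA p n *ᵥ sMinus (ξ x))
          + M.connA p m *ᵥ (M.connV p n *ᵥ sPlus (ξ x))
          + M.connA p m *ᵥ (M.connQ B n x *ᵥ sPlus (ξ x)))
        + (M.connV p m *ᵥ pd n (fun y => sPlus (ξ y)) x
          + M.connV p m *ᵥ (M.connE p n *ᵥ sPlus (ξ x)))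
        + (M.connQ B m x *ᵥ pd n (fun y => sPlus (ξ y)) x
          + M.connQ B m x *ᵥ (M.connE p n *ᵥ sPlus (ξ x))) := by
    rw [M.sMinus_conn m ((M.contDiff_conn n h).diffAt x)]
    simp only [M.sMinus_conn n (h.diffAt _), M.sPlus_conn n (h.diffAt _), Matrix.mulVec_add]
    rw [pd_add m ((((contDiff_pd n h1).add (contDiff_mulVec _ h1)).add
        (contDiff_mulVec _ h2)).diffAt x) ((M.contDiff_connQ_mulVec n h2).diffAt x),
      pd_add m (((contDiff_pd n h1).add (contDiff_mulVec _ h1)).diffAt x)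
        ((contDiff_mulVec _ h2).diffAt x),
      pd_add m ((contDiff_pd n h1).diffAt x) ((contDiff_mulVec _ h1).diffAt x),
      pd_mulVec _ h1, pd_mulVec _ h2, M.pd_connQ_mulVec n h2]
  rw [key, key, pd_comm m h1]
  have q0 (m : Idx) (hm : m ≠ minus) : M.connQ B m x = 0 := by simp [connQ, connW, hm]
  rcases m with m | m <;> rcases n with n | n
  · fin_cases m <;> fin_cases n <;>
      simp [connA, connE, connV, q0, -Matrix.mulVec_mulVec]
  · fin_cases m
    · simp [connA, connE, connV, connW, q0, -Matrix.mulVec_mulVec]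
    · simp only [Fin.mk_one, connA, connE, connV, q0 (Sum.inr n) (by simp), connW, curv,
        Sum.elim_inr, Sum.elim_inl, Pi.zero_apply, if_true, reduceCtorEq, if_false,
        Matrix.zero_mulVec, Matrix.mulVec_zero, Matrix.smul_mulVec, Matrix.add_mulVec,
        Matrix.sub_mulVec, ← Matrix.mulVec_mulVec, Matrix.mulVec_smul]
      module
  · fin_cases n
    · simp [connA, connE, connV, connW, q0, -Matrix.mulVec_mulVec]
    · simp only [Fin.mk_one, connA, connE, connV, q0 (Sum.inr m) (by simp), connW, curv,
        Sum.elim_inr, Sum.elim_inl, Pi.zero_apply, if_true, reduceCtorEq, if_false,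
        Matrix.zero_mulVec, Matrix.mulVec_zero, Matrix.smul_mulVec, Matrix.add_mulVec,
        Matrix.sub_mulVec, ← Matrix.mulVec_mulVec, Matrix.mulVec_smul]
      module
  · simp only [connA, connE, connV, q0 (Sum.inr _) (by simp), connW, Sum.elim_inr, reduceCtorEq,
      if_false, Matrix.zero_mulVec, Matrix.mulVec_zero]
    module

/-- The curvature vanishes on the image of `X⁺` and is a scalar times `γᵢ` on the image of `X⁻`. -/
theorem curv_mulVec (hB : ∀ i, (B i : ℂ) = -(p.μ i) ^ 2) (i : Fin 9) :
    ∃ r : ℂ, ∀ v, M.curv p B i *ᵥ v = r • M.γ i *ᵥ (M.Xm *ᵥ v) := by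
  refine ⟨((p.αp + p.αm) / 2 + sign1234 i * -1 * ((p.αp - p.αm) / 2)
      - sign125 i * ((p.αp' + p.αm') / 2 + -1 * ((p.αp' - p.αm') / 2))) ^ 2 + B i, fun v => ?_⟩
  have w2 : M.γ1234 *ᵥ (M.γ1234 *ᵥ v) = v := by
    rw [Matrix.mulVec_mulVec, γ1234_sq, Matrix.one_mulVec]
  have hm : M.γ1234 *ᵥ (M.Xm *ᵥ v) = (-1 : ℂ) • M.Xm *ᵥ v := by
    simp only [Xm, Matrix.smul_mulVec, Matrix.sub_mulVec, Matrix.one_mulVec, Matrix.mulVec_smul,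
      Matrix.mulVec_sub, w2]
    module
  have hp : M.γ1234 *ᵥ (M.Xp *ᵥ v) = M.Xp *ᵥ v := by
    simp only [Xp, Matrix.smul_mulVec, Matrix.add_mulVec, Matrix.one_mulVec, Matrix.mulVec_smul,
      Matrix.mulVec_add, w2]
    module
  have hv : v = M.Xp *ᵥ v + M.Xm *ᵥ v := by
    simp only [Xp, Xm, Matrix.smul_mulVec, Matrix.add_mulVec, Matrix.sub_mulVec, Matrix.one_mulVec]
    module
  have e (w : VIdx → ℂ) : M.curv p B i *ᵥ w = M.cbar p *ᵥ (M.s p i *ᵥ w)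
      - M.s p i *ᵥ (M.d p *ᵥ w) + (B i : ℂ) • M.γ i *ᵥ w := by
    rw [curv, Matrix.add_mulVec, Matrix.sub_mulVec, ← Matrix.mulVec_mulVec, ← Matrix.mulVec_mulVec,
      Matrix.smul_mulVec]
  conv_lhs => rw [hv, Matrix.mulVec_add]
  rw [e, e, M.cbar_s_sub_s_d p hp, M.cbar_s_sub_s_d_of_eigen p hm, hB]
  module

/-! ### Uniqueness of parallel spinor fields -/

end SpinModule

/-- The derivative of `f` along the ray through `x`. -/
theorem hasDerivAt_line {F : Type*} [NormedAddCommGroup F] [NormedSpace ℝ F] {f : Pt → F}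
    (hf : ContDiff ℝ ∞ f) (x : Pt) (t : ℝ) :
    HasDerivAt (fun t : ℝ => f (t • x)) (∑ m, x m • pd m f (t • x)) t := by
  have h1 : HasDerivAt (fun t : ℝ => t • x) x t := by
    simpa using (hasDerivAt_id t).smul_const x
  have h2 := (hf.diffAt (t • x)).hasFDerivAt.comp_hasDerivAt t h1
  have e (L : Pt →L[ℝ] F) : L x = ∑ m, x m • L (Pi.single m 1) := by
    conv_lhs => rw [← Finset.univ_sum_single x, map_sum]
    refine Finset.sum_congr rfl fun m _ => ?_
    rw [← map_smul]
    congr 1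
    ext n
    by_cases h : n = m <;> simp [h]
  exact h2.congr_deriv (e _)

namespace SpinModule

variable (M : SpinModule) {p : Params} {B : Fin 9 → ℝ}

/-- Parallel spinor fields are determined by their value at the origin: along the ray through a
point, the `S⁺`-component solves a linear ordinary differential equation, and so does then the
difference of the `S⁻`-components. -/
theorem eq_of_isParallel {ξ η : SpinorField} (hξ : IsParallel (M.conn p B) ξ)
    (hη : IsParallel (M.conn p B) η) (h0 : ξ 0 = η 0) : ξ = η := by
  have eP {ξ : SpinorField} (hξ : IsParallel (M.conn p B) ξ) (m : Idx) (x : Pt) :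
      pd m (fun y => sPlus (ξ y)) x = -(M.connE p m *ᵥ sPlus (ξ x)) := by
    have h := M.sPlus_conn (p := p) (B := B) m (hξ.1.diffAt x)
    rw [hξ.2 m] at h
    exact eq_neg_of_add_eq_zero_left h.symm
  have eM {ξ : SpinorField} (hξ : IsParallel (M.conn p B) ξ) (m : Idx) (x : Pt) :
      pd m (fun y => sMinus (ξ y)) x = -(M.connA p m *ᵥ sMinus (ξ x))
        - (M.connV p m *ᵥ sPlus (ξ x) + M.connQ B m x *ᵥ sPlus (ξ x)) := by
    have h := M.sMinus_conn (p := p) (B := B) m (hξ.1.diffAt x)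
    rw [hξ.2 m, add_assoc, add_assoc] at h
    rw [eq_neg_of_add_eq_zero_left h.symm]
    abel
  have e2 (x : Pt) : sPlus (ξ x) = sPlus (η x) := by
    have d {ξ : SpinorField} (hξ : IsParallel (M.conn p B) ξ) (t : ℝ) :
        HasDerivAt (fun t : ℝ => sPlus (ξ (t • x)))
          ((∑ m, (x m : ℂ) • -M.connE p m) *ᵥ sPlus (ξ (t • x))) t := by
      refine (hasDerivAt_line (contDiff_sPlus hξ.1) x t).congr_deriv ?_
      rw [Matrix.sum_mulVec]
      refine Finset.sum_congr rfl fun m _ => ?_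
      rw [eP hξ, Matrix.smul_mulVec, Matrix.neg_mulVec, Complex.coe_smul]
    have h := congrFun (eq_of_hasDerivAt_mulVec (d hξ) (d hη) (by simp [h0])) 1
    simpa using h
  ext x : 1
  refine spinor_ext ?_ (e2 x)
  have d (t : ℝ) : HasDerivAt (fun t : ℝ => sMinus (ξ (t • x)) - sMinus (η (t • x)))
      ((∑ m, (x m : ℂ) • -M.connA p m) *ᵥ (sMinus (ξ (t • x)) - sMinus (η (t • x)))) t := by
    refine ((hasDerivAt_line (contDiff_sMinus hξ.1) x t).sub
      (hasDerivAt_line (contDiff_sMinus hη.1) x t)).congr_deriv ?_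
    rw [Matrix.sum_mulVec, ← Finset.sum_sub_distrib]
    refine Finset.sum_congr rfl fun m _ => ?_
    rw [eM hξ, eM hη, e2, Matrix.smul_mulVec, Matrix.neg_mulVec, Complex.coe_smul,
      Matrix.mulVec_sub]
    module
  have h := congrFun (eq_of_hasDerivAt_mulVec d (g := fun _ => 0)
    (fun t => by rw [Matrix.mulVec_zero]; exact hasDerivAt_const t 0) (by simp [h0])) 1
  simpa [sub_eq_zero] using h

/-- If `D` is not flat, some scalar in `curv_mulVec` is non-zero. The value of a parallel spinor
field at the origin is annihilated by the curvature, and hence belongs to the space of constants. -/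
theorem mem_oddPart_of_isParallel (hB : ∀ i, (B i : ℂ) = -(p.μ i) ^ 2)
    (hD : ¬ IsFlat (M.conn p B)) {ξ : SpinorField} (hξ : IsParallel (M.conn p B) ξ) :
    ξ ∈ M.oddPart p := by
  choose r hr using M.curv_mulVec hB
  -- If all scalars vanish, then so does the curvature.
  obtain ⟨i, hi⟩ : ∃ i, r i ≠ 0 := by
    by_contra! h
    have hc : M.curv p B = 0 := funext fun i => Matrix.mulVec_injective (funext fun v => by
      rw [hr, h, zero_smul, Pi.zero_apply, Matrix.zero_mulVec])
    refine hD fun η hη m n => funext fun x => spinor_ext ?_ (M.sPlus_conn_conn m n hη x)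
    rw [M.sMinus_conn_conn m n hη x, hc]
    have z (m : Idx) : (Sum.elim 0 0 m : Matrix VIdx VIdx ℂ) = 0 := by cases m <;> rfl
    simp [z]
  have h0 (m n : Idx) : M.conn p B m (M.conn p B n ξ) 0 = 0 := by
    have hc : M.conn p B m 0 = 0 := by
      have h := M.parField_smul (p := p) 0 0
      rw [smul_zero, zero_smul] at h
      have h' := M.conn_parField hB (zero_mem M.constants) m
      rwa [h] at h'
    rw [hξ.2 n, hc, Pi.zero_apply]
  have h := M.sMinus_conn_conn (p := p) (B := B) (Sum.inr i) minus hξ.1 0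
  rw [h0, h0] at h
  simp only [sMinus_zero, if_true, reduceCtorEq, if_false, Sum.elim_inr, zero_add, sub_zero, hr,
    smul_smul] at h
  have hk : M.γ i *ᵥ (M.Xm *ᵥ sPlus (ξ 0)) = 0 :=
    (smul_eq_zero.1 h.symm).resolve_left
      (mul_ne_zero (div_ne_zero rt_ne_zero two_ne_zero) hi)
  have hm : ξ 0 ∈ M.constants := by
    rw [mem_constants_iff, ← Xm_mulVec_eq_zero_iff, ← neg_eq_zero, ← M.γ_γ_self_mulVec i, hk,
      Matrix.mulVec_zero]
  exact ⟨ξ 0, hm, M.eq_of_isParallel hξ (M.isParallel_parField hB hm) (M.parField_zero p _).symm⟩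

/-! ### The dimension of the odd part -/

variable (p) in
/-- A field in the odd part corresponds to its value at the origin. -/
def oddEquiv : M.constants ≃ₗ[ℂ] M.oddPart p where
  toFun ζ := ⟨M.parField p ζ, ζ, ζ.2, rfl⟩
  map_add' ζ θ := Subtype.ext (M.parField_add _ _)
  map_smul' c ζ := Subtype.ext (M.parField_smul _ _)
  invFun ξ := ⟨ξ.1 0, by
    obtain ⟨ζ, hζ, h⟩ := ξ.2
    rw [h, parField_zero]
    exact hζ⟩
  left_inv ζ := Subtype.ext (M.parField_zero p ζ)
  right_inv ξ := by
    obtain ⟨_, ζ, hζ, rfl⟩ := ξ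
    exact Subtype.ext (congrArg (M.parField p) (M.parField_zero p ζ))

/-- The space of constants is the kernel of an idempotent of trace `8`. -/
theorem finrank_constants : Module.finrank ℂ M.constants = 24 := by
  set P : Matrix SIdx SIdx ℂ := liftV M.Xm * projPlus with hP
  have hX : M.Xm * M.Xm = M.Xm := by
    rw [Xm, Matrix.smul_mul, Matrix.mul_smul, sub_mul, mul_sub, mul_sub, γ1234_sq]
    simp only [one_mul, mul_one]
    module
  have hPk : P = (!![0, 0; 0, 1] : Matrix (Fin 2) (Fin 2) ℂ) ⊗ₖ M.Xm := by
    rw [hP, liftV, projPlus, ← Matrix.mul_kronecker_mul, one_mul, mul_one]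
  have hPP : P * P = P := by
    rw [hPk, ← Matrix.mul_kronecker_mul, hX]
    congr 1
    ext i j; fin_cases i <;> fin_cases j <;> simp
  have hproj : LinearMap.IsProj M.constants (Matrix.toLin' (1 - P)) := by
    refine ⟨fun ζ => ?_, fun ζ hζ => ?_⟩
    · change P *ᵥ _ = 0
      rw [Matrix.toLin'_apply, Matrix.mulVec_mulVec, mul_sub, hPP, mul_one, sub_self,
        Matrix.zero_mulVec]
    · have : P *ᵥ ζ = 0 := hζ
      rw [Matrix.toLin'_apply, Matrix.sub_mulVec, this, Matrix.one_mulVec, sub_zero]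
  have ht := hproj.trace
  rw [Matrix.trace_toLin'_eq, Matrix.trace_sub, hPk, Matrix.trace_kronecker, Xm,
    Matrix.trace_smul, Matrix.trace_sub, trace_γ1234, Matrix.trace_one, Matrix.trace_one] at ht
  have h24 : (Module.finrank ℂ M.constants : ℂ) = 24 := by
    rw [← ht]
    simp [Matrix.trace]
    norm_num
  exact_mod_cast h24

variable (p) in
theorem finrank_oddPart : Module.finrank ℂ (M.oddPart p) = 24 := by
  rw [← (M.oddEquiv p).finrank_eq, finrank_constants]

end SpinModule

namespace SpinModule

variable (M : SpinModule) {p : Params} {B : Fin 9 → ℝ}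

/-! ### The superalgebra -/

theorem mem_oddPart_parField {ζ : Spinor} (h : ζ ∈ M.constants) : M.parField p ζ ∈ M.oddPart p :=
  ⟨ζ, h, rfl⟩

/-- A field in the odd part is recovered from its value at the origin, which is its tuple of
constants. -/
theorem parField_apply_zero {ξ : SpinorField} (h : ξ ∈ M.oddPart p) :
    ξ 0 ∈ M.constants ∧ M.parField p (ξ 0) = ξ := by
  obtain ⟨ζ, hζ, rfl⟩ := h
  rw [parField_zero]
  exact ⟨hζ, rfl⟩

variable {M}

theorem Represents.spinLie_of_mem {X : VectorField} {R : Matrix SIdx SIdx ℂ}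
    (hX : M.Represents p B X R) {ξ : SpinorField} (h : ξ ∈ M.oddPart p) :
    M.spinLie B X ξ = M.parField p (-(R *ᵥ ξ 0)) := by
  obtain ⟨h0, h1⟩ := M.parField_apply_zero h
  have := hX.spinLie_eq _ h0
  rwa [h1, ← parField_neg] at this

theorem Represents.spinLie_mem {X : VectorField} {R : Matrix SIdx SIdx ℂ}
    (hX : M.Represents p B X R) {ξ : SpinorField} (h : ξ ∈ M.oddPart p) :
    M.spinLie B X ξ ∈ M.oddPart p := by
  rw [hX.spinLie_of_mem h]
  exact M.mem_oddPart_parField (neg_mem (hX.compat.1 _ (M.parField_apply_zero h).1))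

variable (M)

/-- The action of the even part on the odd part by the spinorial Lie derivative. -/
def lieAction (hB : ∀ i, (B i : ℂ) = -(p.μ i) ^ 2) (hB0 : ∀ i, B i ≠ 0) :
    killingAlgebra p →ₗ[ℂ] Module.End ℂ (M.oddPart p) where
  toFun X :=
    { toFun := fun ξ => ⟨M.spinLie B X ξ,
        (M.exists_represents hB hB0 X.2).choose_spec.spinLie_mem ξ.2⟩
      map_add' := fun ξ η => Subtype.ext <| by
        obtain ⟨R, hR⟩ := M.exists_represents hB hB0 X.2
        change M.spinLie B X (ξ + η : M.oddPart p) = M.spinLie B X ξ + M.spinLie B X η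
        rw [hR.spinLie_of_mem ξ.2, hR.spinLie_of_mem η.2, hR.spinLie_of_mem (ξ + η).2,
          ← parField_add, ← neg_add, ← Matrix.mulVec_add]
        rfl
      map_smul' := fun c ξ => Subtype.ext <| by
        obtain ⟨R, hR⟩ := M.exists_represents hB hB0 X.2
        change M.spinLie B X (c • ξ : M.oddPart p) = c • M.spinLie B X ξ
        rw [hR.spinLie_of_mem ξ.2, hR.spinLie_of_mem (c • ξ).2, ← parField_smul, smul_neg,
          ← Matrix.mulVec_smul]
        rfl }
  map_add' X Y := LinearMap.ext fun ξ => Subtype.ext <|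
    M.spinLie_add (smooth_and_isKilling hB X.2).1 (smooth_and_isKilling hB Y.2).1 ξ
  map_smul' c X := LinearMap.ext fun ξ => Subtype.ext <|
    M.spinLie_smul (smooth_and_isKilling hB X.2).1 c ξ

variable (p B) in
/-- The odd-odd bracket. The constants of a field in the odd part are its value at the origin. -/
def oddPairing : M.oddPart p →ₗ[ℂ] M.oddPart p →ₗ[ℂ] killingAlgebra p :=
  LinearMap.mk₂ ℂ
    (fun ξ η => ⟨M.oddBracket p B (ξ.1 0) (η.1 0), M.oddBracket_mem _ _⟩)
    (fun _ _ _ => Subtype.ext (M.oddBracket_add_left _ _ _))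
    (fun _ _ _ => Subtype.ext (M.oddBracket_smul_left _ _ _))
    (fun _ _ _ => Subtype.ext (M.oddBracket_add_right _ _ _))
    (fun _ _ _ => Subtype.ext (M.oddBracket_smul_right _ _ _))

/-- The geometric superalgebra on the Cahen–Wallach space. -/
def superalgebra (hB : ∀ i, (B i : ℂ) = -(p.μ i) ^ 2) (hB0 : ∀ i, B i ≠ 0) :
    GeometricSuperalgebra (cwMetric B) (M.conn p B) where
  even := killingAlgebra p
  even_smooth _ hX := (smooth_and_isKilling hB hX).1
  even_killing _ hX := (smooth_and_isKilling hB hX).2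
  even_commutator _ hX _ hY := by
    obtain ⟨R, S, -, -, h⟩ := M.exists_representsBracket hB hB0 hX hY
    exact h.mem
  odd := M.oddPart p
  odd_parallel := by
    rintro _ ⟨ζ, hζ, rfl⟩
    exact M.isParallel_parField hB hζ
  action := M.lieAction hB hB0
  action_commutator X Y := LinearMap.ext fun ξ => Subtype.ext <| by
    obtain ⟨R, S, hR, hS, h⟩ := M.exists_representsBracket hB hB0 X.2 Y.2
    change M.spinLie B (commutator X Y) ξ
      = M.spinLie B X (M.spinLie B Y ξ) - M.spinLie B Y (M.spinLie B X ξ)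
    rw [hR.spinLie_of_mem (hS.spinLie_mem ξ.2), hS.spinLie_of_mem (hR.spinLie_mem ξ.2),
      hR.spinLie_of_mem ξ.2, hS.spinLie_of_mem ξ.2, h.spinLie_of_mem ξ.2, parField_zero,
      parField_zero, Matrix.mulVec_neg, Matrix.mulVec_neg, neg_neg, neg_neg, Matrix.sub_mulVec,
      neg_sub, sub_eq_add_neg, parField_add, parField_neg, ← sub_eq_add_neg, Matrix.mulVec_mulVec,
      Matrix.mulVec_mulVec]
  pairing := M.oddPairing p B
  pairing_symm _ _ := Subtype.ext (M.oddBracket_comm _ _)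
  pairing_compat X ξ η := by
    obtain ⟨R, hR⟩ := M.exists_represents hB hB0 X.2
    change commutator X (M.oddBracket p B (ξ.1 0) (η.1 0))
      = M.oddBracket p B (M.spinLie B X ξ 0) (η.1 0) + M.oddBracket p B (ξ.1 0) (M.spinLie B X η 0)
    have hl (ζ θ : Spinor) : M.oddBracket p B (-ζ) θ = -M.oddBracket p B ζ θ := by
      simpa using M.oddBracket_smul_left (p := p) (B := B) (-1) ζ θ
    have hr (ζ θ : Spinor) : M.oddBracket p B ζ (-θ) = -M.oddBracket p B ζ θ := by
      simpa using M.oddBracket_smul_right (p := p) (B := B) (-1) ζ θ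
    rw [hR.spinLie_of_mem ξ.2, hR.spinLie_of_mem η.2, parField_zero, parField_zero, hl, hr,
      hR.compat.2 _ (M.parField_apply_zero ξ.2).1 _ (M.parField_apply_zero η.2).1, neg_add]

end SpinModule

end CahenWallach

end

theorem mainTheorem2 (M : CahenWallach.SpinModule) (p : CahenWallach.Params) (B : Fin 9 → ℝ)
    (hB : ∀ i, (B i : ℂ) = -(p.μ i) ^ 2) (hind : CahenWallach.IsIndecomposable B) :
    ∃ A : CahenWallach.GeometricSuperalgebra (CahenWallach.cwMetric B) (M.conn p B),
      -- the even part
      A.even = CahenWallach.killingAlgebra p ∧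
      (∀ X ∈ A.even, star X ∈ A.even) ∧
      ((∀ i j, B i = B j → CahenWallach.block i = CahenWallach.block j) →
        ∀ X, ContDiff ℝ ∞ X → CahenWallach.IsKilling (CahenWallach.cwMetric B) X → X ∈ A.even) ∧
      -- the odd part
      A.odd = M.oddPart p ∧
      Module.finrank ℂ A.odd = 24 ∧
      (¬ CahenWallach.IsFlat (M.conn p B) → A.IsNonRestricted) ∧
      -- the even-odd bracket
      (∀ (X : A.even) (ξ : A.odd),
        (A.action X ξ : CahenWallach.SpinorField) = M.spinLie B X ξ) ∧
      (∀ ζ ∈ M.constants,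
        M.spinLie B CahenWallach.KPlus (M.parField p ζ) = 0 ∧
        M.spinLie B CahenWallach.KMinus (M.parField p ζ)
          = -M.parField p (M.rho p CahenWallach.minus *ᵥ ζ) ∧
        (∀ i, M.spinLie B (CahenWallach.KVec p i) (M.parField p ζ)
          = -M.parField p (M.rho p (Sum.inr i) *ᵥ ζ)) ∧
        (∀ i, M.spinLie B (CahenWallach.KStar p i) (M.parField p ζ)
          = -M.parField p (M.rhoStar B i *ᵥ ζ)) ∧
        (∀ i j, CahenWallach.block i = CahenWallach.block j →
          M.spinLie B (CahenWallach.KRot i j) (M.parField p ζ)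
            = -M.parField p (M.rhoRot i j *ᵥ ζ))) ∧
      -- the odd-odd bracket
      (∀ (ξ η : A.odd) (ζ θ : CahenWallach.Spinor),
        (ξ : CahenWallach.SpinorField) = M.parField p ζ →
        (η : CahenWallach.SpinorField) = M.parField p θ →
        (A.pairing ξ η : CahenWallach.VectorField) = M.oddBracket p B ζ θ) := by
  have hB0 := hind.ne_zero
  refine ⟨M.superalgebra hB hB0, rfl, fun X hX => CahenWallach.star_mem_killingAlgebra hB hX,
    fun hblock X sX hX => hX.mem_killingAlgebra hB hB0 hblock sX, rfl, M.finrank_oddPart p,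
    fun hD ξ hξ => M.mem_oddPart_of_isParallel hB hD hξ, fun X ξ => rfl,
    fun ζ hζ => ⟨M.spinLie_KPlus hB hζ, M.spinLie_KMinus hB hζ, M.spinLie_KVec hB hζ,
      M.spinLie_KStar hB hζ, fun i j h => M.spinLie_KRot hB hζ h⟩,
    fun ξ η ζ θ hξ hη => ?_⟩
  change M.oddBracket p B (ξ.1 0) (η.1 0) = _
  rw [hξ, hη, M.parField_zero, M.parField_zero]
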